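/- **Setting.** Let $E=(E^0,E^1,r,s)$ be a countable directed graph that is locally finite (every vertex emits and receives finitely many edges) and has no sources. Let $M\subset E$ be a zhyvot: a subgraph such that $M$ has no sources (every vertex of $M$ is the range of an edge of $M$), every vertex of $E$ is the range of a path starting in $M$, and every path starting outside $M$ ends outside $M$. Assume that outside $M$ the graph is a union of trees emanating from the vertices of $M$, that is, every edge $e\notin M$ has $r(e)\notin M$, and every vertex outside $M$ receives exactly one edge. For a finite path $\mu$ (vertices being paths without edges), let $|\mu|_\sigma$ be the number of edges of $\mu$ that lie in $M$, and for $v\in E^0$, $m>0$, let $|v|_m$ be the number of paths $\mu$ with $|\mu|_\sigma=m$ and $r(\mu)=v$. Let $0<\lambda<1$ and let $g:E^0\to[0,\infty)$ be such that $$g(v)=\lambda\sum_{s(e)=v,\ e\in M}g(r(e))+\sum_{s(e)=v,\ e\notin M}g(r(e))$$ for every vertex $v$ that is not a sink. Let $A=C^*(E)$ be the graph $C^*$-algebra, the universal $C^*$-algebra generated by mutually orthogonal projections $p_v$ and partial isometries $S_e$ with $S_e^*S_e=p_{r(e)}$, and $p_v=\sum_{s(e)=v}S_eS_e^*$ if $v$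 is not a sink. Write $S_\mu=S_{e_1}\cdots S_{e_n}$ for $\mu=e_1\cdots e_n$, $S_v=p_v$, and $A_c=\operatorname{span}\{S_\mu S_\nu^*\}$. The zhyvot action $\sigma:\mathbb T\to\operatorname{Aut}(A)$ is given by $\sigma_z(p_v)=p_v$, $\sigma_z(S_e)=zS_e$ for $e\in M$, and $\sigma_z(S_e)=S_e$ for $e\notin M$. Let $F=A^\sigma$, let $\Phi(a)=\frac1{2\pi}\int_0^{2\pi}\sigma_{e^{i\theta}}(a)\,d\theta$, and let $X$ be the Hilbert $F$-module completion of $A$ for $(a|b)=\Phi(a^*b)$, on which $A$ acts by left multiplication; $\Theta_{x,y}z=x(y|z)$. Let $\mathcal D$ be the closure of the operator on $A_c\subset X$ with $\mathcal D S_\mu S_\nu^*=(|\mu|_\sigma-|\nu|_\sigma)S_\mu S_\nu^*$. Let $\phi$ be the positive functional on $A_c$ with $\phi(S_\mu S_\nu^*)=\delta_{\mu,\nu}\lambda^{|\mu|_\sigma}g(r(\mu))$, let $\mathcal H$ be the completion of $A_c$ for $\langle a,b\rangle=\phi(a^*b)$, and write $\mathcal D$ also for the self-adjoint operator on $\mathcal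 H$ given by the same formula on $A_c$. Endomorphisms of $X$ act on $\mathcal H$ through the common dense subspace $A_c$. Let $\mathcal N=(\operatorname{End}^0_F(X))''$ be the von Neumann algebra generated on $\mathcal H$ by the compact endomorphisms of $X$, let $\operatorname{Tr}_\phi$ be its natural trace, $\operatorname{Tr}_\phi(\Theta_{x,x})=\phi((x|x))$, explicitly $$\operatorname{Tr}_\phi(T)=\sup\Big\{\sum_i\langle\xi_i,T\xi_i\rangle:\ \xi_1,\dots,\xi_n\in A_c,\ \sum_i\Theta_{\xi_i,\xi_i}\le1\Big\}\qquad(T\ge0),$$ let $\phi_{\mathcal D}(T)=\operatorname{Tr}_\phi(\lambda^{\mathcal D}T)$, and let $\mathcal M\subset\mathcal N$ be the fixed point algebra of its modular group, that is, the set of those elements of $\mathcal N$ that commute with all $\lambda^{it\mathcal D}$, $t\in\mathbb R$. **Proposition.** The operator $\mathcal D$ on $X$ has spectral projections $\Phi_m$, $m\in\mathbb Z$: they are mutually orthogonal projections in the adjointable operators on $X$, $\sum_m\Phi_mx=x$ for all $x\in X$, and $x\in\operatorname{dom}\mathcal D$ with $\mathcal Dx=y$ if and only if $\Phi_my=m\Phi_mx$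 for all $m$. They can be represented as follows, where infinite sums converge strictly (unconditionally in norm, at every $x\in X$). 1. For $m>0$, $$\Phi_m=\sum_{\substack{|\mu|_\sigma=m\\ s(\mu)\in M,\ r(\mu)\in M}}\Theta_{S_\mu,S_\mu}.$$ 2. For $m=0$, $$\Phi_0=\sum_{v\in E^0}\Theta_{p_v,p_v}.$$ 3. For $m<0$ and $v\in E^0$, one has $0<|v|_{|m|}<\infty$ and $$p_v\Phi_m=\frac1{|v|_{|m|}}\sum_{\substack{|\mu|_\sigma=|m|\\ r(\mu)=v}}\Theta_{S_\mu^*,S_\mu^*}.$$ In all cases, let $q\in A$ be a projection with $q\le p_v$ for a vertex $v$ (for instance $q=p_v$). Then $q\Phi_m$ is a finite rank endomorphism of $X$, that is, a finite sum of operators $\Theta_{x,y}$. If moreover $q\in F$, then $q\Phi_m$ acts on $\mathcal H$ as a bounded positive operator that belongs to $\mathcal M\subset\mathcal N$ and lies in the domain of $\phi_{\mathcal D}$: $\phi_{\mathcal D}(q\Phi_m)<\infty$. -/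

import Mathlib

open scoped ENNReal ComplexOrder

universe u

noncomputable section

/-- A locally finite directed graph: source and range maps such that every vertex emits, and
receives, only finitely many edges. -/
structure LFGraph (V Edge : Type u) where
  s : Edge → V
  r : Edge → V
  finite_out : ∀ v, {e | s e = v}.Finite
  finite_in : ∀ v, {e | r e = v}.Finite

theorem starHom_continuous {A B : Type*} [NonUnitalCStarAlgebra A] [NonUnitalCStarAlgebra B]
    (π : A →⋆ₙₐ[ℂ] B) : Continuous π :=
  AddMonoidHomClass.continuous_of_bound π 1 fun a => by
    simpa using NonUnitalStarAlgHom.norm_apply_le π a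

namespace LFGraph

variable {V Edge : Type u} (G : LFGraph V Edge)

/-- `G.IsWalk v l`: the list `l = [e₁, …, eₙ]` satisfies `s e₁ = v` and `r eᵢ = s eᵢ₊₁`. -/
def IsWalk : V → List Edge → Prop
  | _, [] => True
  | v, e :: l => G.s e = v ∧ IsWalk (G.r e) l

/-- The end vertex of a walk that starts at `v`. -/
def walkEnd : V → List Edge → V
  | v, [] => v
  | _, e :: l => walkEnd (G.r e) l

/-- A finite path; the paths without edges are the vertices. -/
@[ext]
structure Path where
  src : V
  edges : List Edge
  isWalk : G.IsWalk src edges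

variable {G} in
/-- The range of a path. -/
def Path.rng (μ : G.Path) : V := G.walkEnd μ.src μ.edges

/-- A sink emits no edge. -/
def IsSink (v : V) : Prop := ∀ e, G.s e ≠ v

/-- The finite set of the edges emitted by `v`. -/
def out (v : V) : Finset Edge := (G.finite_out v).toFinset

theorem mem_out {v : V} {e : Edge} : e ∈ G.out v ↔ G.s e = v := by simp [out]

/-- A subgraph: a set of vertices and a set of edges with both ends among these vertices. -/
structure Sub where
  verts : Set V
  edges : Set Edge
  src_mem : ∀ e ∈ edges, G.s e ∈ verts
  rng_mem : ∀ e ∈ edges, G.r e ∈ verts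

variable {G}

/-- `M` is a zhyvot of the graph `G` (which has no sources): `M` has no sources, every vertex of `G`
is the range of a path that starts in `M`, and a path that starts outside `M` ends outside `M`. -/
structure IsZhyvot (M : G.Sub) : Prop where
  graph_noSource : ∀ v, ∃ e, G.r e = v
  noSource : ∀ v ∈ M.verts, ∃ e ∈ M.edges, G.r e = v
  reach : ∀ v, ∃ μ : G.Path, μ.src ∈ M.verts ∧ μ.rng = v
  leave : ∀ μ : G.Path, μ.src ∉ M.verts → μ.rng ∉ M.verts

/-- Outside `M` the graph is a union of trees which emanate from the vertices of `M`: an edge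
that is not in `M` ends outside `M`, and a vertex outside `M` receives exactly one edge.
(Together with `IsZhyvot.reach` this says that the edges outside `M` form disjoint trees, oriented
away from their roots, and that the roots are vertices of `M`.) -/
structure HasExteriorTrees (M : G.Sub) : Prop where
  rng_notMem : ∀ e, e ∉ M.edges → G.r e ∉ M.verts
  unique_in : ∀ v, v ∉ M.verts → ∃! e, G.r e = v

open Classical in
/-- `|μ|_σ`: the number of edges of the path `μ` that belong to `M`. -/
def Sub.len (M : G.Sub) (μ : G.Path) : ℕ := μ.edges.countP fun e => decide (e ∈ M.edges)

/-- A Cuntz-Krieger `G`-family in a C⋆-algebra: mutually orthogonal projections `p v` and partial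
isometries `S e` with `S e⋆ S e = p (r e)`, and `p v = ∑_{s e = v} S e S e⋆` if `v` is not a sink. -/
structure CKFamily (G : LFGraph V Edge) (B : Type*) [NonUnitalCStarAlgebra B] where
  p : V → B
  S : Edge → B
  isProj : ∀ v, IsStarProjection (p v)
  orth : ∀ v w, v ≠ w → p v * p w = 0
  partialIsom : ∀ e, S e * star (S e) * S e = S e
  star_mul : ∀ e, star (S e) * S e = p (G.r e)
  sum_eq : ∀ v, ¬ G.IsSink v → p v = ∑ e ∈ G.out v, S e * star (S e)

namespace CKFamily

variable {B : Type*} [NonUnitalCStarAlgebra B] (T : CKFamily G B)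

theorem norm_p_le (v : V) : ‖T.p v‖ ≤ 1 := (T.isProj v).norm_le

theorem norm_S_le (e : Edge) : ‖T.S e‖ ≤ 1 := by
  have h := CStarRing.norm_star_mul_self (x := T.S e)
  rw [T.star_mul] at h
  have := T.norm_p_le (G.r e)
  nlinarith [norm_nonneg (T.S e)]

/-- Multiply every partial isometry by a complex number of modulus one. -/
def rescale (c : Edge → Circle) : CKFamily G B where
  p := T.p
  S e := (c e : ℂ) • T.S e
  isProj := T.isProj
  orth := T.orth
  partialIsom e := by
    have h : star (c e : ℂ) * (c e : ℂ) = 1 := by simp [← Circle.coe_inv_eq_conj]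
    rw [star_smul, smul_mul_smul_comm, smul_mul_smul_comm, T.partialIsom, mul_assoc, h, mul_one]
  star_mul e := by
    have h : star (c e : ℂ) * (c e : ℂ) = 1 := by simp [← Circle.coe_inv_eq_conj]
    rw [star_smul, smul_mul_smul_comm, h, one_smul, T.star_mul]
  sum_eq v hv := by
    rw [T.sum_eq v hv]
    refine Finset.sum_congr rfl fun e _ => ?_
    have h : (c e : ℂ) * star (c e : ℂ) = 1 := by simp [← Circle.coe_inv_eq_conj]
    rw [star_smul, smul_mul_smul_comm, h, one_smul]

/-- `S_{e₁} ⋯ S_{eₙ}` for a walk `e₁ ⋯ eₙ` from `v` (note that `S e * p (r e) = S e`), and `p v` for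
the empty walk. -/
def walk (v : V) : List Edge → B
  | [] => T.p v
  | e :: l => T.S e * walk (G.r e) l

/-- `S_μ` for a path `μ`, with `S_v = p_v` for a vertex `v`. -/
def path (μ : G.Path) : B := T.walk μ.src μ.edges

end CKFamily

/-- A Cuntz-Krieger family together with the C⋆-algebra in which it lives. -/
structure CKRep (G : LFGraph V Edge) : Type (u + 1) where
  B : Type u
  [inst : NonUnitalCStarAlgebra B]
  fam : CKFamily G B

instance (i : CKRep G) : NonUnitalCStarAlgebra i.B := i.inst

/-- Rescale the partial isometries of a Cuntz-Krieger family. -/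
def CKRep.rescale (c : Edge → Circle) (i : CKRep G) : CKRep G := ⟨i.B, i.fam.rescale c⟩

variable (G) in
/-- The C⋆-algebra of all bounded families indexed by the Cuntz-Krieger families. -/
abbrev Ambient := lp (fun i : CKRep G => i.B) ∞

/-- The bounded family of all `p v`. -/
def ambientP (v : V) : Ambient G :=
  ⟨fun i => i.fam.p v, memℓp_infty ⟨1, by rintro _ ⟨i, rfl⟩; exact i.fam.norm_p_le v⟩⟩

/-- The bounded family of all `S e`. -/
def ambientS (e : Edge) : Ambient G :=
  ⟨fun i => i.fam.S e, memℓp_infty ⟨1, by rintro _ ⟨i, rfl⟩; exact i.fam.norm_S_le e⟩⟩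

variable (G) in
/-- The closed ⋆-subalgebra generated by the universal Cuntz-Krieger family. -/
def univSub : NonUnitalStarSubalgebra ℂ (Ambient G) :=
  (NonUnitalStarAlgebra.adjoin ℂ
    (Set.range (ambientP (G := G)) ∪ Set.range (ambientS (G := G)))).topologicalClosure

variable (G) in
/-- The graph C⋆-algebra `C⋆(G)`: generated by the universal Cuntz-Krieger family, which is the
family of all Cuntz-Krieger families. -/
def CStar : Type (u + 1) := univSub G

instance : IsClosed (univSub G : Set (Ambient G)) :=
  NonUnitalStarSubalgebra.isClosed_topologicalClosure _

instance : NonUnitalCStarAlgebra (CStar G) :=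
  inferInstanceAs (NonUnitalCStarAlgebra (univSub G))

instance : PartialOrder (CStar G) := CStarAlgebra.spectralOrder _

instance : StarOrderedRing (CStar G) := CStarAlgebra.spectralOrderedRing _

theorem ambientP_mem (v : V) : ambientP v ∈ univSub G :=
  subset_closure (NonUnitalStarAlgebra.subset_adjoin ℂ _ (Or.inl ⟨v, rfl⟩))

theorem ambientS_mem (e : Edge) : ambientS e ∈ univSub G :=
  subset_closure (NonUnitalStarAlgebra.subset_adjoin ℂ _ (Or.inr ⟨e, rfl⟩))

/-- The value of an element of `C⋆(G)` at one Cuntz-Krieger family. -/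
def evalAt (i : CKRep G) : CStar G →⋆ₙₐ[ℂ] i.B where
  toFun a := a.1 i
  map_smul' _ _ := rfl
  map_zero' := rfl
  map_add' _ _ := rfl
  map_mul' _ _ := rfl
  map_star' _ := rfl

theorem evalAt_ext {a b : CStar G} (h : ∀ i, evalAt i a = evalAt i b) : a = b :=
  Subtype.ext (lp.ext (funext h))

/-- The universal projection `p v`. -/
def univP (v : V) : CStar G := ⟨ambientP v, ambientP_mem v⟩

/-- The universal partial isometry `S e`. -/
def univS (e : Edge) : CStar G := ⟨ambientS e, ambientS_mem e⟩

theorem evalAt_univP (i : CKRep G) (v : V) : evalAt i (univP v) = i.fam.p v := rfl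

theorem evalAt_univS (i : CKRep G) (e : Edge) : evalAt i (univS e) = i.fam.S e := rfl

variable (G) in
/-- The universal Cuntz-Krieger family in `C⋆(G)`. -/
def univFamily : CKFamily G (CStar G) where
  p := univP
  S := univS
  isProj v := ⟨evalAt_ext fun i => by
      rw [map_mul]; exact (i.fam.isProj v).isIdempotentElem,
    evalAt_ext fun i => by rw [map_star]; exact (i.fam.isProj v).isSelfAdjoint⟩
  orth v w h := evalAt_ext fun i => by rw [map_mul, map_zero]; exact i.fam.orth v w h
  partialIsom e := evalAt_ext fun i => by
    rw [map_mul, map_mul, map_star]; exact i.fam.partialIsom e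
  star_mul e := evalAt_ext fun i => by rw [map_mul, map_star]; exact i.fam.star_mul e
  sum_eq v hv := evalAt_ext fun i => by
    simp only [map_sum, map_mul, map_star]; exact i.fam.sum_eq v hv

/-- A closed property that is stable under the algebra operations and holds for the generators
holds on all of `C⋆(G)`. -/
theorem CStar.induction {P : CStar G → Prop} (hclosed : IsClosed {a | P a})
    (hp : ∀ v, P (univP v)) (hS : ∀ e, P (univS e)) (h0 : P 0)
    (hadd : ∀ a b, P a → P b → P (a + b)) (hmul : ∀ a b, P a → P b → P (a * b))
    (hsmul : ∀ (c : ℂ) a, P a → P (c • a)) (hstar : ∀ a, P a → P (star a)) (a : CStar G) :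
    P a := by
  have key : ∀ x (hx : x ∈ NonUnitalStarAlgebra.adjoin ℂ
      (Set.range (ambientP (G := G)) ∪ Set.range (ambientS (G := G)))),
      P ⟨x, subset_closure hx⟩ := by
    intro x hx
    induction hx using NonUnitalStarAlgebra.adjoin_induction with
    | mem x hx =>
      rcases hx with ⟨v, rfl⟩ | ⟨e, rfl⟩
      · exact hp v
      · exact hS e
    | add x y hx hy h1 h2 => exact hadd _ _ h1 h2
    | zero => exact h0
    | mul x y hx hy h1 h2 => exact hmul _ _ h1 h2
    | smul c x hx h => exact hsmul c _ h
    | star x hx h => exact hstar _ h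
  obtain ⟨x, hx⟩ := a
  obtain ⟨f, hf, hlim⟩ := mem_closure_iff_seq_limit.1 hx
  refine hclosed.mem_of_tendsto (f := fun n => (⟨f n, subset_closure (hf n)⟩ : CStar G))
    (b := Filter.atTop) ?_ (Filter.Eventually.of_forall fun n => key _ (hf n))
  exact tendsto_subtype_rng.2 hlim

/-- The universal property of `C⋆(G)`. -/
theorem existsUnique_lift (B : Type u) [NonUnitalCStarAlgebra B] (T : CKFamily G B) :
    ∃! π : CStar G →⋆ₙₐ[ℂ] B,
      (∀ v, π ((univFamily G).p v) = T.p v) ∧ ∀ e, π ((univFamily G).S e) = T.S e := by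
  refine ⟨evalAt ⟨B, T⟩, ⟨fun _ => rfl, fun _ => rfl⟩, fun π hπ => ?_⟩
  refine DFunLike.ext _ _ fun a => ?_
  refine CStar.induction (P := fun a => π a = evalAt ⟨B, T⟩ a)
    ?_ hπ.1 hπ.2 ?_ ?_ ?_ ?_ ?_ a
  · exact isClosed_eq (starHom_continuous π)
      (starHom_continuous (evalAt (⟨B, T⟩ : CKRep G)))
  · rw [map_zero, map_zero]
  · intro a b ha hb; rw [map_add, map_add, ha, hb]
  · intro a b ha hb; rw [map_mul, map_mul, ha, hb]
  · intro c a ha; rw [map_smul, map_smul, ha]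
  · intro a ha; rw [map_star, map_star, ha]

/-- Rescaling on the ambient algebra. -/
def ambientRescale (c : Edge → Circle) : Ambient G →⋆ₙₐ[ℂ] Ambient G where
  toFun f := ⟨fun i => f (i.rescale c), memℓp_infty ⟨‖f‖, by
    rintro _ ⟨i, rfl⟩; exact lp.norm_apply_le_norm ENNReal.top_ne_zero f (i.rescale c)⟩⟩
  map_smul' _ _ := rfl
  map_zero' := rfl
  map_add' _ _ := rfl
  map_mul' _ _ := rfl
  map_star' _ := rfl

theorem ambientRescale_mem (c : Edge → Circle) {f : Ambient G} (hf : f ∈ univSub G) :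
    ambientRescale c f ∈ univSub G := by
  have hc : Continuous (ambientRescale (G := G) c) := starHom_continuous _
  refine map_mem_closure hc hf fun x hx => ?_
  have : NonUnitalStarAlgebra.adjoin ℂ
      (Set.range (ambientP (G := G)) ∪ Set.range (ambientS (G := G))) ≤
      (NonUnitalStarAlgebra.adjoin ℂ
      (Set.range (ambientP (G := G)) ∪ Set.range (ambientS (G := G)))).comap
        (ambientRescale (G := G) c) := by
    refine NonUnitalStarAlgebra.adjoin_le ?_
    rintro _ (⟨v, rfl⟩ | ⟨e, rfl⟩)
    · exact NonUnitalStarAlgebra.subset_adjoin ℂ _ (Or.inl ⟨v, rfl⟩)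
    · have h : ambientRescale c (ambientS e) = (c e : ℂ) • ambientS (G := G) e := rfl
      change ambientRescale c (ambientS e) ∈ NonUnitalStarAlgebra.adjoin ℂ
        (Set.range (ambientP (G := G)) ∪ Set.range (ambientS (G := G)))
      rw [h]
      exact SMulMemClass.smul_mem _ (NonUnitalStarAlgebra.subset_adjoin ℂ _ (Or.inr ⟨e, rfl⟩))
  exact this hx

/-- The endomorphism of `C⋆(G)` with `p v ↦ p v` and `S e ↦ c e • S e`. -/
def rescale (c : Edge → Circle) : CStar G →⋆ₙₐ[ℂ] CStar G where
  toFun a := ⟨ambientRescale c a.1, ambientRescale_mem c a.2⟩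
  map_smul' _ _ := rfl
  map_zero' := rfl
  map_add' _ _ := rfl
  map_mul' _ _ := rfl
  map_star' _ := rfl

theorem rescale_p (c : Edge → Circle) (v : V) :
    rescale c ((univFamily G).p v) = (univFamily G).p v := rfl

theorem rescale_S (c : Edge → Circle) (e : Edge) :
    rescale c ((univFamily G).S e) = (c e : ℂ) • (univFamily G).S e := rfl

open Classical in
/-- The zhyvot action: `σ_z S_e = z S_e` for the edges of `M`, and `S_e`, `p_v` fixed otherwise. -/
def Sub.act (M : G.Sub) (z : Circle) : CStar G →⋆ₙₐ[ℂ] CStar G :=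
  rescale fun e => if e ∈ M.edges then z else 1

/-! ### Products of generators -/

namespace CKFamily

variable {B : Type*} [NonUnitalCStarAlgebra B] (T : CKFamily G B)

theorem star_p (v : V) : star (T.p v) = T.p v := (T.isProj v).isSelfAdjoint

theorem p_mul_p (v : V) : T.p v * T.p v = T.p v := (T.isProj v).isIdempotentElem

theorem S_mul_p (e : Edge) : T.S e * T.p (G.r e) = T.S e := by
  rw [← T.star_mul, ← mul_assoc, T.partialIsom]

theorem not_isSink (e : Edge) : ¬ G.IsSink (G.s e) := fun h => h e rfl

theorem range_idem (e : Edge) : (T.S e * star (T.S e)) * (T.S e * star (T.S e)) =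
    T.S e * star (T.S e) := by rw [← mul_assoc, T.partialIsom]

theorem eq_zero_of_sum_eq_zero {ι : Type*} (s : Finset ι) (x : ι → B)
    (h : ∑ i ∈ s, star (x i) * x i = 0) : ∀ i ∈ s, x i = 0 := by
  let _ := CStarAlgebra.spectralOrder B
  have _ := CStarAlgebra.spectralOrderedRing B
  intro i hi
  have := (Finset.sum_eq_zero_iff_of_nonneg (s := s) (f := fun i => star (x i) * x i)
    (fun i _ => star_mul_self_nonneg (x i))).1 h i hi
  exact (CStarRing.star_mul_self_eq_zero_iff _).1 this

theorem p_mul_S (e : Edge) : T.p (G.s e) * T.S e = T.S e := by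
  set v := G.s e with hv
  have hs := T.sum_eq v (hv ▸ not_isSink e)
  have h0 : ∑ f ∈ G.out v, star (T.S f * star (T.S f) - T.S f * star (T.S f) * T.p v) *
      (T.S f * star (T.S f) - T.S f * star (T.S f) * T.p v) = 0 := by
    have : ∀ f, star (T.S f * star (T.S f) - T.S f * star (T.S f) * T.p v) *
      (T.S f * star (T.S f) - T.S f * star (T.S f) * T.p v) =
        T.S f * star (T.S f) - T.S f * star (T.S f) * T.p v - T.p v * (T.S f * star (T.S f))
          + T.p v * (T.S f * star (T.S f)) * T.p v := by
      intro f
      have h1 := T.range_idem f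
      have h2 : star (T.S f * star (T.S f)) = T.S f * star (T.S f) := by simp
      rw [star_sub, StarMul.star_mul (_ * _) (T.p v), h2, T.star_p]
      generalize T.S f * star (T.S f) = q at h1
      generalize T.p v = p
      calc (q - p * q) * (q - q * p) = q * q - (q * q) * p - p * (q * q) + p * (q * q) * p := by
            noncomm_ring
        _ = _ := by rw [h1]
    rw [Finset.sum_congr rfl fun f _ => this f]
    rw [Finset.sum_add_distrib, Finset.sum_sub_distrib, Finset.sum_sub_distrib, ← Finset.sum_mul,
      ← Finset.mul_sum, ← Finset.sum_mul, ← Finset.mul_sum, ← hs, T.p_mul_p, T.p_mul_p]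
    abel
  have h1 := eq_zero_of_sum_eq_zero _ _ h0 e ((G.mem_out).2 hv.symm)
  have h2 := congrArg star (sub_eq_zero.1 h1)
  simp only [StarMul.star_mul, star_star, T.star_p] at h2
  calc T.p v * T.S e = (T.p v * (T.S e * star (T.S e))) * T.S e := by
        rw [mul_assoc, T.partialIsom]
    _ = T.S e := by rw [← h2, T.partialIsom]

theorem star_S_mul_S {e f : Edge} (hef : e ≠ f) : star (T.S e) * T.S f = 0 := by
  classical
  by_cases hv : G.s e = G.s f
  · have hs := T.sum_eq (G.s f) (not_isSink f)
    have hf : f ∈ G.out (G.s f) := G.mem_out.2 rfl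
    have he : e ∈ (G.out (G.s f)).erase f := Finset.mem_erase.2 ⟨hef, G.mem_out.2 hv⟩
    have h1 : ∑ x ∈ G.out (G.s f), star (T.S f) * (T.S x * star (T.S x)) * T.S f =
        star (T.S f) * T.S f := by
      rw [← Finset.sum_mul, ← Finset.mul_sum, ← hs, mul_assoc, T.p_mul_S]
    rw [← Finset.add_sum_erase _ _ hf] at h1
    have h2 : star (T.S f) * (T.S f * star (T.S f)) * T.S f = star (T.S f) * T.S f := by
      rw [mul_assoc, T.partialIsom]
    rw [h2, add_eq_left] at h1
    have h3 : ∑ x ∈ (G.out (G.s f)).erase f, star (star (T.S x) * T.S f) * (star (T.S x) * T.S f)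
        = 0 := by
      rw [← h1]
      refine Finset.sum_congr rfl fun x _ => ?_
      simp only [StarMul.star_mul, star_star, mul_assoc]
    exact eq_zero_of_sum_eq_zero _ _ h3 e he
  · have h1 := T.p_mul_S e
    rw [← T.p_mul_S f, ← h1, StarMul.star_mul, T.star_p, mul_assoc, ← mul_assoc (T.p _),
      T.orth _ _ hv, zero_mul, mul_zero]

theorem p_mul_walk {v : V} : ∀ {l : List Edge}, G.IsWalk v l → T.p v * T.walk v l = T.walk v l
  | [], _ => T.p_mul_p v
  | e :: l, h => by
    have := T.p_mul_S e
    rw [h.1] at this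
    rw [walk, ← mul_assoc, this]

theorem p_mul_walk_of_ne {v w : V} (hvw : v ≠ w) {l : List Edge} (h : G.IsWalk w l) :
    T.p v * T.walk w l = 0 := by
  rw [← T.p_mul_walk h, ← mul_assoc, T.orth v w hvw, zero_mul]

theorem walk_mul_p {v : V} : ∀ {l : List Edge},
    T.walk v l * T.p (G.walkEnd v l) = T.walk v l
  | [] => T.p_mul_p v
  | e :: l => by rw [walk, mul_assoc, walkEnd, walk_mul_p]

theorem isWalk_append : ∀ {l l' : List Edge} {v : V}, G.IsWalk v l →
    G.IsWalk (G.walkEnd v l) l' → G.IsWalk v (l ++ l')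
  | [], _, _, _, h' => h'
  | _ :: _, _, _, h, h' => ⟨h.1, isWalk_append h.2 h'⟩

theorem walk_append : ∀ {l l' : List Edge} {v : V}, G.IsWalk v l →
    G.IsWalk (G.walkEnd v l) l' →
    T.walk v (l ++ l') = T.walk v l * T.walk (G.walkEnd v l) l'
  | [], _, v, _, h' => by
    exact (T.p_mul_walk h').symm
  | e :: l, l', v, h, h' => by
    rw [List.cons_append, walk, walk, walkEnd, mul_assoc, walk_append h.2 h']

theorem star_walk_mul_walk : ∀ {l l' : List Edge} {v w : V}, G.IsWalk v l → G.IsWalk w l' →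
    star (T.walk v l) * T.walk w l' = 0 ∨
    (∃ k, G.IsWalk (G.walkEnd v l) k ∧
      star (T.walk v l) * T.walk w l' = T.walk (G.walkEnd v l) k) ∨
    (∃ k, G.IsWalk (G.walkEnd w l') k ∧
      star (T.walk v l) * T.walk w l' = star (T.walk (G.walkEnd w l') k))
  | [], l', v, w, _, h' => by
    rw [walk.eq_1, T.star_p]
    by_cases hvw : v = w
    · subst hvw
      exact Or.inr (Or.inl ⟨l', h', T.p_mul_walk h'⟩)
    · exact Or.inl (T.p_mul_walk_of_ne hvw h')
  | e :: l, [], v, w, h, _ => by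
    have hs : star (T.walk v (e :: l)) * T.walk w [] = star (T.p w * T.walk v (e :: l)) := by
      rw [StarMul.star_mul, T.star_p, walk.eq_1 T w]
    rw [hs]
    by_cases hvw : w = v
    · subst hvw
      exact Or.inr (Or.inr ⟨e :: l, h, by rw [T.p_mul_walk h]; rfl⟩)
    · exact Or.inl (by rw [T.p_mul_walk_of_ne hvw h, star_zero])
  | e :: l, f :: l', v, w, h, h' => by
    have hs : star (T.walk v (e :: l)) * T.walk w (f :: l') =
        star (T.walk (G.r e) l) * ((star (T.S e) * T.S f) * T.walk (G.r f) l') := by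
      rw [walk, walk, StarMul.star_mul]; simp only [mul_assoc]
    rw [hs]
    by_cases hef : e = f
    · subst hef
      rw [T.star_mul, T.p_mul_walk h'.2]
      exact star_walk_mul_walk h.2 h'.2
    · exact Or.inl (by rw [T.star_S_mul_S hef, zero_mul, mul_zero])

theorem path_mul_star_path_of_ne {μ ν : G.Path} (h : μ.rng ≠ ν.rng) :
    T.path μ * star (T.path ν) = 0 := by
  have h1 : T.path μ * T.p μ.rng = T.path μ := T.walk_mul_p
  have h2 : T.path ν * T.p ν.rng = T.path ν := T.walk_mul_p
  rw [← h1, ← h2, StarMul.star_mul, T.star_p, mul_assoc, ← mul_assoc (T.p _), T.orth _ _ h,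
    zero_mul, mul_zero]

/-- `A_c = span {S_μ S_ν⋆}`, as a subspace. -/
def coreSpan : Submodule ℂ B :=
  Submodule.span ℂ {a | ∃ μ ν : G.Path, a = T.path μ * star (T.path ν)}

theorem path_mul_walk_mul_mem (μ κ : G.Path) {v : V} {k : List Edge} (hk : G.IsWalk v k) :
    T.path μ * T.walk v k * star (T.path κ) ∈ T.coreSpan := by
  by_cases hv : μ.rng = v
  · subst hv
    have : T.path μ * T.walk μ.rng k = T.path ⟨μ.src, μ.edges ++ k, isWalk_append μ.isWalk hk⟩ :=
      (T.walk_append μ.isWalk hk).symm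
    rw [this]
    exact Submodule.subset_span ⟨_, _, rfl⟩
  · have h1 : T.path μ * T.p μ.rng = T.path μ := T.walk_mul_p
    rw [← h1, mul_assoc (T.path μ), T.p_mul_walk_of_ne hv hk, mul_zero, zero_mul]
    exact zero_mem _

theorem star_mem_coreSpan {a : B} (ha : a ∈ T.coreSpan) : star a ∈ T.coreSpan := by
  induction ha using Submodule.span_induction with
  | mem a h =>
    obtain ⟨μ, ν, rfl⟩ := h
    exact Submodule.subset_span ⟨ν, μ, by simp⟩
  | zero => simp
  | add a b _ _ ha hb => rw [star_add]; exact add_mem ha hb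
  | smul c a _ ha => rw [star_smul]; exact Submodule.smul_mem _ _ ha

theorem mul_mem_coreSpan {a b : B} (ha : a ∈ T.coreSpan) (hb : b ∈ T.coreSpan) :
    a * b ∈ T.coreSpan := by
  induction ha using Submodule.span_induction with
  | zero => simp
  | add a a' _ _ h h' => rw [add_mul]; exact add_mem h h'
  | smul c a _ h => rw [smul_mul_assoc]; exact Submodule.smul_mem _ _ h
  | mem a h =>
    obtain ⟨μ, ν, rfl⟩ := h
    induction hb using Submodule.span_induction with
    | zero => simp
    | add a a' _ _ h h' => rw [mul_add]; exact add_mem h h'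
    | smul c a _ h => rw [mul_smul_comm]; exact Submodule.smul_mem _ _ h
    | mem b h =>
      obtain ⟨ρ, κ, rfl⟩ := h
      have hs : T.path μ * star (T.path ν) * (T.path ρ * star (T.path κ)) =
          T.path μ * (star (T.path ν) * T.path ρ) * star (T.path κ) := by simp only [mul_assoc]
      rw [hs]
      rcases T.star_walk_mul_walk ν.isWalk ρ.isWalk with h | ⟨k, hk, h⟩ | ⟨k, hk, h⟩
      · rw [path, path, path, path, h]; simp
      · have h' : star (T.path ν) * T.path ρ = _ := h
        rw [h']; exact T.path_mul_walk_mul_mem μ κ hk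
      · have h' : star (T.path ν) * T.path ρ = _ := h
        rw [h']
        have := T.star_mem_coreSpan (T.path_mul_walk_mul_mem κ μ hk)
        simpa [mul_assoc] using this

end CKFamily

variable (G) in
/-- `A_c = span {S_μ S_ν⋆}`, a dense ⋆-subalgebra of `C⋆(G)`. -/
def core : NonUnitalStarSubalgebra ℂ (CStar G) where
  carrier := (univFamily G).coreSpan
  add_mem' := add_mem
  zero_mem' := zero_mem _
  mul_mem' := (univFamily G).mul_mem_coreSpan
  smul_mem' c _ h := Submodule.smul_mem _ c h
  star_mem' := (univFamily G).star_mem_coreSpan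

/-- The element `S_μ S_ν⋆` of `A_c`. -/
def gen (μ ν : G.Path) : core G :=
  ⟨(univFamily G).path μ * star ((univFamily G).path ν), Submodule.subset_span ⟨μ, ν, rfl⟩⟩

/-! ### The expectation onto the fixed point algebra and the Kasparov module -/

theorem rescale_continuous (a : CStar G) (c : Circle → Edge → Circle)
    (hc : ∀ e, Continuous fun z => c z e) : Continuous fun z => rescale (c z) a := by
  refine CStar.induction (P := fun a => Continuous fun z => rescale (c z) a)
    ?_ ?_ ?_ ?_ ?_ ?_ ?_ ?_ a
  · refine isClosed_of_closure_subset fun a ha => ?_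
    refine continuous_of_uniform_approx_of_continuous fun u hu => ?_
    obtain ⟨ε, hε, hu⟩ := Metric.mem_uniformity_dist.1 hu
    obtain ⟨b, hb, hab⟩ := Metric.mem_closure_iff.1 ha ε hε
    refine ⟨fun z => rescale (c z) b, hb, fun z => hu ?_⟩
    rw [dist_eq_norm, ← map_sub]
    exact (NonUnitalStarAlgHom.norm_apply_le _ _).trans_lt (by rwa [← dist_eq_norm])
  · exact fun v => (continuous_const : Continuous fun _ : Circle => (univP v : CStar G))
  · exact fun e => (continuous_subtype_val.comp (hc e)).smul
      (continuous_const : Continuous fun _ : Circle => (univS e : CStar G))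
  · simp only [map_zero]; exact continuous_const
  · intro a b ha hb; simp only [map_add]; exact ha.add hb
  · intro a b ha hb; simp only [map_mul]; exact ha.mul hb
  · intro k a ha; simp only [map_smul]; exact ha.const_smul k
  · intro a ha; simp only [map_star]; exact ha.star

namespace Sub

variable (M : G.Sub)

theorem act_continuous (a : CStar G) : Continuous fun θ : ℝ => M.act (Circle.exp θ) a := by
  classical
  have := rescale_continuous a (fun z e => if e ∈ M.edges then z else 1) fun e => by
    by_cases he : e ∈ M.edges <;> simp only [he, if_true, if_false] <;> fun_prop
  exact this.comp Circle.exp.continuous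

/-- The expectation onto the fixed point algebra, `Φ(a) = (2π)⁻¹ ∫ σ_z(a) dθ` with `z = exp(iθ)`. -/
def expect (a : CStar G) : CStar G :=
  ((2 * Real.pi : ℝ) : ℂ)⁻¹ • ∫ θ in (0 : ℝ)..(2 * Real.pi), M.act (Circle.exp θ) a

theorem expect_add (a b : CStar G) : M.expect (a + b) = M.expect a + M.expect b := by
  simp only [expect, map_add, ← smul_add]
  rw [intervalIntegral.integral_add ((M.act_continuous a).intervalIntegrable _ _)
    ((M.act_continuous b).intervalIntegrable _ _)]

theorem expect_smul (c : ℂ) (a : CStar G) : M.expect (c • a) = c • M.expect a := by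
  simp only [expect, map_smul]
  rw [intervalIntegral.integral_smul, smul_comm]

theorem expect_star (a : CStar G) : M.expect (star a) = star (M.expect a) := by
  have h := ((starL' ℝ : CStar G ≃L[ℝ] CStar G) : CStar G →L[ℝ] CStar G).intervalIntegral_comp_comm
    ((M.act_continuous a).intervalIntegrable (μ := MeasureTheory.volume) 0 (2 * Real.pi))
  simp only [expect, map_star, star_smul, star_inv₀, Complex.star_def, Complex.conj_ofReal]
  exact congrArg _ h

theorem expect_star_mul_self_nonneg (a : CStar G) : 0 ≤ M.expect (star a * a) := by
  have h2 : (0 : ℝ) ≤ 2 * Real.pi := by positivity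
  have h : 0 ≤ ∫ θ in (0 : ℝ)..(2 * Real.pi), M.act (Circle.exp θ) (star a * a) := by
    rw [intervalIntegral.integral_of_le h2]
    refine MeasureTheory.integral_nonneg fun θ => ?_
    change 0 ≤ M.act (Circle.exp θ) (star a * a)
    rw [map_mul, map_star]
    exact star_mul_self_nonneg _
  have h3 : M.expect (star a * a) = (2 * Real.pi : ℝ)⁻¹ •
      ∫ θ in (0 : ℝ)..(2 * Real.pi), M.act (Circle.exp θ) (star a * a) := by
    rw [expect, ← Complex.ofReal_inv]
    exact Complex.coe_smul _ _
  rw [h3]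
  exact smul_nonneg (by positivity) h

theorem act_act (z w : Circle) (a : CStar G) : M.act z (M.act w a) = M.act (w * z) a := by
  classical
  refine CStar.induction (P := fun a => M.act z (M.act w a) = M.act (w * z) a)
    ?_ ?_ ?_ ?_ ?_ ?_ ?_ ?_ a
  · exact isClosed_eq ((starHom_continuous (M.act z)).comp (starHom_continuous (M.act w)))
      (starHom_continuous (M.act (w * z)))
  · exact fun v => rfl
  · intro e
    have h : ∀ z : Circle, M.act z (univS e) =
        ((if e ∈ M.edges then z else 1 : Circle) : ℂ) • univS e := fun z => rfl
    rw [h, map_smul, h, h, smul_smul]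
    by_cases he : e ∈ M.edges <;> simp [he]
  · simp only [map_zero]
  · intro a b ha hb; simp only [map_add, ha, hb]
  · intro a b ha hb; simp only [map_mul, ha, hb]
  · intro k a ha; simp only [map_smul, ha]
  · intro a ha; simp only [map_star, ha]

theorem act_expect (t : ℝ) (a : CStar G) :
    M.act (Circle.exp t) (M.expect a) = M.expect a := by
  let π : CStar G →L[ℂ] CStar G :=
    ⟨(M.act (Circle.exp t) : CStar G →ₗ[ℂ] CStar G), starHom_continuous _⟩
  have h := π.intervalIntegral_comp_comm
    ((M.act_continuous a).intervalIntegrable (μ := MeasureTheory.volume) 0 (2 * Real.pi))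
  have hper : Function.Periodic (fun θ : ℝ => M.act (Circle.exp θ) a) (2 * Real.pi) := by
    intro θ; simp only [Circle.periodic_exp θ]
  have h2 : ∀ θ : ℝ, π (M.act (Circle.exp θ) a) = M.act (Circle.exp (θ + t)) a := fun θ => by
    rw [Circle.exp_add]; exact M.act_act _ _ a
  simp only [h2] at h
  rw [intervalIntegral.integral_comp_add_right (fun θ => M.act (Circle.exp θ) a), zero_add,
    add_comm, hper.intervalIntegral_add_eq t 0, zero_add] at h
  simp only [expect, map_smul]
  exact congrArg _ h.symm

theorem expect_mul_expect (a b : CStar G) :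
    M.expect (a * M.expect b) = M.expect a * M.expect b := by
  let R : CStar G →L[ℂ] CStar G := (ContinuousLinearMap.mul ℂ (CStar G)).flip (M.expect b)
  have h := R.intervalIntegral_comp_comm
    ((M.act_continuous a).intervalIntegrable (μ := MeasureTheory.volume) 0 (2 * Real.pi))
  have h2 : ∀ θ : ℝ, R (M.act (Circle.exp θ) a) = M.act (Circle.exp θ) (a * M.expect b) :=
    fun θ => by rw [map_mul, act_expect]; rfl
  simp only [h2] at h
  simp only [expect, smul_mul_assoc]
  exact congrArg _ h

theorem expect_expect_mul (a b : CStar G) :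
    M.expect (M.expect a * b) = M.expect a * M.expect b := by
  have h := congrArg star (M.expect_mul_expect (star b) (star a))
  simpa [← expect_star] using h

theorem expect_sub (a b : CStar G) : M.expect (a - b) = M.expect a - M.expect b := by
  have h := M.expect_add (a - b) b
  rw [sub_add_cancel] at h
  rw [h, add_sub_cancel_right]

/-- The Cauchy-Schwarz inequality for the inner product `(x | y) = Φ(x⋆ y)`. -/
theorem norm_expect_star_mul_sq_le (x y : CStar G) :
    ‖M.expect (star x * y)‖ ^ 2 ≤ ‖M.expect (star x * x)‖ * ‖M.expect (star y * y)‖ := by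
  set c := M.expect (star x * y) with hc
  have hc' : M.expect (star y * x) = star c := by rw [hc, ← expect_star]; simp
  have key : ∀ N : ℝ, 0 < N → ‖M.expect (star x * x)‖ ≤ N →
      ‖c‖ ^ 2 ≤ N * ‖M.expect (star y * y)‖ := by
    intro N hN hle
    have h0 := M.expect_star_mul_self_nonneg (x * c - (N : ℂ) • y)
    have h1 : M.expect (star (x * c - (N : ℂ) • y) * (x * c - (N : ℂ) • y)) =
        star c * M.expect (star x * x) * c - (2 * N : ℝ) • (star c * c)
          + (N ^ 2 : ℝ) • M.expect (star y * y) := by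
      have e1 : star (x * c - (N : ℂ) • y) * (x * c - (N : ℂ) • y) =
          (star c * (star x * x * c) - (N : ℂ) • (star c * (star x * y)))
          - ((N : ℂ) • ((star y * x) * c) - (N : ℂ) • ((N : ℂ) • (star y * y))) := by
        simp only [star_sub, star_smul, StarMul.star_mul, Complex.star_def, Complex.conj_ofReal,
          sub_mul, mul_sub, smul_mul_assoc, mul_smul_comm, mul_assoc, smul_sub]
        abel
      have e2 : ∀ a, M.expect (star c * a) = star c * M.expect a := fun a => by
        rw [hc, ← expect_star, expect_expect_mul]
      have e3 : ∀ a, M.expect (a * c) = M.expect a * c := fun a => by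
        rw [hc, expect_mul_expect]
      rw [e1]
      simp only [expect_sub, expect_smul, e2, e3, hc', ← hc]
      rw [← mul_assoc]
      have r1 : ∀ (r : ℝ) (a : CStar G), r • a = (r : ℂ) • a := fun r a => (Complex.coe_smul r a).symm
      rw [r1, r1, smul_smul]
      push_cast
      rw [two_mul, add_smul, sq]
      abel
    rw [h1] at h0
    have h2 : star c * M.expect (star x * x) * c ≤ N • (star c * c) := by
      have hsa : IsSelfAdjoint (M.expect (star x * x)) :=
        (M.expect_star_mul_self_nonneg x).isSelfAdjoint
      refine (CStarAlgebra.star_left_conjugate_le_norm_smul (a := c) (b := M.expect (star x * x))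
        hsa).trans ?_
      exact smul_le_smul_of_nonneg_right hle (star_mul_self_nonneg c)
    have h3 : N • (star c * c) ≤ (N ^ 2 : ℝ) • M.expect (star y * y) := by
      have h4 : 0 ≤ N • (star c * c) - (2 * N : ℝ) • (star c * c)
          + (N ^ 2 : ℝ) • M.expect (star y * y) :=
        h0.trans (by gcongr)
      have h5 : N • (star c * c) - (2 * N : ℝ) • (star c * c)
          + (N ^ 2 : ℝ) • M.expect (star y * y) =
          (N ^ 2 : ℝ) • M.expect (star y * y) - N • (star c * c) := by
        rw [two_mul, add_smul]; abel
      rw [h5] at h4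
      exact sub_nonneg.1 h4
    have h6 := CStarAlgebra.norm_le_norm_of_nonneg_of_le
      (smul_nonneg hN.le (star_mul_self_nonneg c)) h3
    rw [norm_smul, norm_smul, CStarRing.norm_star_mul_self, Real.norm_of_nonneg hN.le,
      Real.norm_of_nonneg (sq_nonneg N)] at h6
    have h7 : N * ‖c‖ ^ 2 ≤ N * (N * ‖M.expect (star y * y)‖) := by nlinarith [h6]
    exact le_of_mul_le_mul_left h7 hN
  refine le_of_forall_pos_le_add fun ε hε => ?_
  set K := ‖M.expect (star y * y)‖
  have hK : 0 ≤ K := norm_nonneg _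
  have := key (‖M.expect (star x * x)‖ + ε / (K + 1)) (by positivity)
    (le_add_of_nonneg_right (by positivity))
  refine this.trans ?_
  rw [add_mul, add_le_add_iff_left, div_mul_eq_mul_div]
  rw [div_le_iff₀ (by positivity)]
  nlinarith

/-- `C⋆(G)` as a pre-Hilbert module over the fixed point algebra of the zhyvot action. -/
def PreX (_M : G.Sub) : Type (u + 1) := CStar G

instance : AddCommGroup (PreX M) := inferInstanceAs (AddCommGroup (CStar G))

instance : Module ℂ (PreX M) := inferInstanceAs (Module ℂ (CStar G))

/-- The identity map from `C⋆(G)` to the pre-Hilbert module. -/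
def toPreX : CStar G ≃ₗ[ℂ] PreX M := LinearEquiv.refl ℂ _

/-- The inner product `(a | b) = Φ(a⋆ b)`. -/
instance : Inner (CStar G) (PreX M) :=
  ⟨fun a b => M.expect (star (M.toPreX.symm a) * M.toPreX.symm b)⟩

theorem preX_norm_add (a b : CStar G) :
    √‖M.expect (star (a + b) * (a + b))‖ ≤
      √‖M.expect (star a * a)‖ + √‖M.expect (star b * b)‖ := by
  set A := ‖M.expect (star a * a)‖ with hA
  set B := ‖M.expect (star b * b)‖ with hB
  have h1 : ‖M.expect (star a * b)‖ ≤ √A * √B := by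
    rw [← Real.sqrt_mul (norm_nonneg _)]
    exact Real.le_sqrt_of_sq_le (M.norm_expect_star_mul_sq_le a b)
  have h2 : ‖M.expect (star b * a)‖ ≤ √A * √B := by
    have : M.expect (star b * a) = star (M.expect (star a * b)) := by rw [← expect_star]; simp
    rwa [this, norm_star]
  refine Real.sqrt_le_iff.2 ⟨by positivity, ?_⟩
  have h3 : M.expect (star (a + b) * (a + b)) = M.expect (star a * a) + M.expect (star a * b)
      + (M.expect (star b * a) + M.expect (star b * b)) := by
    simp only [star_add, add_mul, mul_add, expect_add]
    abel
  have hsA : √A ^ 2 = A := Real.sq_sqrt (norm_nonneg _)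
  have hsB : √B ^ 2 = B := Real.sq_sqrt (norm_nonneg _)
  calc ‖M.expect (star (a + b) * (a + b))‖
      ≤ A + ‖M.expect (star a * b)‖ + (‖M.expect (star b * a)‖ + B) := by
        rw [h3]
        exact (norm_add_le _ _).trans (add_le_add (norm_add_le _ _) (norm_add_le _ _))
    _ ≤ (√A + √B) ^ 2 := by rw [add_sq, hsA, hsB]; linarith

/-- The seminorm `‖a‖ = ‖(a | a)‖ ^ (1 / 2)`. -/
instance : SeminormedAddCommGroup (PreX M) :=
  AddGroupSeminorm.toSeminormedAddCommGroup
    { toFun := fun a => √‖inner (CStar G) a a‖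
      map_zero' := by
        have : M.expect 0 = 0 := by simpa using M.expect_smul 0 0
        simp [inner, this]
      add_le' := fun a b => M.preX_norm_add a b
      neg' := fun a => by simp [inner] }

instance : NormedSpace ℂ (PreX M) where
  norm_smul_le c a := by
    change √‖M.expect (star (c • M.toPreX.symm a) * (c • M.toPreX.symm a))‖ ≤
      ‖c‖ * √‖M.expect (star (M.toPreX.symm a) * M.toPreX.symm a)‖
    rw [star_smul, smul_mul_smul_comm, expect_smul, norm_smul, Real.sqrt_mul (norm_nonneg _)]
    rw [norm_mul, norm_star, Real.sqrt_mul_self (norm_nonneg _)]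

/-- The Kasparov module `X`: the Hilbert module completion of `C⋆(G)` for `(a | b) = Φ(a⋆ b)`. -/
abbrev X : Type (u + 1) := UniformSpace.Completion (PreX M)

/-- The canonical map from `C⋆(G)` to `X`. -/
def toX (a : CStar G) : M.X := (M.toPreX a : M.PreX)

/-- The `C⋆(G)^σ`-valued inner product of `X`, the continuous extension of `Φ(a⋆ b)`. -/
def ip (x y : M.X) : CStar G := inner (CStar G) x y

/-- The left action of `C⋆(G)` on `X`, the continuous extension of left multiplication. -/
def lmul (a : CStar G) : M.X → M.X :=
  UniformSpace.Completion.map fun b => M.toPreX (a * M.toPreX.symm b)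

/-- The right action of the fixed point algebra on `X` (for `f` in the fixed point algebra), the
continuous extension of right multiplication. -/
def rmul (f : CStar G) : M.X → M.X :=
  UniformSpace.Completion.map fun b => M.toPreX (M.toPreX.symm b * f)

/-- The rank one endomorphism `Θ_{x,y} z = x (y | z)`. -/
def theta (x y : M.X) : M.X → M.X := fun z => M.rmul (M.ip y z) x

end Sub

/-! ### Graph weights and the functional of a graph weight -/

/-- `(g, lam)` is a graph weight: `g v = ∑_{s e = v} lam e * g (r e)` at every vertex that is not a
sink, with nonnegative `g` and `lam`. -/
structure IsGraphWeight (G : LFGraph V Edge) (g : V → ℝ) (lam : Edge → ℝ) : Prop where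
  g_nonneg : ∀ v, 0 ≤ g v
  lam_nonneg : ∀ e, 0 ≤ lam e
  eq_sum : ∀ v, ¬ G.IsSink v → g v = ∑ e ∈ G.out v, lam e * g (G.r e)

section Functional

/-- The operator on `ℓ²` that is given by a partial bijection of the index set. -/
theorem exists_opP {Ω : Type*} (f : Ω ≃. Ω) :
    ∃ T : lp (fun _ : Ω => ℂ) 2 →L[ℂ] lp (fun _ : Ω => ℂ) 2,
      ∀ ξ i, T ξ i = (f i).elim 0 ξ := by
  have h2 : (2 : ℝ≥0∞).toReal = 2 := by norm_num
  have h2' : 0 < (2 : ℝ≥0∞).toReal := by norm_num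
  let j : {i // (f i).isSome} → Ω := fun i => (f i.1).get i.2
  have hj : Function.Injective j := by
    intro a b hab
    refine Subtype.ext (f.inj (b := j a) (Option.get_mem _) ?_)
    rw [hab]; exact Option.get_mem _
  have hsub : ∀ ξ : Ω → ℂ, (fun i => ‖(f i).elim 0 ξ‖ ^ (2 : ℝ≥0∞).toReal) ∘
      (Subtype.val : {i // (f i).isSome} → Ω) = (fun i => ‖ξ i‖ ^ (2 : ℝ≥0∞).toReal) ∘ j := by
    intro ξ
    funext i
    obtain ⟨i, hi⟩ := i
    obtain ⟨k, hk⟩ := Option.isSome_iff_exists.1 hi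
    simp [j, hk]
  have hout : ∀ ξ : Ω → ℂ, ∀ i ∉ Set.range (Subtype.val : {i // (f i).isSome} → Ω),
      ‖(f i).elim 0 ξ‖ ^ (2 : ℝ≥0∞).toReal = 0 := by
    intro ξ i hi
    have : f i = none := by simpa using hi
    simp [this]
  have hmem : ∀ ξ : lp (fun _ : Ω => ℂ) 2, Memℓp (E := fun _ : Ω => ℂ) (fun i => (f i).elim 0 ξ) 2 := by
    intro ξ
    refine memℓp_gen ?_
    rw [← Function.Injective.summable_iff Subtype.val_injective (hout ξ), hsub]
    exact ((lp.memℓp ξ).summable h2').comp_injective hj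
  have hle : ∀ ξ : lp (fun _ : Ω => ℂ) 2,
      ‖(⟨fun i => (f i).elim 0 ξ, hmem ξ⟩ : lp (fun _ : Ω => ℂ) 2)‖ ≤ 1 * ‖ξ‖ := by
    intro ξ
    rw [one_mul]
    refine lp.norm_le_of_tsum_le h2' (norm_nonneg _) ?_
    rw [lp.norm_rpow_eq_tsum h2']
    change ∑' i, ‖(f i).elim 0 ξ‖ ^ (2 : ℝ≥0∞).toReal ≤ _
    rw [← Function.Injective.tsum_eq (f := fun i => ‖(f i).elim 0 ξ‖ ^ (2 : ℝ≥0∞).toReal)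
      (Subtype.val_injective (p := fun i => (f i).isSome))
      (fun i hi => by by_contra h; exact hi (hout ξ i h))]
    have := hsub ξ
    simp only [funext_iff, Function.comp_apply] at this
    rw [tsum_congr this]
    exact _root_.tsum_comp_le_tsum_of_inj ((lp.memℓp ξ).summable h2')
      (fun i => by positivity) hj
  refine ⟨LinearMap.mkContinuous
    { toFun := fun ξ => ⟨fun i => (f i).elim 0 ξ, hmem ξ⟩
      map_add' := fun ξ η => ?_
      map_smul' := fun c ξ => ?_ } 1 hle, fun ξ i => rfl⟩
  · ext i
    change (f i).elim 0 ⇑(ξ + η) = (f i).elim 0 ⇑ξ + (f i).elim 0 ⇑η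
    cases f i with
    | none => exact (add_zero 0).symm
    | some k => rfl
  · ext i
    change (f i).elim 0 ⇑(c • ξ) = c • (f i).elim 0 ⇑ξ
    cases f i with
    | none => exact (smul_zero c).symm
    | some k => rfl

/-- The operator on `ℓ²` that is given by a partial bijection of the index set. -/
def opP {Ω : Type*} (f : Ω ≃. Ω) : lp (fun _ : Ω => ℂ) 2 →L[ℂ] lp (fun _ : Ω => ℂ) 2 :=
  (exists_opP f).choose

theorem opP_apply {Ω : Type*} (f : Ω ≃. Ω) (ξ : lp (fun _ : Ω => ℂ) 2) (i : Ω) :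
    opP f ξ i = (f i).elim 0 ξ := (exists_opP f).choose_spec ξ i

theorem opP_mul {Ω : Type*} (f f' : Ω ≃. Ω) : opP f * opP f' = opP (f.trans f') := by
  ext ξ i
  change opP f (opP f' ξ) i = _
  rw [opP_apply, opP_apply]
  have : (f.trans f') i = (f i).bind f' := rfl
  rw [this]
  cases f i with
  | none => rfl
  | some j => simp [opP_apply]

theorem star_opP {Ω : Type*} (f : Ω ≃. Ω) : star (opP f) = opP f.symm := by
  rw [ContinuousLinearMap.star_eq_adjoint]
  symm
  rw [ContinuousLinearMap.eq_adjoint_iff]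
  intro ξ η
  rw [lp.inner_eq_tsum, lp.inner_eq_tsum]
  have hsome : ∀ x : Function.support fun i => inner ℂ (opP f.symm ξ i) (η i),
      (f.symm x.1).isSome := by
    rintro ⟨x, hx⟩
    by_contra h
    have h' : f.symm x = none := by simpa using h
    refine hx ?_
    change inner ℂ (opP f.symm ξ x) (η x) = 0
    rw [opP_apply, h']
    simp
  symm
  refine tsum_eq_tsum_of_ne_zero_bij (fun x => (f.symm x.1).get (hsome x)) ?_ ?_ ?_
  · intro a b hab
    refine Subtype.ext (f.symm.inj (b := (f.symm a.1).get (hsome a)) (Option.get_mem _) ?_)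
    dsimp only at hab
    rw [hab]; exact Option.get_mem _
  · intro j hj
    have hj2 : inner ℂ (ξ j) (opP f η j) ≠ 0 := hj
    rw [opP_apply] at hj2
    cases hk : f j with
    | none => simp [hk] at hj2
    | some k =>
      have hk' : f.symm k = some j := f.eq_some_iff.2 hk
      refine ⟨⟨k, ?_⟩, by simp [hk']⟩
      change inner ℂ (opP f.symm ξ k) (η k) ≠ 0
      rw [opP_apply, hk']
      simpa [hk] using hj2
  · rintro ⟨x, hx⟩
    obtain ⟨k, hk⟩ := Option.isSome_iff_exists.1 (hsome ⟨x, hx⟩)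
    have hk' : f k = some x := f.eq_some_iff.1 hk
    simp only [opP_apply, hk, hk', Option.get_some, Option.elim_some]

theorem exists_branching [Countable Edge] (G : LFGraph V Edge) :
    ∃ b : Edge × ℕ ≃ {v // ¬ G.IsSink v} × ℕ, ∀ q, ((b q).1 : V) = G.s q.1 := by
  let f : Edge × ℕ → {v // ¬ G.IsSink v} := fun q => ⟨G.s q.1, CKFamily.not_isSink q.1⟩
  have hfib : ∀ v, Nonempty ({q // f q = v} ≃ ℕ) := by
    rintro ⟨v, hv⟩
    have hfin : Finite {e // G.s e = v} := G.finite_out v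
    have hc : Countable {q // f q = ⟨v, hv⟩} := by
      refine Function.Injective.countable (β := {e // G.s e = v} × ℕ)
        (f := fun q => (⟨q.1.1, congrArg Subtype.val q.2⟩, q.1.2)) ?_
      rintro ⟨⟨e, n⟩, h⟩ ⟨⟨e', n'⟩, h'⟩ heq
      simp only [Prod.mk.injEq, Subtype.mk.injEq] at heq
      simp [heq.1, heq.2]
    obtain ⟨e, he⟩ : ∃ e, G.s e = v := by simpa [IsSink] using hv
    have hi : Infinite {q // f q = ⟨v, hv⟩} := by
      refine Infinite.of_injective (fun n : ℕ => ⟨(e, n), Subtype.ext he⟩) ?_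
      intro n m h
      simpa using h
    exact nonempty_equiv_of_countable
  refine ⟨(Equiv.sigmaFiberEquiv f).symm.trans
    ((Equiv.sigmaCongrRight fun v => (hfib v).some).trans (Equiv.sigmaEquivProd _ _)), fun q => rfl⟩

/-- The indices of the representation: a vertex, a multiplicity, and a degree. -/
abbrev Idx (_G : LFGraph V Edge) : Type u := V × ℕ × ℤ

variable (b : Edge × ℕ ≃ {v // ¬ G.IsSink v} × ℕ)

open Classical in
/-- The partial bijection of the indices which gives the partial isometry of the edge `e`. -/
def edgeP (e : Edge) : Idx G ≃. Idx G where
  toFun i := if h : ¬ G.IsSink i.1 then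
      (if (b.symm (⟨i.1, h⟩, i.2.1)).1 = e then
        some (G.r e, (b.symm (⟨i.1, h⟩, i.2.1)).2, i.2.2 - 1) else none)
    else none
  invFun j := if j.1 = G.r e then some ((b (e, j.2.1)).1, (b (e, j.2.1)).2, j.2.2 + 1) else none
  inv := by
    rintro ⟨v, n, k⟩ ⟨w, m, l⟩
    simp only [Option.ite_none_right_eq_some, Option.some.injEq, Prod.mk.injEq,
      Option.dite_none_right_eq_some]
    constructor
    · rintro ⟨rfl, rfl, rfl, rfl⟩
      refine ⟨(b (e, m)).1.2, ?_, rfl, ?_, by ring⟩ <;> simp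
    · rintro ⟨h, h1, rfl, rfl, rfl⟩
      have : (e, (b.symm (⟨v, h⟩, n)).2) = b.symm (⟨v, h⟩, n) := by rw [← h1]
      rw [this]
      simp

/-- The projection of the vertex `v`. -/
def vertP (v : V) : Idx G ≃. Idx G := by
  classical exact PEquiv.ofSet {i | i.1 = v}

theorem ofSet_elim {Ω : Type*} (s : Set Ω) [DecidablePred (· ∈ s)] (ξ : Ω → ℂ) (i : Ω) :
    (PEquiv.ofSet s i).elim 0 ξ = if i ∈ s then ξ i else 0 := by
  change (if i ∈ s then some i else none : Option Ω).elim 0 ξ = _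
  split_ifs <;> rfl

open Classical in
theorem edgeP_isSome (e : Edge) (i : Idx G) : (edgeP b e i).isSome ↔
    ∃ h : ¬ G.IsSink i.1, (b.symm (⟨i.1, h⟩, i.2.1)).1 = e := by
  change (if h : ¬ G.IsSink i.1 then
      (if (b.symm (⟨i.1, h⟩, i.2.1)).1 = e then
        some (G.r e, (b.symm (⟨i.1, h⟩, i.2.1)).2, i.2.2 - 1) else none)
    else none : Option (Idx G)).isSome ↔ _
  split_ifs with h1 h2
  · exact ⟨fun h => by simp at h, fun ⟨h, _⟩ => absurd h1 h⟩
  · exact ⟨fun _ => ⟨h1, h2⟩, fun _ => rfl⟩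
  · exact ⟨fun h => by simp at h, fun ⟨_, h⟩ => absurd h h2⟩

open Classical in
theorem edgeP_symm_isSome (e : Edge) (j : Idx G) : ((edgeP b e).symm j).isSome ↔ j.1 = G.r e := by
  change (if j.1 = G.r e then some ((b (e, j.2.1)).1, (b (e, j.2.1)).2, j.2.2 + 1)
    else none : Option (Idx G)).isSome ↔ _
  split_ifs with h <;> simp [h]

theorem edgeP_degree {e : Edge} {i j : Idx G} (h : edgeP b e i = some j) : i.2.2 = j.2.2 + 1 := by
  classical
  change (if h : ¬ G.IsSink i.1 then
      (if (b.symm (⟨i.1, h⟩, i.2.1)).1 = e then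
        some (G.r e, (b.symm (⟨i.1, h⟩, i.2.1)).2, i.2.2 - 1) else none)
    else none : Option (Idx G)) = some j at h
  split_ifs at h with h1 h2
  obtain rfl := Option.some.inj h
  simp

/-- A Cuntz-Krieger family on `ℓ²` of the indices. -/
theorem exists_family (hb : ∀ q, ((b q).1 : V) = G.s q.1) :
    ∃ T : CKFamily G (lp (fun _ : Idx G => ℂ) 2 →L[ℂ] lp (fun _ : Idx G => ℂ) 2),
    (∀ v, T.p v = opP (vertP v)) ∧ ∀ e, T.S e = opP (edgeP b e) := by
  classical
  have hp : ∀ (v : V) (ξ : lp (fun _ : Idx G => ℂ) 2) i,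
      opP (vertP (G := G) v) ξ i = if i.1 = v then ξ i else 0 := fun v ξ i => by
    rw [opP_apply]; exact ofSet_elim _ _ _
  refine ⟨{
    p := fun v => opP (vertP v)
    S := fun e => opP (edgeP b e)
    isProj := fun v => ⟨?_, ?_⟩
    orth := ?_
    partialIsom := ?_
    star_mul := ?_
    sum_eq := ?_ }, fun _ => rfl, fun _ => rfl⟩
  · change opP _ * opP _ = opP _
    ext ξ i
    change opP (vertP v) (opP (vertP v) ξ) i = _
    rw [hp, hp]
    split_ifs <;> rfl
  · change star _ = _
    rw [star_opP]
    rfl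
  · intro v w hvw
    ext ξ i
    change opP (vertP v) (opP (vertP w) ξ) i = 0
    rw [hp, hp]
    split_ifs with h1 h2
    · exact absurd (h1.symm.trans h2) hvw
    · rfl
    · rfl
  · intro e
    rw [star_opP, opP_mul, opP_mul, PEquiv.self_trans_symm]
    congr 1
    ext i : 1
    change (PEquiv.ofSet _ i).bind _ = _
    change (if (edgeP b e i).isSome then some i else none : Option (Idx G)).bind _ = _
    split_ifs with h
    · rfl
    · simp at h; exact h.symm
  · intro e
    rw [star_opP, opP_mul, PEquiv.symm_trans_self]
    ext ξ i
    rw [hp, opP_apply, ofSet_elim]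
    exact if_congr (edgeP_symm_isSome b e i) rfl rfl
  · intro v hv
    ext ξ i
    have h1 : ∀ e, (opP (edgeP b e) * star (opP (edgeP b e))) ξ i =
        if (edgeP b e i).isSome then ξ i else 0 := fun e => by
      rw [star_opP, opP_mul, PEquiv.self_trans_symm, opP_apply, ofSet_elim]; rfl
    have h2 : (∑ e ∈ G.out v, opP (edgeP b e) * star (opP (edgeP b e))) ξ i =
        ∑ e ∈ G.out v, (if (edgeP b e i).isSome then ξ i else 0) := by
      rw [_root_.sum_apply, lp.coeFn_sum, Finset.sum_apply]
      exact Finset.sum_congr rfl fun e _ => h1 e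
    rw [hp, h2]
    simp only [edgeP_isSome]
    split_ifs with h
    · subst h
      rw [Finset.sum_eq_single (b.symm (⟨i.1, hv⟩, i.2.1)).1]
      · rw [if_pos ⟨hv, rfl⟩]
      · rintro e - he
        exact if_neg fun ⟨_, h⟩ => he h.symm
      · intro h
        refine absurd ?_ h
        rw [G.mem_out, ← hb]
        simp
    · symm
      refine Finset.sum_eq_zero fun e he => if_neg ?_
      rintro ⟨h', rfl⟩
      rw [G.mem_out, ← hb] at he
      simp at he
      exact h he

/-- The operator `T` raises the degree by `k`. -/
def Raises (k : ℤ) (T : lp (fun _ : Idx G => ℂ) 2 →L[ℂ] lp (fun _ : Idx G => ℂ) 2) : Prop :=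
  ∀ m ξ, (∀ i, i.2.2 ≠ m → ξ i = 0) → ∀ i, i.2.2 ≠ m + k → T ξ i = 0

theorem Raises.mul {k l : ℤ} {T T' : lp (fun _ : Idx G => ℂ) 2 →L[ℂ] lp (fun _ : Idx G => ℂ) 2}
    (h : Raises k T) (h' : Raises l T') : Raises (k + l) (T * T') := fun m ξ hξ i hi =>
  h (m + l) (T' ξ) (h' m ξ hξ) i (by rwa [add_assoc, add_comm l k])

theorem Raises.opP {k : ℤ} {f : Idx G ≃. Idx G}
    (h : ∀ i j, f i = some j → i.2.2 = j.2.2 + k) : Raises k (opP f) := by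
  intro m ξ hξ i hi
  rw [opP_apply]
  cases hf : f i with
  | none => rfl
  | some j =>
    refine hξ j fun hj => hi ?_
    rw [h i j hf, hj]

variable {T : CKFamily G (lp (fun _ : Idx G => ℂ) 2 →L[ℂ] lp (fun _ : Idx G => ℂ) 2)}

theorem raises_p (hp : ∀ v, T.p v = opP (vertP v)) (v : V) : Raises 0 (T.p v) := by
  rw [hp]
  refine Raises.opP fun i j h => ?_
  classical
  change (if _ then some i else none : Option (Idx G)) = some j at h
  split_ifs at h
  rw [Option.some.inj h, add_zero]

theorem raises_S (hS : ∀ e, T.S e = opP (edgeP b e)) (e : Edge) : Raises 1 (T.S e) := by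
  rw [hS]
  exact Raises.opP fun i j h => edgeP_degree b h

theorem raises_star_S (hS : ∀ e, T.S e = opP (edgeP b e)) (e : Edge) :
    Raises (-1) (star (T.S e)) := by
  rw [hS, star_opP]
  refine Raises.opP fun i j h => ?_
  rw [edgeP_degree b ((edgeP b e).eq_some_iff.1 h)]
  ring

theorem raises_walk (hp : ∀ v, T.p v = opP (vertP v)) (hS : ∀ e, T.S e = opP (edgeP b e)) :
    ∀ (v : V) (l : List Edge), Raises l.length (T.walk v l)
  | v, [] => raises_p hp v
  | v, e :: l => by
    have := (raises_S b hS e).mul (raises_walk hp hS (G.r e) l)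
    rwa [add_comm, ← Nat.cast_one, ← Nat.cast_add] at this

theorem raises_star_walk (hp : ∀ v, T.p v = opP (vertP v)) (hS : ∀ e, T.S e = opP (edgeP b e)) :
    ∀ (v : V) (l : List Edge), Raises (-l.length) (star (T.walk v l))
  | v, [] => by
    have := raises_p hp v
    rw [← T.star_p] at this
    change Raises (-((0 : ℕ) : ℤ)) (star (T.p v))
    rwa [Nat.cast_zero, neg_zero]
  | v, e :: l => by
    have := (raises_star_walk hp hS (G.r e) l).mul (raises_star_S b hS e)
    rw [← StarMul.star_mul] at this
    have h : (-((e :: l).length : ℕ) : ℤ) = -l.length + -1 := by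
      rw [List.length_cons]; push_cast; ring
    rw [h]
    exact this

open Classical in
/-- The basis vector at the index `(v, 0, 0)`. -/
def base (v : V) : lp (fun _ : Idx G => ℂ) 2 := lp.single 2 (v, 0, 0) 1

open Classical in
variable (T) in
/-- The approximations of the functional of a graph weight: the matrix coefficient at `v`, after
`n` conjugations by the partial isometries of the edges. -/
def approx (g : V → ℝ) (lam : Edge → ℝ) : ℕ → V →
    (lp (fun _ : Idx G => ℂ) 2 →L[ℂ] lp (fun _ : Idx G => ℂ) 2) → ℂ
  | 0, v, A => g v * (A (base v)) (v, 0, 0)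
  | n + 1, v, A => if G.IsSink v then g v * (A (base v)) (v, 0, 0) else
      ∑ e ∈ G.out v, lam e * approx g lam n (G.r e) (star (T.S e) * A * T.S e)

theorem approx_add (g : V → ℝ) (lam : Edge → ℝ) (n : ℕ) : ∀ (v : V) (A A'),
    approx T g lam n v (A + A') = approx T g lam n v A + approx T g lam n v A' := by
  have h0 : ∀ v (A A' : lp (fun _ : Idx G => ℂ) 2 →L[ℂ] lp (fun _ : Idx G => ℂ) 2),
      (g v : ℂ) * ((A + A') (base v)) (v, 0, 0) =
      g v * (A (base v)) (v, 0, 0) + g v * (A' (base v)) (v, 0, 0) := fun v A A' => mul_add _ _ _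
  induction n with
  | zero => exact h0
  | succ n ih =>
    intro v A A'
    simp only [approx]
    split_ifs with h
    · exact h0 v A A'
    · simp only [mul_add, add_mul, ih, Finset.sum_add_distrib]

theorem approx_smul (g : V → ℝ) (lam : Edge → ℝ) (n : ℕ) : ∀ (v : V) (c : ℂ) (A),
    approx T g lam n v (c • A) = c * approx T g lam n v A := by
  have h0 : ∀ v (c : ℂ) (A : lp (fun _ : Idx G => ℂ) 2 →L[ℂ] lp (fun _ : Idx G => ℂ) 2),
      (g v : ℂ) * ((c • A) (base v)) (v, 0, 0) = c * (g v * (A (base v)) (v, 0, 0)) :=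
    fun v c A => mul_left_comm _ _ _
  induction n with
  | zero => exact h0
  | succ n ih =>
    intro v c A
    simp only [approx]
    split_ifs with h
    · exact h0 v c A
    · simp only [mul_smul_comm, smul_mul_assoc, ih, Finset.mul_sum, mul_left_comm c]

theorem approx_nonneg {g : V → ℝ} {lam : Edge → ℝ} (hg : IsGraphWeight G g lam) (n : ℕ) :
    ∀ (v : V) (A), 0 ≤ approx T g lam n v (star A * A) := by
  have h0 : ∀ v (A : lp (fun _ : Idx G => ℂ) 2 →L[ℂ] lp (fun _ : Idx G => ℂ) 2),
      (0 : ℂ) ≤ (g v : ℂ) * ((star A * A) (base v)) (v, 0, 0) := by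
    intro v A
    classical
    refine mul_nonneg (by exact_mod_cast hg.g_nonneg v) ?_
    have h1 : ((star A * A) (base v)) (v, 0, 0) =
        inner ℂ (base (G := G) v) ((star A * A) (base v)) := by
      rw [base, lp.inner_single_left]
      simp
    rw [h1, ContinuousLinearMap.star_eq_adjoint]
    change (0 : ℂ) ≤ inner ℂ (base v) ((ContinuousLinearMap.adjoint A) (A (base v)))
    rw [ContinuousLinearMap.adjoint_inner_right, inner_self_eq_norm_sq_to_K]
    positivity
  induction n with
  | zero => exact h0
  | succ n ih =>
    intro v A
    simp only [approx]
    split_ifs with h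
    · exact h0 v A
    · refine Finset.sum_nonneg fun e _ => mul_nonneg (by exact_mod_cast hg.lam_nonneg e) ?_
      have : star (T.S e) * (star A * A) * T.S e = star (A * T.S e) * (A * T.S e) := by
        rw [StarMul.star_mul]; simp only [mul_assoc]
      rw [this]
      exact ih _ _

theorem approx_raises (hS : ∀ e, T.S e = opP (edgeP b e)) (g : V → ℝ) (lam : Edge → ℝ) {k : ℤ}
    (hk : k ≠ 0) (n : ℕ) : ∀ (v : V) (A), Raises k A → approx T g lam n v A = 0 := by
  have h0 : ∀ v (A : lp (fun _ : Idx G => ℂ) 2 →L[ℂ] lp (fun _ : Idx G => ℂ) 2), Raises k A →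
      (g v : ℂ) * (A (base v)) (v, 0, 0) = 0 := by
    intro v A hA
    classical
    rw [hA 0 (base v) ?_ (v, 0, 0) (by simpa using hk.symm), mul_zero]
    intro i hi
    rw [base, lp.single_apply]
    exact Pi.single_eq_of_ne (M := fun _ : Idx G => ℂ) (fun h => hi (by rw [h])) 1
  induction n with
  | zero => exact h0
  | succ n ih =>
    intro v A hA
    simp only [approx]
    split_ifs with h
    · exact h0 v A hA
    · refine Finset.sum_eq_zero fun e _ => ?_
      rw [ih, mul_zero]
      have := ((raises_star_S b hS e).mul hA).mul (raises_S b hS e)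
      rwa [neg_add_eq_sub, sub_add_cancel] at this

open Classical in
theorem approx_walk (hp : ∀ v, T.p v = opP (vertP v)) {g : V → ℝ}
    {lam : Edge → ℝ} (hg : IsGraphWeight G g lam) (n : ℕ) :
    ∀ (v w w' : V) (l l' : List Edge), G.IsWalk w l → G.IsWalk w' l' → l.length = l'.length →
      l.length ≤ n → approx T g lam n v (T.walk w l * star (T.walk w' l')) =
        if v = w ∧ v = w' ∧ l = l' then ((l.map lam).prod : ℂ) * g (G.walkEnd w l) else 0 := by
  have hpv : ∀ (v : V) (ξ : lp (fun _ : Idx G => ℂ) 2) i,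
      T.p v ξ i = if i.1 = v then ξ i else 0 := fun v ξ i => by
    rw [hp, opP_apply]; exact ofSet_elim _ _ _
  have hbase : ∀ v : V, (base v : lp (fun _ : Idx G => ℂ) 2) (v, 0, 0) = 1 := fun v => by
    rw [base, lp.single_apply]; exact Pi.single_eq_same _ _
  have h0 : ∀ v w w' : V, (g v : ℂ) * ((T.walk w [] * star (T.walk w' [])) (base v)) (v, 0, 0) =
      if v = w ∧ v = w' ∧ ([] : List Edge) = [] then
        ((([] : List Edge).map lam).prod : ℂ) * g (G.walkEnd w []) else 0 := by
    intro v w w'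
    change (g v : ℂ) * (T.p w (star (T.p w') (base v))) (v, 0, 0) = _
    rw [T.star_p, hpv, hpv, hbase]
    by_cases h1 : v = w
    · subst h1
      by_cases h2 : v = w' <;> simp [h2, walkEnd]
    · simp [h1]
  induction n with
  | zero =>
    intro v w w' l l' _ _ h h'
    obtain rfl := List.length_eq_zero_iff.1 (Nat.le_zero.1 h')
    obtain rfl := List.length_eq_zero_iff.1 h.symm
    exact h0 v w w'
  | succ n ih =>
    intro v w w' l l' hl hl' hll hn
    simp only [approx]
    match l, l', hl, hl', hll, hn with
    | [], [], _, _, _, _ =>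
      by_cases h : G.IsSink v
      · rw [if_pos h]; exact h0 v w w'
      · rw [if_neg h]
        by_cases hw : v = w ∧ v = w'
        · obtain ⟨rfl, rfl⟩ := hw
          rw [if_pos ⟨rfl, rfl, rfl⟩]
          simp only [List.map_nil, List.prod_nil, walkEnd, one_mul, Complex.ofReal_one]
          rw [hg.eq_sum v h]
          push_cast
          refine Finset.sum_congr rfl fun e he => ?_
          have h1 := ih (G.r e) (G.r e) (G.r e) [] [] trivial trivial rfl (Nat.zero_le _)
          rw [if_pos ⟨rfl, rfl, rfl⟩] at h1
          simp only [List.map_nil, List.prod_nil, walkEnd, one_mul, Complex.ofReal_one] at h1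
          rw [← h1]
          congr 2
          simp only [CKFamily.walk, T.star_p, T.p_mul_p]
          have h2 := T.p_mul_S e
          rw [G.mem_out.1 he] at h2
          rw [mul_assoc, h2, T.star_mul]
        · rw [if_neg (fun h => hw ⟨h.1, h.2.1⟩)]
          refine Finset.sum_eq_zero fun e he => ?_
          have h2 := T.p_mul_S e
          rw [G.mem_out.1 he] at h2
          have h3 : star (T.S e) * (T.walk w [] * star (T.walk w' [])) * T.S e = 0 := by
            simp only [CKFamily.walk, T.star_p]
            rw [← h2, StarMul.star_mul, T.star_p]
            by_cases h4 : v = w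
            · have h5 : w' ≠ v := fun h => hw ⟨h4, h.symm⟩
              have h6 : T.p w' * (T.p v * T.S e) = 0 := by
                rw [← mul_assoc, T.orth _ _ h5, zero_mul]
              simp only [mul_assoc, h6, mul_zero]
            · have h6 : star (T.S e) * T.p v * T.p w = 0 := by
                rw [mul_assoc, T.orth _ _ h4, mul_zero]
              simp only [← mul_assoc, h6, zero_mul]
          rw [h3]
          have := approx_smul (T := T) g lam n (G.r e) 0 0
          rw [zero_smul, zero_mul] at this
          rw [this, mul_zero]
    | a :: l, c :: l', hl, hl', hll, hn =>
      have hll' : l.length = l'.length := by simpa using hll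
      have hn' : l.length ≤ n := by simpa using hn
      have hwa : T.p w * T.S a = T.S a := by rw [← hl.1]; exact T.p_mul_S a
      by_cases h : G.IsSink v
      · have hvw : v ≠ w := fun hvw => h a (hl.1.trans hvw.symm)
        rw [if_pos h, if_neg fun h' => hvw h'.1]
        have h1 : T.walk w (a :: l) * star (T.walk w' (c :: l')) =
            T.p w * (T.walk w (a :: l) * star (T.walk w' (c :: l'))) := by
          rw [CKFamily.walk, ← mul_assoc, ← mul_assoc, hwa]
        rw [h1]
        change (g v : ℂ) * (T.p w _) (v, 0, 0) = 0
        rw [hpv]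
        simp [hvw]
      · have key : ∀ e, star (T.S e) * (T.walk w (a :: l) * star (T.walk w' (c :: l'))) * T.S e =
            if e = a ∧ e = c then T.walk (G.r a) l * star (T.walk (G.r c) l') else 0 := by
          intro e
          have h1 : star (T.S e) * (T.walk w (a :: l) * star (T.walk w' (c :: l'))) * T.S e =
              (star (T.S e) * T.S a) * T.walk (G.r a) l *
                (star (T.walk (G.r c) l') * (star (T.S c) * T.S e)) := by
            simp only [CKFamily.walk, StarMul.star_mul, mul_assoc]
          rw [h1]
          by_cases hea : e = a
          · subst hea
            by_cases hec : e = c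
            · subst hec
              rw [if_pos ⟨rfl, rfl⟩, T.star_mul, T.p_mul_walk hl.2]
              congr 1
              have h2 := congrArg star (T.p_mul_walk hl'.2)
              rwa [StarMul.star_mul, T.star_p] at h2
            · rw [if_neg fun h => hec h.2, T.star_S_mul_S (Ne.symm hec), mul_zero, mul_zero]
          · rw [if_neg fun h => hea h.1, T.star_S_mul_S hea, zero_mul, zero_mul]
        have hzero : ∀ u, approx T g lam n u 0 = 0 := fun u => by
          have := approx_smul (T := T) g lam n u 0 0
          rwa [zero_smul, zero_mul] at this
        rw [if_neg h]
        by_cases hc : v = w ∧ v = w' ∧ a :: l = c :: l'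
        · obtain ⟨rfl, rfl, hcl⟩ := hc
          obtain ⟨rfl, rfl⟩ := List.cons.inj hcl
          rw [if_pos ⟨rfl, rfl, rfl⟩, Finset.sum_eq_single a]
          · rw [key, if_pos ⟨rfl, rfl⟩, ih _ _ _ _ _ hl.2 hl'.2 hll' hn', if_pos ⟨rfl, rfl, rfl⟩]
            simp only [List.map_cons, List.prod_cons, walkEnd]
            push_cast
            ring
          · rintro e - he
            rw [key, if_neg fun h => he h.1, hzero, mul_zero]
          · exact fun h => absurd (G.mem_out.2 hl.1) h
        · rw [if_neg hc]
          refine Finset.sum_eq_zero fun e he => ?_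
          rw [key]
          by_cases hec : e = a ∧ e = c
          · obtain ⟨rfl, rfl⟩ := hec
            rw [if_pos ⟨rfl, rfl⟩, ih _ _ _ _ _ hl.2 hl'.2 hll' hn', if_neg, mul_zero]
            rintro ⟨-, -, rfl⟩
            have := G.mem_out.1 he
            exact hc ⟨this.symm.trans hl.1, this.symm.trans hl'.1, rfl⟩
          · rw [if_neg hec, hzero, mul_zero]

open Classical in
/-- The functional of a graph weight exists and is positive. -/
theorem exists_phi [Countable V] [Countable Edge] {g : V → ℝ} {lam : Edge → ℝ}
    (h : IsGraphWeight G g lam) : ∃ φ : core G →ₗ[ℂ] ℂ,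
      (∀ μ ν : G.Path, φ (gen μ ν) =
        if μ = ν then ((ν.edges.map lam).prod : ℂ) * g ν.rng else 0) ∧
      ∀ a, 0 ≤ φ (star a * a) := by
  obtain ⟨b, hb⟩ := exists_branching G
  obtain ⟨T, hp, hS⟩ := exists_family b hb
  let π : CStar G →⋆ₙₐ[ℂ] (lp (fun _ : Idx G => ℂ) 2 →L[ℂ] lp (fun _ : Idx G => ℂ) 2) :=
    evalAt ⟨_, T⟩
  have hπ : ∀ μ ν : G.Path, π (gen μ ν) = T.path μ * star (T.path ν) := by
    have h1 : ∀ (v : V) (l : List Edge), π ((univFamily G).walk v l) = T.walk v l := by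
      intro v l
      induction l generalizing v with
      | nil => rfl
      | cons e l ih =>
        rw [CKFamily.walk, CKFamily.walk, map_mul, ih]; rfl
    intro μ ν
    change π ((univFamily G).path μ * star ((univFamily G).path ν)) = _
    rw [map_mul, map_star, CKFamily.path, CKFamily.path, h1, h1]
    rfl
  have : Nonempty (Finset V × ℕ) := ⟨(∅, 0)⟩
  let φ : Finset V × ℕ → core G →ₗ[ℂ] ℂ := fun F =>
    { toFun := fun a => ∑ v ∈ F.1, approx T g lam F.2 v (π a)
      map_add' := fun a a' => by
        rw [← Finset.sum_add_distrib]
        refine Finset.sum_congr rfl fun v _ => ?_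
        rw [← approx_add, ← map_add]; rfl
      map_smul' := fun c a => by
        rw [smul_eq_mul, Finset.mul_sum]
        refine Finset.sum_congr rfl fun v _ => ?_
        rw [RingHom.id_apply, ← approx_smul, ← map_smul]; rfl }
  have hgen : ∀ μ ν : G.Path, ∀ᶠ F in Filter.atTop, φ F (gen μ ν) =
      if μ = ν then ((ν.edges.map lam).prod : ℂ) * g ν.rng else 0 := by
    intro μ ν
    refine (Filter.eventually_ge_atTop ({μ.src}, μ.edges.length)).mono fun F hF => ?_
    change ∑ v ∈ F.1, approx T g lam F.2 v (π (gen μ ν)) = _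
    simp only [hπ]
    by_cases hlen : μ.edges.length = ν.edges.length
    · simp only [CKFamily.path,
        approx_walk hp h F.2 _ _ _ _ _ μ.isWalk ν.isWalk hlen hF.2]
      by_cases hμν : μ = ν
      · subst hμν
        rw [if_pos rfl, Finset.sum_eq_single μ.src]
        · rw [if_pos ⟨rfl, rfl, rfl⟩]; rfl
        · exact fun v _ hv => if_neg fun h => hv h.1
        · exact fun h => absurd (hF.1 (Finset.mem_singleton_self _)) h
      · rw [if_neg hμν]
        refine Finset.sum_eq_zero fun v _ => if_neg ?_
        exact fun h => hμν (Path.ext (h.1.symm.trans h.2.1) h.2.2)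
    · rw [if_neg fun h => hlen (by rw [h])]
      refine Finset.sum_eq_zero fun v _ => ?_
      refine approx_raises b hS g lam (k := μ.edges.length + -ν.edges.length) (by lia) _ _ _ ?_
      exact (raises_walk b hp hS _ _).mul (raises_star_walk b hp hS _ _)
  have hconv : ∀ a : core G, ∃ c, ∀ᶠ F in Filter.atTop, φ F a = c := by
    rintro ⟨a, ha⟩
    induction ha using Submodule.span_induction with
    | mem a ha =>
      obtain ⟨μ, ν, rfl⟩ := ha
      exact ⟨_, hgen μ ν⟩
    | zero => exact ⟨0, Filter.Eventually.of_forall fun F => map_zero (φ F)⟩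
    | add a a' ha ha' h h' =>
      obtain ⟨c, hc⟩ := h
      obtain ⟨c', hc'⟩ := h'
      refine ⟨c + c', (hc.and hc').mono fun F hF => ?_⟩
      rw [← hF.1, ← hF.2, ← map_add]; rfl
    | smul k a ha h =>
      obtain ⟨c, hc⟩ := h
      refine ⟨k • c, hc.mono fun F hF => ?_⟩
      rw [← hF, ← map_smul]; rfl
  choose c hc using hconv
  have hlim : ∀ a, Filter.Tendsto (fun F => φ F a) Filter.atTop (nhds (c a)) := fun a =>
    (Filter.tendsto_congr' (hc a)).2 tendsto_const_nhds
  refine ⟨linearMapOfTendsto c (g := φ) (l := Filter.atTop) (tendsto_pi_nhds.2 hlim),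
    fun μ ν => ?_, fun a => ?_⟩
  · exact tendsto_nhds_unique (hlim _) ((Filter.tendsto_congr' (hgen μ ν)).2 tendsto_const_nhds)
  · refine ge_of_tendsto' (hlim (star a * a)) fun F => ?_
    refine Finset.sum_nonneg fun v _ => ?_
    have : π ((star a * a : core G) : CStar G) = star (π a) * π a := by
      rw [← map_star, ← map_mul]; rfl
    rw [this]
    exact approx_nonneg h _ _ _

end Functional

/-! ### The Hilbert space of the weight -/

section Hilbert

variable [Countable V] [Countable Edge] {g : V → ℝ} {lam : Edge → ℝ}

/-- The functional of a graph weight, on `A_c`: the linear functional with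
`φ (S_μ S_ν⋆) = δ_{μ, ν} lam(μ) g (r μ)`. -/
def phi (h : IsGraphWeight G g lam) : core G →ₗ[ℂ] ℂ := (exists_phi h).choose

open Classical in
theorem phi_gen (h : IsGraphWeight G g lam) (μ ν : G.Path) : phi h (gen μ ν) =
    if μ = ν then ((ν.edges.map lam).prod : ℂ) * g ν.rng else 0 :=
  (exists_phi h).choose_spec.1 μ ν

theorem phi_nonneg (h : IsGraphWeight G g lam) (a : core G) : 0 ≤ phi h (star a * a) :=
  (exists_phi h).choose_spec.2 a

theorem phi_star (h : IsGraphWeight G g lam) (a : core G) : phi h (star a) = star (phi h a) := by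
  obtain ⟨a, ha⟩ := a
  induction ha using Submodule.span_induction with
  | mem a ha =>
    obtain ⟨μ, ν, rfl⟩ := ha
    classical
    have h1 : star (gen μ ν) = gen ν μ := Subtype.ext (by
      change star ((univFamily G).path μ * star ((univFamily G).path ν)) =
        (univFamily G).path ν * star ((univFamily G).path μ)
      simp)
    change phi h (star (gen μ ν)) = star (phi h (gen μ ν))
    rw [h1, phi_gen, phi_gen]
    by_cases h2 : μ = ν
    · subst h2
      simp
    · simp [h2, Ne.symm h2]
  | zero =>
    change phi h (star 0) = star (phi h 0)
    rw [star_zero, map_zero, star_zero]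
  | add a b ha hb h1 h2 =>
    have key : ∀ x y : core G, phi h (star x) = star (phi h x) → phi h (star y) = star (phi h y) →
        phi h (star (x + y)) = star (phi h (x + y)) := fun x y hx hy => by
      rw [star_add, map_add, hx, hy, map_add, star_add]
    exact key ⟨a, ha⟩ ⟨b, hb⟩ h1 h2
  | smul c a ha h1 =>
    have key : ∀ x : core G, phi h (star x) = star (phi h x) →
        phi h (star (c • x)) = star (phi h (c • x)) := fun x hx => by
      rw [star_smul, map_smul, hx, map_smul, star_smul]
    exact key ⟨a, ha⟩ h1

set_option linter.unusedVariables false in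
/-- `A_c` with the semi-inner product `φ (a⋆ b)`. -/
def PreH (h : IsGraphWeight G g lam) : Type (u + 1) := core G

variable (h : IsGraphWeight G g lam)

instance : AddCommGroup (PreH h) := inferInstanceAs (AddCommGroup (core G))

instance : Module ℂ (PreH h) := inferInstanceAs (Module ℂ (core G))

/-- The identity map from `A_c` to the semi-inner product space. -/
def toPreH : core G ≃ₗ[ℂ] PreH h := LinearEquiv.refl ℂ _

/-- The semi-inner product `φ (a⋆ b)`. -/
abbrev preHCore : PreInnerProductSpace.Core ℂ (PreH h) where
  inner a b := phi h (star ((toPreH h).symm a) * (toPreH h).symm b)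
  conj_inner_symm a b := by
    rw [← Complex.star_def, ← phi_star, StarMul.star_mul, star_star]
  re_inner_nonneg a := (RCLike.nonneg_iff.1 (phi_nonneg h _)).1
  add_left a b c := by rw [map_add, star_add, add_mul, map_add]
  smul_left a b c := by
    rw [map_smul, star_smul, smul_mul_assoc, map_smul]; rfl

instance : SeminormedAddCommGroup (PreH h) :=
  InnerProductSpace.Core.toSeminormedAddCommGroup (c := preHCore h)

instance : InnerProductSpace ℂ (PreH h) := InnerProductSpace.ofCore (preHCore h)

/-- The GNS space of the weight: the completion of `A_c` for `⟨a, b⟩ = φ (a⋆ b)`. -/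
abbrev H : Type (u + 1) := UniformSpace.Completion (PreH h)

/-- The canonical map from `A_c` to the GNS space. -/
def toH (a : core G) : H h := (toPreH h a : PreH h)

end Hilbert

/-! ### The operator `D` and its spectral projections on the Kasparov module -/

namespace Sub

variable (M : G.Sub)

/-- The graph of the closure of the operator `D` with domain `A_c ⊆ X` and
`D (S_μ S_ν⋆) = (|μ|_σ - |ν|_σ) S_μ S_ν⋆`. -/
def graphD : Submodule ℂ (M.X × M.X) :=
  (Submodule.span ℂ {x | ∃ μ ν : G.Path, x = (M.toX (gen μ ν),
    ((M.len μ : ℂ) - M.len ν) • M.toX (gen μ ν))}).topologicalClosure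

/-- `Φ` is the family of the spectral projections of (the closure of) `D`, whose spectrum is
contained in `ℤ`: mutually orthogonal projections in the adjointable operators, with sum `1`
(strictly), and `D = ∑ m Φ_m`, that is, `x` is in the domain of `D` with `D x = y` if and only if
`Φ_m y = m Φ_m x` for all `m`. -/
structure IsSpectralResolution (Φ : ℤ → M.X → M.X) : Prop where
  adjoint : ∀ m x y, M.ip (Φ m x) y = M.ip x (Φ m y)
  mul : ∀ m n x, Φ m (Φ n x) = if m = n then Φ m x else 0
  hasSum : ∀ x, HasSum (fun m => Φ m x) x
  graph : ∀ x y, (x, y) ∈ M.graphD ↔ ∀ m : ℤ, Φ m y = (m : ℂ) • Φ m x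

/-- Finite rank endomorphisms of `X`: finite sums of `Θ_{x,y}`. -/
def IsFiniteRank (K : M.X → M.X) : Prop :=
  ∃ (n : ℕ) (x y : Fin n → M.X), ∀ z, K z = ∑ i, M.theta (x i) (y i) z

/-- Compact endomorphisms of `X`: norm limits of finite rank endomorphisms. -/
def IsCompactEnd (K : M.X → M.X) : Prop :=
  (∃ K' : M.X → M.X, ∀ x y, M.ip (K x) y = M.ip x (K' y)) ∧
    ∀ ε > 0, ∃ F, M.IsFiniteRank F ∧ ∀ x, ‖K x - F x‖ ≤ ε * ‖x‖

/-! ### The von Neumann algebra, the trace and the weight `φ_D` -/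

variable [Countable V] [Countable Edge] {g : V → ℝ} {lam : Edge → ℝ}
  (h : IsGraphWeight G g lam)

/-- The bounded operator `T` on the GNS space is the action of the endomorphism `K` of `X`: on
`a ∈ A_c` both are the limit of the same sequence in `A_c`. -/
def Represents (K : M.X → M.X) (T : H h →L[ℂ] H h) : Prop :=
  ∀ a : core G, (K (M.toX a), T (toH h a)) ∈ closure {x : M.X × H h | ∃ c : core G,
    x = (M.toX c, toH h c)}

/-- The von Neumann algebra `N = (End⁰(X))''` on the GNS space. -/
def vN : Set (H h →L[ℂ] H h) :=
  Set.centralizer (Set.centralizer {T | ∃ K, M.IsCompactEnd K ∧ M.Represents h K T})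

/-- The spectral projection of `D`, as an operator on the GNS space, for the eigenvalue `k`. -/
def projH (k : ℤ) : H h →L[ℂ] H h :=
  (Submodule.span ℂ {x | ∃ μ ν : G.Path, (M.len μ : ℤ) - M.len ν = k ∧
    x = toH h (gen μ ν)}).topologicalClosure.starProjection

/-- The unitary operator `c ^ (i t D)` on the GNS space, `c > 0`. -/
def unitaryD (c t : ℝ) (x : H h) : H h :=
  ∑' k : ℤ, (c : ℂ) ^ (Complex.I * t * k) • M.projH h k x

/-- The trace `Tr` on the positive operators of `N`, with `Tr (Θ_{ξ,ξ}) = φ ((ξ | ξ))`: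
`Tr T = sup ∑ᵢ ⟨ξᵢ, T ξᵢ⟩` over the finite families in `A_c ⊆ X` with `∑ᵢ Θ_{ξᵢ,ξᵢ} ≤ 1`. -/
def trace (T : H h →L[ℂ] H h) : ℝ≥0∞ :=
  ⨆ (n : ℕ) (ξ : Fin n → core G)
    (_ : ∀ x, ∑ i, M.ip x (M.toX (ξ i)) * M.ip (M.toX (ξ i)) x ≤ M.ip x x),
    ENNReal.ofReal (∑ i, (inner ℂ (toH h (ξ i)) (T (toH h (ξ i)))).re)

/-- The operator `c ^ (D / 2)` on the sum of the eigenspaces of `D` for `-n, …, n`. -/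
def sqrtD (c : ℝ) (n : ℕ) : H h →L[ℂ] H h :=
  ∑ k ∈ Finset.Icc (-n : ℤ) n, (c : ℂ) ^ ((k : ℂ) / 2) • M.projH h k

/-- The weight `φ_D (T) = Tr (c ^ D T)` at a positive operator `T`, that is, the limit of the
increasing sequence `Tr (cₙ T cₙ)`, where `cₙ` is the part of `c ^ (D / 2)` on the eigenspaces of
`D` for `-n, …, n`. -/
def weightD (c : ℝ) (T : H h →L[ℂ] H h) : ℝ≥0∞ :=
  ⨆ n : ℕ, M.trace h (M.sqrtD h c n * T * M.sqrtD h c n)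

/-- The fixed points in `N` of the modular group of `φ_D`, which is inner, implemented by the
unitary operators `c ^ (i t D)`. -/
def modularFixed (c : ℝ) : Set (H h →L[ℂ] H h) :=
  {T | T ∈ M.vN h ∧ ∀ t x, T (M.unitaryD h c t x) = M.unitaryD h c t (T x)}

/-- The special edge weight: `c` on the edges of `M` and `1` on the other edges. -/
def edgeWeight (c : ℝ) (e : Edge) : ℝ := by
  classical exact if e ∈ M.edges then c else 1

end Sub

end LFGraph

end

noncomputable section

namespace LFGraph

variable {V Edge : Type u} {G : LFGraph V Edge}

/-! ### Density of `A_c` -/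

/-! The zhyvot action grades `C⋆(G)`. The `m`-th Fourier coefficient `M.component m` of `z ↦ σ_z(a)`
keeps `S_μ S_ν⋆` if `|μ|_σ - |ν|_σ = m` and kills it otherwise, and `Φ` is the coefficient of degree
zero. Elements of different degrees are orthogonal for `Φ(a⋆ b)`, so the components extend to
orthogonal projections `specProj m` of `X` whose finite sums are contractions. Because of this
uniform bound, strict convergence only has to be tested on the elements `S_μ S_ν⋆`
(`X.hasSum_of_gen`), and the projections diagonalise the closed operator `D` (`mem_graphD_iff`).

The three formulas come from one identity: if `b` is homogeneous of degree `k`, then `b Φ(b⋆ a) = b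
b⋆ a_k`, that is, `Θ_{b,b} = b b⋆ Φ_k`. For `b = p_v` the projections `b b⋆` add up to `1` strictly.
For `b = S_μ⋆` one gets `b b⋆ = p_{r(μ)}`, so all the summands in the third formula are equal, and
what remains is that their number is finite and positive (`finite_and_exists_walk_to`). For `b =
S_μ` one gets range projections. The exterior edges form trees that leave `M` for good, so a path
runs through its edges in `M` first; hence if `S_α S_β⋆` has degree `m > 0`, then `α` begins with a
path of `m` edges in `M`, and exactly one of the mutually orthogonal range projections fixes `S_α`.

By local finiteness `p_v Φ_m` is a finite sum `∑ Θ_{x_j,x_j}` with `x_j ∈ A_c`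
(`exists_p_mul_component`), so `q Φ_m = ∑ Θ_{q x_j,x_j}` has finite rank. On the GNS space, for `q ∈
F`, it is an orthogonal projection commuting with `D` and supported on one eigenspace. This gives
positivity and membership in the fixed point algebra, and reduces `φ_D` to a multiple of the trace,
up to truncation.

The trace is finite because `φ` is a KMS functional, hence tracial on degree zero
(`phi_coreComponent_mul`). This turns `⟨ξ, Θ_{x,x} ξ⟩` into `φ((x | ξ)(ξ | x))`, and the constraint
`∑ Θ_{ξ_i,ξ_i} ≤ 1` bounds the sum over `i` by `φ((x | x))`. That step uses positivity of `φ` for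
the order of the C⋆-algebra, not only on elements `a⋆ a` with `a ∈ A_c` (`phi_nonneg_of_nonneg`). -/

theorem univP_eq_gen (v : V) : univP v = (gen ⟨v, [], trivial⟩ ⟨v, [], trivial⟩ : core G).1 := by
  change (univFamily G).p v = (univFamily G).p v * star ((univFamily G).p v)
  rw [(univFamily G).star_p, (univFamily G).p_mul_p]

theorem univS_eq_gen (e : Edge) :
    univS e = (gen ⟨G.s e, [e], rfl, trivial⟩ ⟨G.r e, [], trivial⟩ : core G).1 := by
  change (univFamily G).S e =
    (univFamily G).S e * (univFamily G).p (G.r e) * star ((univFamily G).p (G.r e))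
  rw [(univFamily G).star_p, mul_assoc, (univFamily G).p_mul_p, (univFamily G).S_mul_p]

/-- The closure of `A_c` is a closed ⋆-subalgebra that contains all the generators `p_v` and `S_e`.
-/
theorem dense_core : Dense (core G : Set (CStar G)) := fun a => by
  refine CStar.induction (P := fun a => a ∈ (core G).topologicalClosure) ?_ ?_ ?_ (zero_mem _)
    (fun _ _ => add_mem) (fun _ _ => mul_mem) (fun c _ h => SMulMemClass.smul_mem c h)
    (fun _ => star_mem) a
  · exact NonUnitalStarSubalgebra.isClosed_topologicalClosure _
  · exact fun v => subset_closure (univP_eq_gen (G := G) v ▸ Subtype.property _)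
  · exact fun e => subset_closure (univS_eq_gen (G := G) e ▸ Subtype.property _)

/-- Induction over the elements `S_μ S_ν⋆`, on `A_c`. -/
theorem core_induction {P : core G → Prop} (hgen : ∀ μ ν, P (gen μ ν)) (h0 : P 0)
    (hadd : ∀ a b, P a → P b → P (a + b)) (hsmul : ∀ (c : ℂ) a, P a → P (c • a)) (a : core G) :
    P a := by
  obtain ⟨a, ha⟩ := a
  induction ha using Submodule.span_induction with
  | mem a ha => obtain ⟨μ, ν, rfl⟩ := ha; exact hgen μ ν
  | zero => exact h0
  | add a b ha hb h1 h2 => exact hadd _ _ h1 h2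
  | smul c a ha h1 => exact hsmul c _ h1

theorem CStar.dense_induction {P : CStar G → Prop} (hclosed : IsClosed {a | P a})
    (hP : ∀ a : core G, P a) (a : CStar G) : P a :=
  hclosed.closure_subset_iff.2 (fun a ha => hP ⟨a, ha⟩) (dense_core a)

variable (G) in
/-- The inclusion of `A_c` into `C⋆(G)`. -/
def coreIncl : core G →ₗ[ℂ] CStar G where
  toFun a := a
  map_add' _ _ := rfl
  map_smul' _ _ := rfl

theorem denseRange_coreIncl : DenseRange (coreIncl G) := by
  have : Set.range (coreIncl G) = (core G : Set (CStar G)) := Subtype.range_coe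
  rw [DenseRange, this]
  exact dense_core

/-- A closed property which is linear and holds at all `S_μ S_ν⋆` holds on `C⋆(G)`. -/
theorem CStar.gen_induction {P : CStar G → Prop} (hclosed : IsClosed {a | P a})
    (hgen : ∀ μ ν, P (gen μ ν : core G)) (h0 : P 0)
    (hadd : ∀ a b, P a → P b → P (a + b)) (hsmul : ∀ (c : ℂ) a, P a → P (c • a)) (a : CStar G) :
    P a :=
  CStar.dense_induction hclosed
    (LFGraph.core_induction hgen h0 (fun a b => hadd a b) fun c a => hsmul c a) a

theorem CStar.ext_gen {F : Type*} [NormedAddCommGroup F] [NormedSpace ℂ F]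
    {f f' : CStar G →L[ℂ] F} (h : ∀ μ ν : G.Path, f (gen μ ν : core G) = f' (gen μ ν : core G)) :
    f = f' := by
  ext a
  refine CStar.gen_induction (isClosed_eq f.continuous f'.continuous) h ?_ ?_ ?_ a
  · simp
  · intro a b ha hb; simp only [map_add, ha, hb]
  · intro c a ha; simp only [map_smul, ha]

namespace Sub

variable (M : G.Sub)

/-! ### Homogeneous elements -/

/-- `a` is homogeneous of degree `k` for the zhyvot action. -/
def IsHomogeneous (k : ℤ) (a : CStar G) : Prop :=
  ∀ z : Circle, M.act z a = ((z ^ k : Circle) : ℂ) • a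

variable {M}

theorem IsHomogeneous.mul {k l : ℤ} {a b : CStar G} (ha : M.IsHomogeneous k a)
    (hb : M.IsHomogeneous l b) : M.IsHomogeneous (k + l) (a * b) := fun z => by
  rw [map_mul, ha, hb, smul_mul_smul_comm, zpow_add]; rfl

theorem IsHomogeneous.adjoint {k : ℤ} {a : CStar G} (ha : M.IsHomogeneous k a) :
    M.IsHomogeneous (-k) (star a) := fun z => by
  rw [map_star, ha, star_smul, zpow_neg, Circle.coe_inv_eq_conj, Complex.star_def]

theorem isHomogeneous_p (v : V) : M.IsHomogeneous 0 ((univFamily G).p v) := fun z => by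
  rw [zpow_zero, Circle.coe_one, one_smul]; exact rescale_p _ v

open Classical in
theorem isHomogeneous_S (e : Edge) :
    M.IsHomogeneous (if e ∈ M.edges then 1 else 0) ((univFamily G).S e) := fun z => by
  have h : M.act z ((univFamily G).S e) =
      ((if e ∈ M.edges then z else 1 : Circle) : ℂ) • (univFamily G).S e := rfl
  rw [h]
  split_ifs <;> simp

theorem isHomogeneous_path (μ : G.Path) :
    M.IsHomogeneous (M.len μ) ((univFamily G).path μ) := by
  classical
  obtain ⟨v, l, hl⟩ := μ
  induction l generalizing v with
  | nil => exact isHomogeneous_p v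
  | cons e l ih =>
    have h := (isHomogeneous_S (M := M) e).mul (ih (G.r e) hl.2)
    change M.IsHomogeneous _ ((univFamily G).S e * (univFamily G).path ⟨G.r e, l, hl.2⟩)
    convert h using 1
    simp only [Sub.len, List.countP_cons, decide_eq_true_eq]
    push_cast
    rw [add_comm]

theorem isHomogeneous_gen (μ ν : G.Path) :
    M.IsHomogeneous (M.len μ - M.len ν) (gen μ ν : core G) := by
  rw [sub_eq_add_neg]
  exact (isHomogeneous_path μ).mul (isHomogeneous_path ν).adjoint

variable (M)

/-! ### Fourier coefficients of the zhyvot action -/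

theorem norm_act_le (z : Circle) (a : CStar G) : ‖M.act z a‖ ≤ ‖a‖ :=
  NonUnitalStarAlgHom.norm_apply_le _ _

theorem component_continuous (m : ℤ) (a : CStar G) :
    Continuous fun θ : ℝ => ((Circle.exp θ ^ (-m) : Circle) : ℂ) • M.act (Circle.exp θ) a := by
  have := M.act_continuous a
  have h : Continuous fun θ : ℝ => ((Circle.exp θ ^ (-m) : Circle) : ℂ) :=
    (continuous_subtype_val : Continuous ((↑) : Circle → ℂ)).comp (Circle.exp.continuous.zpow _)
  exact h.smul this

/-- The component of degree `m` for the zhyvot action. -/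
def component (m : ℤ) : CStar G →L[ℂ] CStar G :=
  LinearMap.mkContinuous
    { toFun := fun a => ((2 * Real.pi : ℝ) : ℂ)⁻¹ • ∫ θ in (0 : ℝ)..(2 * Real.pi),
        ((Circle.exp θ ^ (-m) : Circle) : ℂ) • M.act (Circle.exp θ) a
      map_add' := fun a b => by
        simp only [map_add, smul_add]
        rw [intervalIntegral.integral_add ((M.component_continuous m a).intervalIntegrable _ _)
          ((M.component_continuous m b).intervalIntegrable _ _), smul_add]
      map_smul' := fun c a => by
        simp only [map_smul, RingHom.id_apply]
        simp only [smul_comm _ c]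
        rw [intervalIntegral.integral_smul, smul_comm] } 1 fun a => by
    have h := intervalIntegral.norm_integral_le_of_norm_le_const (a := 0) (b := 2 * Real.pi)
      (f := fun θ => ((Circle.exp θ ^ (-m) : Circle) : ℂ) • M.act (Circle.exp θ) a) (C := ‖a‖)
      (fun θ _ => by rw [norm_smul, Circle.norm_coe, one_mul]; exact M.norm_act_le _ _)
    have h2 : (0 : ℝ) < 2 * Real.pi := by positivity
    rw [sub_zero, abs_of_pos h2] at h
    change ‖((2 * Real.pi : ℝ) : ℂ)⁻¹ • (_ : CStar G)‖ ≤ _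
    rw [norm_smul, norm_inv, Complex.norm_real, Real.norm_of_nonneg h2.le, one_mul,
      inv_mul_le_iff₀ h2]
    exact h.trans_eq (mul_comm _ _)

theorem norm_component_le (m : ℤ) (a : CStar G) : ‖M.component m a‖ ≤ ‖a‖ := by
  have h : ‖M.component m‖ ≤ 1 := LinearMap.mkContinuous_norm_le _ zero_le_one _
  simpa using (M.component m).le_of_opNorm_le h a

theorem component_apply (m : ℤ) (a : CStar G) : M.component m a =
    ((2 * Real.pi : ℝ) : ℂ)⁻¹ • ∫ θ in (0 : ℝ)..(2 * Real.pi),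
      ((Circle.exp θ ^ (-m) : Circle) : ℂ) • M.act (Circle.exp θ) a := rfl

/-- Lets every computation with the expectation be done by counting degrees. -/
theorem expect_eq_component (a : CStar G) : M.expect a = M.component 0 a := by
  simp [component_apply, expect]

theorem integral_circle_zpow {n : ℤ} (hn : n ≠ 0) :
    ∫ θ in (0 : ℝ)..(2 * Real.pi), ((Circle.exp θ ^ n : Circle) : ℂ) = 0 := by
  have h : ∀ θ : ℝ, ((Circle.exp θ ^ n : Circle) : ℂ) = Complex.exp ((n * Complex.I) * θ) := by
    intro θ
    rw [Circle.coe_zpow, Circle.coe_exp, ← Complex.exp_int_mul]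
    ring_nf
  simp only [h]
  rw [integral_exp_mul_complex (by simp [hn])]
  have : (n : ℂ) * Complex.I * ((2 * Real.pi : ℝ) : ℂ) = n * (2 * Real.pi * Complex.I) := by
    push_cast; ring
  rw [this, Complex.exp_int_mul_two_pi_mul_I]
  simp

variable {M}

/-- Orthogonality of the characters of the circle: the integrand is `z ^ (k - m) • a`. -/
theorem IsHomogeneous.component_eq {k : ℤ} {a : CStar G} (ha : M.IsHomogeneous k a) (m : ℤ) :
    M.component m a = if k = m then a else 0 := by
  have h : ∀ θ : ℝ, ((Circle.exp θ ^ (-m) : Circle) : ℂ) • M.act (Circle.exp θ) a =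
      ((Circle.exp θ ^ (k - m) : Circle) : ℂ) • a := fun θ => by
    rw [ha, smul_smul, ← Circle.coe_mul, ← zpow_add, neg_add_eq_sub]
  simp only [component_apply, h]
  split_ifs with hk
  · subst hk
    have : (2 * Real.pi : ℝ) ≠ 0 := by positivity
    have h3 : (((2 * Real.pi : ℝ) : ℂ))⁻¹ * ((2 * Real.pi : ℝ) : ℂ) = 1 :=
      inv_mul_cancel₀ (by exact_mod_cast this)
    simp only [sub_self, zpow_zero, Circle.coe_one, one_smul, intervalIntegral.integral_const,
      sub_zero]
    rw [← Complex.coe_smul, smul_smul, h3, one_smul]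
  · rw [intervalIntegral.integral_smul_const, integral_circle_zpow (sub_ne_zero.2 hk), zero_smul,
      smul_zero]

theorem component_gen (m : ℤ) (μ ν : G.Path) : M.component m (gen μ ν : core G) =
    if (M.len μ - M.len ν : ℤ) = m then ((gen μ ν : core G) : CStar G) else 0 :=
  (isHomogeneous_gen μ ν).component_eq m

/-- Left multiplication by `b` shifts degrees by `k`. Both sides are continuous and linear in `a`,
so homogeneous `a` suffice. Applied to an adjoint with `m = 0`, this is what relates `Θ_{b,b}` to a
spectral projection. -/
theorem IsHomogeneous.component_mul {k : ℤ} {b : CStar G} (hb : M.IsHomogeneous k b) (m : ℤ)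
    (a : CStar G) : M.component m (b * a) = b * M.component (m - k) a := by
  refine DFunLike.congr_fun (f := (M.component m).comp (ContinuousLinearMap.mul ℂ (CStar G) b))
    (g := (ContinuousLinearMap.mul ℂ (CStar G) b).comp (M.component (m - k))) ?_ a
  refine CStar.ext_gen fun μ ν => ?_
  change M.component m (b * (gen μ ν : core G)) = b * M.component (m - k) (gen μ ν : core G)
  rw [(hb.mul (isHomogeneous_gen μ ν)).component_eq, component_gen]
  by_cases h : (M.len μ - M.len ν : ℤ) = m - k
  · rw [if_pos h, if_pos (by lia)]
  · rw [if_neg h, if_neg (by lia), mul_zero]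

theorem isHomogeneous_component (m : ℤ) (a : CStar G) : M.IsHomogeneous m (M.component m a) := by
  intro z
  let π : CStar G →L[ℂ] CStar G := ⟨(M.act z : CStar G →ₗ[ℂ] CStar G), starHom_continuous _⟩
  refine DFunLike.congr_fun (f := π.comp (M.component m))
    (g := ((z ^ m : Circle) : ℂ) • M.component m) ?_ a
  refine CStar.ext_gen fun μ ν => ?_
  change M.act z (M.component m (gen μ ν : core G)) =
    ((z ^ m : Circle) : ℂ) • M.component m (gen μ ν : core G)
  rw [component_gen]
  split_ifs with h
  · rw [isHomogeneous_gen, h]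
  · simp

theorem component_component (m n : ℤ) (a : CStar G) :
    M.component m (M.component n a) = if m = n then M.component m a else 0 := by
  rw [(isHomogeneous_component n a).component_eq]
  by_cases h : n = m
  · subst h; simp
  · rw [if_neg h, if_neg (Ne.symm h)]

variable (M) in
-- For homogeneous `a` and `b` of different degrees, `a⋆ b` has nonzero degree and is killed by the
-- expectation; density in both variables does the rest. This is the self-adjointness of the
-- spectral projections.
theorem expect_star_component_mul (m : ℤ) (a b : CStar G) :
    M.expect (star (M.component m a) * b) = M.expect (star a * M.component m b) := by
  have hc : Continuous (M.component m) := (M.component m).continuous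
  simp only [expect_eq_component]
  have hc0 : Continuous (M.component 0) := (M.component 0).continuous
  refine CStar.gen_induction (P := fun b => M.component 0 (star (M.component m a) * b) =
    M.component 0 (star a * M.component m b)) ?_ ?_ ?_ ?_ ?_ b
  · exact isClosed_eq (by fun_prop) (by fun_prop)
  · intro ρ κ
    refine CStar.gen_induction (P := fun a => M.component 0 (star (M.component m a) * _) =
      M.component 0 (star a * M.component m _)) ?_ ?_ ?_ ?_ ?_ a
    · exact isClosed_eq (by fun_prop) (by fun_prop)
    · intro μ ν
      rw [component_gen, component_gen]
      have h := (isHomogeneous_gen (M := M) μ ν).adjoint.mul (isHomogeneous_gen (M := M) ρ κ)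
      split_ifs with h1 h2 h2
      · rfl
      · rw [h.component_eq, if_neg (by lia), mul_zero, map_zero]
      · rw [h.component_eq, if_neg (by lia), star_zero, zero_mul, map_zero]
      · simp
    · simp
    · intro a b ha hb; simp only [map_add, star_add, add_mul, ha, hb]
    · intro c a ha; simp only [map_smul, star_smul, smul_mul_assoc, ha]
  · simp
  · intro a b ha hb; simp only [map_add, mul_add, ha, hb]
  · intro c a ha; simp only [map_smul, mul_smul_comm, ha]

/-! ### Positivity of the expectation, and the grading of `A_c` -/

theorem expect_nonneg {a : CStar G} (ha : 0 ≤ a) : 0 ≤ M.expect a := by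
  obtain ⟨b, rfl⟩ := CStarAlgebra.nonneg_iff_eq_star_mul_self.1 ha
  exact M.expect_star_mul_self_nonneg b

theorem expect_mono {a b : CStar G} (h : a ≤ b) : M.expect a ≤ M.expect b := by
  rw [← sub_nonneg, ← expect_sub]
  exact expect_nonneg (sub_nonneg.2 h)

variable (M) in
-- The GNS space is a completion of `A_c` only, so the grading has to restrict to `A_c` before it
-- can act there.
theorem component_mem_core (m : ℤ) (a : core G) : M.component m a ∈ core G := by
  refine core_induction (P := fun a : core G => M.component m a ∈ core G) ?_ ?_ ?_ ?_ a
  · intro μ ν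
    rw [component_gen]
    split_ifs
    · exact Subtype.property _
    · exact zero_mem _
  · rw [ZeroMemClass.coe_zero, map_zero]; exact zero_mem _
  · intro a b ha hb; rw [AddMemClass.coe_add, map_add]; exact add_mem ha hb
  · intro c a ha
    have : M.component m ((c • a : core G) : CStar G) = c • M.component m a := map_smul _ _ _
    rw [this]; exact SMulMemClass.smul_mem _ ha

/-- The component of degree `m`, on `A_c`. -/
def coreComponent (m : ℤ) : core G →ₗ[ℂ] core G where
  toFun a := ⟨M.component m a, M.component_mem_core m a⟩
  map_add' _ _ := Subtype.ext (map_add _ _ _)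
  map_smul' _ _ := Subtype.ext (map_smul _ _ _)

theorem coe_coreComponent (m : ℤ) (a : core G) :
    (M.coreComponent m a : CStar G) = M.component m a := rfl

theorem coreComponent_gen (m : ℤ) (μ ν : G.Path) : M.coreComponent m (gen μ ν) =
    if (M.len μ - M.len ν : ℤ) = m then gen μ ν else 0 := by
  refine Subtype.ext ((M.component_gen m μ ν).trans ?_)
  split_ifs <;> rfl

theorem star_coreComponent_zero (a : core G) :
    star (M.coreComponent 0 a) = M.coreComponent 0 (star a) := Subtype.ext (by
  change star (M.component 0 (a : CStar G)) = M.component 0 (star (a : CStar G))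
  rw [← expect_eq_component, ← expect_eq_component, expect_star])

end Sub

namespace Sub

variable (M : G.Sub)

/-! ### The Kasparov module -/

theorem norm_toX (a : CStar G) : ‖M.toX a‖ = √‖M.expect (star a * a)‖ :=
  UniformSpace.Completion.norm_coe _

theorem norm_toX_sq (a : CStar G) : ‖M.toX a‖ ^ 2 = ‖M.expect (star a * a)‖ := by
  rw [norm_toX, Real.sq_sqrt (norm_nonneg _)]

theorem norm_expect_le (a : CStar G) : ‖M.expect a‖ ≤ ‖a‖ := by
  rw [expect_eq_component]; exact M.norm_component_le 0 a

theorem norm_expect_star_mul_le (a b : CStar G) :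
    ‖M.expect (star a * b)‖ ≤ ‖M.toX a‖ * ‖M.toX b‖ := by
  rw [norm_toX, norm_toX, ← Real.sqrt_mul (norm_nonneg _)]
  exact Real.le_sqrt_of_sq_le (M.norm_expect_star_mul_sq_le a b)

theorem norm_toX_le (a : CStar G) : ‖M.toX a‖ ≤ ‖a‖ := by
  rw [norm_toX]
  refine Real.sqrt_le_iff.2 ⟨norm_nonneg _, (M.norm_expect_le _).trans ?_⟩
  rw [CStarRing.norm_star_mul_self, sq]

/-- The canonical map from `C⋆(G)` to `X`, as a continuous linear map. -/
def toXL : CStar G →L[ℂ] M.X :=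
  LinearMap.mkContinuous
    (UniformSpace.Completion.toComplL.toLinearMap ∘ₗ M.toPreX.toLinearMap) 1 fun a => by
      rw [one_mul]; exact M.norm_toX_le a

theorem toXL_apply (a : CStar G) : M.toXL a = M.toX a := rfl

theorem toX_zero : M.toX 0 = 0 := map_zero M.toXL

variable {M} in
theorem X.toX_induction {P : M.X → Prop} (hclosed : IsClosed {x | P x})
    (h : ∀ a, P (M.toX a)) (x : M.X) : P x :=
  UniformSpace.Completion.induction_on x hclosed fun a => h (M.toPreX.symm a)

variable {M} in
theorem X.ext_toX {f f' : M.X → M.X} (hf : Continuous f) (hf' : Continuous f')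
    (h : ∀ a, f (M.toX a) = f' (M.toX a)) (x : M.X) : f x = f' x :=
  X.toX_induction (isClosed_eq hf hf') h x

variable {M} in
theorem X.gen_induction {P : M.X → Prop} (hclosed : IsClosed {x | P x})
    (hgen : ∀ μ ν, P (M.toX (gen μ ν : core G))) (h0 : P 0)
    (hadd : ∀ a b, P a → P b → P (a + b)) (hsmul : ∀ (c : ℂ) a, P a → P (c • a)) (x : M.X) :
    P x := by
  refine X.toX_induction hclosed (fun a => ?_) x
  refine CStar.gen_induction (P := fun a => P (M.toXL a)) (hclosed.preimage M.toXL.continuous)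
    hgen ?_ ?_ ?_ a
  · rwa [map_zero]
  · intro a b; rw [map_add]; exact hadd _ _
  · intro c a; rw [map_smul]; exact hsmul _ _

/-- The inner product of the pre-Hilbert module as a continuous sesquilinear map. -/
def preIp : M.PreX →L⋆[ℂ] M.PreX →L[ℂ] CStar G :=
  LinearMap.mkContinuous₂
    (LinearMap.mk₂'ₛₗ (starRingEnd ℂ) (RingHom.id ℂ)
      (fun a b => M.expect (star (M.toPreX.symm a) * M.toPreX.symm b))
      (fun a a' b => by simp only [map_add, star_add, add_mul, expect_add])
      (fun c a b => by
        simp only [map_smul, star_smul, smul_mul_assoc, expect_smul]; rfl)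
      (fun a b b' => by simp only [map_add, mul_add, expect_add])
      (fun c a b => by simp only [map_smul, mul_smul_comm, expect_smul]; rfl)) 1 fun a b => by
    rw [one_mul]
    refine (M.norm_expect_star_mul_le _ _).trans_eq ?_
    exact congrArg₂ _ (UniformSpace.Completion.norm_coe a) (UniformSpace.Completion.norm_coe b)

theorem continuous_preIp : Continuous fun p : M.PreX × M.PreX => M.preIp p.1 p.2 :=
  (M.preIp.continuous.comp continuous_fst).clm_apply continuous_snd

theorem continuous_ip : Continuous fun p : M.X × M.X => M.ip p.1 p.2 := by
  -- Only biadditivity and continuity are needed for the extension to the completions, so the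
  -- conjugate linearity in the first variable is forgotten here.
  let φ : M.PreX →+ M.PreX →+ CStar G :=
    { toFun := fun a => (M.preIp a : M.PreX →+ CStar G)
      map_zero' := by ext x; simp
      map_add' := fun x y => by ext z; simp }
  have h : Continuous fun p : M.PreX × M.PreX => φ p.1 p.2 := M.continuous_preIp
  exact (UniformSpace.Completion.isDenseInducing_toCompl M.PreX).extend_Z_bilin
    (UniformSpace.Completion.isDenseInducing_toCompl M.PreX) h

theorem ip_toX (a b : CStar G) : M.ip (M.toX a) (M.toX b) = M.expect (star a * b) :=
  (UniformSpace.Completion.isDenseInducing_coe.prodMap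
    UniformSpace.Completion.isDenseInducing_coe).extend_eq M.continuous_preIp
    (M.toPreX a, M.toPreX b)

variable {M} in
theorem continuous_ip_comp {α : Type*} [TopologicalSpace α] {f f' : α → M.X} (hf : Continuous f)
    (hf' : Continuous f') : Continuous fun t => M.ip (f t) (f' t) :=
  M.continuous_ip.comp (hf.prodMk hf')

variable {M} in
theorem X.toX_induction₂ {P : M.X → M.X → Prop} (hclosed : IsClosed {p : M.X × M.X | P p.1 p.2})
    (h : ∀ a b, P (M.toX a) (M.toX b)) (x y : M.X) : P x y :=
  UniformSpace.Completion.induction_on₂ x y hclosed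
    fun a b => h (M.toPreX.symm a) (M.toPreX.symm b)

/-- Being equal to one's component of degree zero is a closed condition. The lemma makes `Θ_{x,y}`
meaningful: right multiplication on `X` is controlled only for coefficients in the fixed point
algebra. -/
theorem isHomogeneous_ip (x y : M.X) : M.IsHomogeneous 0 (M.ip x y) := by
  have h : M.component 0 (M.ip x y) = M.ip x y := by
    refine X.toX_induction₂ (P := fun x y => M.component 0 (M.ip x y) = M.ip x y) ?_ ?_ x y
    · exact isClosed_eq ((M.component 0).continuous.comp M.continuous_ip) M.continuous_ip
    · intro a b
      rw [ip_toX, expect_eq_component, component_component, if_pos rfl]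
  rw [← h]; exact isHomogeneous_component 0 _

/-! ### Multiplication operators and rank one operators on `X` -/

/-- The extension to `X` of a linear map of `C⋆(G)` which is bounded for the norm of `X`. -/
def liftX (f : CStar G →ₗ[ℂ] CStar G) (C : ℝ) (hf : ∀ a, ‖M.toX (f a)‖ ≤ C * ‖M.toX a‖) :
    M.X →L[ℂ] M.X :=
  (LinearMap.mkContinuous (M.toPreX.toLinearMap ∘ₗ f ∘ₗ M.toPreX.symm.toLinearMap) C fun a => by
    have := hf (M.toPreX.symm a)
    simp only [toX, UniformSpace.Completion.norm_coe] at this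
    exact this).completion

theorem liftX_toX (f : CStar G →ₗ[ℂ] CStar G) (C : ℝ) (hf) (a : CStar G) :
    M.liftX f C hf (M.toX a) = M.toX (f a) :=
  ContinuousLinearMap.completion_apply_coe _ _

/-- The inequality `b⋆ a⋆ a b ≤ ‖a‖² b⋆ b` is preserved by the expectation. -/
theorem norm_toX_mul_le (a b : CStar G) : ‖M.toX (a * b)‖ ≤ ‖a‖ * ‖M.toX b‖ := by
  have h1 : star (a * b) * (a * b) ≤ ‖star a * a‖ • (star b * b) := by
    have := CStarAlgebra.star_left_conjugate_le_norm_smul (a := b) (b := star a * a)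
      (IsSelfAdjoint.star_mul_self a)
    simpa only [StarMul.star_mul, mul_assoc] using this
  have h2 := CStarAlgebra.norm_le_norm_of_nonneg_of_le (M.expect_star_mul_self_nonneg (a * b))
    (expect_mono (M := M) h1)
  rw [← Complex.coe_smul, expect_smul, norm_smul, CStarRing.norm_star_mul_self, Complex.norm_real,
    Real.norm_of_nonneg (by positivity), ← norm_toX_sq, ← norm_toX_sq] at h2
  refine abs_le_of_sq_le_sq' ?_ (by positivity) |>.2
  rw [mul_pow]
  nlinarith [h2]

/-- Left multiplication on `X`, as a continuous linear map. -/
def lmulL (a : CStar G) : M.X →L[ℂ] M.X :=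
  M.liftX (LinearMap.mul ℂ (CStar G) a) ‖a‖ (M.norm_toX_mul_le a)

theorem lmul_toX (a b : CStar G) : M.lmul a (M.toX b) = M.toX (a * b) :=
  M.liftX_toX (LinearMap.mul ℂ (CStar G) a) ‖a‖ (M.norm_toX_mul_le a) b

theorem continuous_lmul (a : CStar G) : Continuous (M.lmul a) := (M.lmulL a).continuous

theorem norm_lmul_le (a : CStar G) (x : M.X) : ‖M.lmul a x‖ ≤ ‖a‖ * ‖x‖ := by
  refine X.toX_induction (P := fun x => ‖M.lmul a x‖ ≤ ‖a‖ * ‖x‖) ?_ ?_ x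
  · have := M.continuous_lmul a
    exact isClosed_le (by fun_prop) (by fun_prop)
  · intro b
    rw [lmul_toX]
    exact M.norm_toX_mul_le a b

theorem lmul_sum {ι : Type*} (s : Finset ι) (a : ι → CStar G) (x : M.X) :
    M.lmul (∑ i ∈ s, a i) x = ∑ i ∈ s, M.lmul (a i) x := by
  refine X.ext_toX (f' := fun x => ∑ i ∈ s, M.lmul (a i) x) (M.continuous_lmul _)
    (continuous_finsetSum _ fun i _ => M.continuous_lmul _) ?_ x
  intro c
  simp only [lmul_toX, Finset.sum_mul]
  exact map_sum M.toXL _ _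

theorem ip_lmul (a : CStar G) (x y : M.X) : M.ip (M.lmul a x) y = M.ip x (M.lmul (star a) y) := by
  refine X.toX_induction₂ (P := fun x y => M.ip (M.lmul a x) y = M.ip x (M.lmul (star a) y))
    ?_ ?_ x y
  · exact isClosed_eq
      (continuous_ip_comp ((M.continuous_lmul a).comp continuous_fst) continuous_snd)
      (continuous_ip_comp continuous_fst ((M.continuous_lmul _).comp continuous_snd))
  · intro b c
    rw [lmul_toX, lmul_toX, ip_toX, ip_toX, StarMul.star_mul, mul_assoc]

variable {M} in
-- Since `f` is fixed by the action, it can be pulled out of the expectation on both sides: `Φ((a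
-- f)⋆ (a f)) = f⋆ Φ(a⋆ a) f`.
theorem IsHomogeneous.norm_toX_mul_le {f : CStar G} (hf : M.IsHomogeneous 0 f) (a : CStar G) :
    ‖M.toX (a * f)‖ ≤ ‖f‖ * ‖M.toX a‖ := by
  have hf' : f = M.expect f := by rw [expect_eq_component, hf.component_eq, if_pos rfl]
  have h : M.expect (star (a * f) * (a * f)) = star f * M.expect (star a * a) * f := by
    have e : star (a * f) * (a * f) = M.expect (star f) * ((star a * a) * M.expect f) := by
      rw [expect_star, ← hf', StarMul.star_mul]; simp only [mul_assoc]
    rw [e, expect_expect_mul, expect_mul_expect, expect_star, ← hf', mul_assoc]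
  refine abs_le_of_sq_le_sq' ?_ (by positivity) |>.2
  rw [norm_toX_sq, h, mul_pow, norm_toX_sq]
  calc ‖star f * M.expect (star a * a) * f‖ ≤ ‖star f‖ * ‖M.expect (star a * a)‖ * ‖f‖ :=
        norm_mul₃_le
    _ = _ := by rw [norm_star]; ring

variable {M} in
-- `rmul f` is defined as an extension by density, which takes the expected values because
-- multiplication by `f` is bounded for the norm of `X`.
theorem IsHomogeneous.rmul_toX {f : CStar G} (hf : M.IsHomogeneous 0 f) (a : CStar G) :
    M.rmul f (M.toX a) = M.toX (a * f) :=
  M.liftX_toX ((LinearMap.mul ℂ (CStar G)).flip f) ‖f‖ hf.norm_toX_mul_le a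

theorem theta_toX_left (a : CStar G) (y z : M.X) :
    M.theta (M.toX a) y z = M.toX (a * M.ip y z) := (M.isHomogeneous_ip y z).rmul_toX a

theorem theta_toX (a b c : CStar G) :
    M.theta (M.toX a) (M.toX b) (M.toX c) = M.toX (a * M.expect (star b * c)) := by
  rw [theta_toX_left, ip_toX]

theorem continuous_theta (a : CStar G) (y : M.X) : Continuous (M.theta (M.toX a) y) := by
  have h : M.theta (M.toX a) y = fun z => M.toXL (a * M.ip y z) := funext (M.theta_toX_left a y)
  rw [h]
  have := continuous_ip_comp (M := M) (continuous_const (y := y)) continuous_id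
  exact M.toXL.continuous.comp (continuous_const.mul this)

/-! ### The spectral projections of `D` -/

variable {M} in
-- The hypothesis says `(b | b) = (a | b)`, as for the image `b` of `a` under an orthogonal
-- projection. By Cauchy-Schwarz `‖b‖² ≤ ‖a‖ ‖b‖`.
theorem norm_toX_le_of_projection {a b : CStar G}
    (h : M.expect (star b * b) = M.expect (star a * b)) : ‖M.toX b‖ ≤ ‖M.toX a‖ := by
  have h1 := M.norm_expect_star_mul_le a b
  rw [← h, ← norm_toX_sq, sq] at h1
  rcases (norm_nonneg (M.toX b)).eq_or_lt with h0 | h0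
  · rw [← h0]; exact norm_nonneg _
  · exact le_of_mul_le_mul_right h1 h0

/-- A finite sum of components is an orthogonal projection, hence a contraction. That the bound does
not depend on `s` is what gives convergence of `∑ Φ_m x` on all of `X`. -/
theorem norm_toX_sum_component_le (s : Finset ℤ) (a : CStar G) :
    ‖M.toX (∑ m ∈ s, M.component m a)‖ ≤ ‖M.toX a‖ := by
  refine norm_toX_le_of_projection ?_
  simp only [expect_eq_component, star_sum, Finset.sum_mul, Finset.mul_sum, map_sum]
  refine Finset.sum_congr rfl fun m hm => ?_
  simp only [← expect_eq_component, expect_star_component_mul, component_component]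
  rw [Finset.sum_eq_single m]
  · rw [if_pos rfl]
  · intro n _ hn
    rw [if_neg hn, mul_zero, expect_eq_component, map_zero]
  · exact fun h => absurd hm h

/-- The spectral projection of `D` for the eigenvalue `m`, on `X`. -/
def specProj (m : ℤ) : M.X →L[ℂ] M.X :=
  M.liftX (M.component m) 1 fun a => by
    simpa using M.norm_toX_sum_component_le {m} a

theorem specProj_toX (m : ℤ) (a : CStar G) :
    M.specProj m (M.toX a) = M.toX (M.component m a) :=
  M.liftX_toX (M.component m) 1 _ a

attribute [irreducible] specProj

theorem norm_sum_specProj_le (s : Finset ℤ) (x : M.X) : ‖∑ m ∈ s, M.specProj m x‖ ≤ ‖x‖ := by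
  refine X.toX_induction (P := fun x => ‖∑ m ∈ s, M.specProj m x‖ ≤ ‖x‖) ?_ ?_ x
  · exact isClosed_le (by fun_prop) (by fun_prop)
  · intro a
    have := M.norm_toX_sum_component_le s a
    simp only [specProj_toX]
    rwa [← toXL_apply, map_sum] at this

theorem norm_specProj_le (m : ℤ) (x : M.X) : ‖M.specProj m x‖ ≤ ‖x‖ := by
  simpa using M.norm_sum_specProj_le {m} x

/-- The set of the points at which a series of operators with bounded partial sums converges is
closed. -/
theorem isClosed_hasSum {E F ι : Type*} [NormedAddCommGroup E] [NormedSpace ℂ E]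
    [NormedAddCommGroup F] [NormedSpace ℂ F] {T : ι → E →L[ℂ] F} {P : E →L[ℂ] F} {C : ℝ}
    (hC : ∀ (s : Finset ι) x, ‖∑ i ∈ s, T i x‖ ≤ C * ‖x‖) :
    IsClosed {x | HasSum (fun i => T i x) (P x)} := by
  refine isClosed_of_closure_subset fun x hx => ?_
  classical
  simp only [HasSum, SummationFilter.unconditional_filter, Metric.tendsto_atTop] at hx
  simp only [Set.mem_ofPred_eq, HasSum, SummationFilter.unconditional_filter, Metric.tendsto_atTop]
  intro ε hε
  -- Three-term estimate: replacing `x` by `y` changes the partial sums by at most `|C| ‖x - y‖` and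
  -- the limit by at most `‖P‖ ‖x - y‖`, together less than `ε / 2`; the error at `y` takes the
  -- other `ε / 2`. The `+ 1` keeps the denominator positive.
  obtain ⟨y, hy, hxy⟩ := Metric.mem_closure_iff.1 hx (ε / 2 / (|C| + ‖P‖ + 1)) (by positivity)
  obtain ⟨s₀, hs₀⟩ := hy (ε / 2) (by positivity)
  refine ⟨s₀, fun s hs => ?_⟩
  have h1 := hs₀ s hs
  have h2 := hC s (x - y)
  have h3 := P.le_opNorm (x - y)
  rw [dist_eq_norm] at h1 hxy ⊢
  simp only [map_sub, Finset.sum_sub_distrib] at h2 h3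
  rw [lt_div_iff₀ (by positivity)] at hxy
  have h4 : ∑ i ∈ s, T i x - P x = (∑ i ∈ s, T i x - ∑ i ∈ s, T i y)
      + (∑ i ∈ s, T i y - P y) - (P x - P y) := by abel
  have h5 := norm_sub_le ((∑ i ∈ s, T i x - ∑ i ∈ s, T i y) + (∑ i ∈ s, T i y - P y)) (P x - P y)
  have h6 := norm_add_le (∑ i ∈ s, T i x - ∑ i ∈ s, T i y) (∑ i ∈ s, T i y - P y)
  rw [h4]
  have h7 : C * ‖x - y‖ ≤ |C| * ‖x - y‖ :=
    mul_le_mul_of_nonneg_right (le_abs_self C) (norm_nonneg _)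
  have h8 := norm_nonneg (x - y)
  linarith

variable {M} in
-- The common route to strict convergence. With bounded partial sums, the set of points of
-- convergence is a closed subspace, so the elements `S_μ S_ν⋆` suffice; there the series in
-- question have at most one nonzero term.
theorem X.hasSum_of_gen {ι : Type*} {T : ι → M.X →L[ℂ] M.X} {P : M.X →L[ℂ] M.X} {C : ℝ}
    (hC : ∀ (s : Finset ι) x, ‖∑ i ∈ s, T i x‖ ≤ C * ‖x‖)
    (hgen : ∀ μ ν, HasSum (fun i => T i (M.toX (gen μ ν : core G)))
      (P (M.toX (gen μ ν : core G)))) (x : M.X) : HasSum (fun i => T i x) (P x) := by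
  refine X.gen_induction (isClosed_hasSum hC) hgen ?_ ?_ ?_ x
  · simp only [map_zero]; exact hasSum_zero
  · intro a b ha hb; simp only [map_add]; exact ha.add hb
  · intro c a ha; simp only [map_smul]; exact ha.const_smul c

theorem hasSum_specProj (x : M.X) : HasSum (fun m => M.specProj m x) x := by
  refine X.hasSum_of_gen (P := .id ℂ M.X) (C := 1) ?_ ?_ x
  · simpa using M.norm_sum_specProj_le
  · intro μ ν
    simp only [specProj_toX, component_gen]
    convert hasSum_ite_eq (M.len μ - M.len ν : ℤ) (M.toX (gen μ ν : core G)) using 2 with m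
    by_cases h : (M.len μ - M.len ν : ℤ) = m
    · rw [if_pos h, if_pos h.symm]
    · rw [if_neg h, if_neg (Ne.symm h)]; exact M.toX_zero
    · rfl

theorem specProj_specProj (m n : ℤ) (x : M.X) :
    M.specProj m (M.specProj n x) = if m = n then M.specProj m x else 0 := by
  refine X.ext_toX (f' := fun x => if m = n then M.specProj m x else 0)
    ((M.specProj m).continuous.comp (M.specProj n).continuous) ?_ ?_ x
  · split_ifs <;> fun_prop
  · intro a
    simp only [Function.comp_apply, specProj_toX, component_component]
    split_ifs
    · rfl
    · exact M.toX_zero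

theorem ip_specProj (m : ℤ) (x y : M.X) : M.ip (M.specProj m x) y = M.ip x (M.specProj m y) := by
  refine X.toX_induction₂ (P := fun x y => M.ip (M.specProj m x) y = M.ip x (M.specProj m y))
    ?_ ?_ x y
  · exact isClosed_eq
      (continuous_ip_comp ((M.specProj m).continuous.comp continuous_fst) continuous_snd)
      (continuous_ip_comp continuous_fst ((M.specProj m).continuous.comp continuous_snd))
  · intro a b
    rw [specProj_toX, specProj_toX, ip_toX, ip_toX, expect_star_component_mul]

theorem isClosed_graphD : IsClosed (M.graphD : Set (M.X × M.X)) :=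
  Submodule.isClosed_topologicalClosure _

theorem gen_mem_graphD (μ ν : G.Path) : (M.toX (gen μ ν : core G),
    ((M.len μ : ℂ) - M.len ν) • M.toX (gen μ ν : core G)) ∈ M.graphD :=
  Submodule.le_topologicalClosure _ (Submodule.subset_span ⟨μ, ν, rfl⟩)

theorem specProj_mem_graphD (m : ℤ) (x : M.X) :
    (M.specProj m x, (m : ℂ) • M.specProj m x) ∈ M.graphD := by
  refine X.gen_induction (P := fun x => (M.specProj m x, (m : ℂ) • M.specProj m x) ∈ M.graphD)
    ?_ ?_ ?_ ?_ ?_ x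
  · have h : Continuous fun x => (M.specProj m x, (m : ℂ) • M.specProj m x) :=
      (M.specProj m).continuous.prodMk ((M.specProj m).continuous.const_smul (m : ℂ))
    exact M.isClosed_graphD.preimage h
  · intro μ ν
    rw [specProj_toX, component_gen]
    split_ifs with h
    · rw [← h, Int.cast_sub, Int.cast_natCast, Int.cast_natCast]
      exact M.gen_mem_graphD μ ν
    · rw [toX_zero, smul_zero]; exact zero_mem M.graphD
  · rw [map_zero, smul_zero]; exact zero_mem M.graphD
  · intro a b ha hb
    rw [map_add, smul_add]; exact M.graphD.add_mem ha hb
  · intro c a ha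
    rw [map_smul, smul_comm]; exact M.graphD.smul_mem c ha

/-- The right side defines a closed subspace that contains the generators of the graph. Conversely
`(x, y)` is the limit of the finite sums of the pairs `(Φ_m x, m Φ_m x)`, which lie in the closed
graph. -/
theorem mem_graphD_iff (x y : M.X) :
    (x, y) ∈ M.graphD ↔ ∀ m : ℤ, M.specProj m y = (m : ℂ) • M.specProj m x := by
  constructor
  · intro h m
    let K : Submodule ℂ (M.X × M.X) := LinearMap.eqLocus
      ((M.specProj m).toLinearMap ∘ₗ LinearMap.snd ℂ M.X M.X)
      ((m : ℂ) • ((M.specProj m).toLinearMap ∘ₗ LinearMap.fst ℂ M.X M.X))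
    have hK : IsClosed (K : Set (M.X × M.X)) := by
      have h1 : Continuous fun p : M.X × M.X => M.specProj m p.2 :=
        (M.specProj m).continuous.comp continuous_snd
      have h2 : Continuous fun p : M.X × M.X => (m : ℂ) • M.specProj m p.1 :=
        ((M.specProj m).continuous.comp continuous_fst).const_smul (m : ℂ)
      exact isClosed_eq h1 h2
    refine Submodule.topologicalClosure_minimal _ (Submodule.span_le.2 ?_) hK h
    rintro _ ⟨μ, ν, rfl⟩
    change M.specProj m (((M.len μ : ℂ) - M.len ν) • M.toX (gen μ ν : core G)) =
      (m : ℂ) • M.specProj m (M.toX (gen μ ν : core G))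
    rw [map_smul, specProj_toX, component_gen]
    split_ifs with h
    · rw [← h, Int.cast_sub, Int.cast_natCast, Int.cast_natCast]
    · rw [toX_zero, smul_zero, smul_zero]
  · intro h
    have h1 := (M.hasSum_specProj x).prodMk (M.hasSum_specProj y)
    refine M.isClosed_graphD.mem_of_tendsto h1
      (Filter.Eventually.of_forall fun s => M.graphD.sum_mem fun m _ => ?_)
    rw [h]
    exact M.specProj_mem_graphD m x

theorem isSpectralResolution_specProj : M.IsSpectralResolution fun m => M.specProj m where
  adjoint := M.ip_specProj
  mul := M.specProj_specProj
  hasSum := M.hasSum_specProj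
  graph := M.mem_graphD_iff

end Sub

/-! ### Paths -/

theorem walkEnd_append (v : V) (l l' : List Edge) :
    G.walkEnd v (l ++ l') = G.walkEnd (G.walkEnd v l) l' := by
  induction l generalizing v with
  | nil => rfl
  | cons e l ih => exact ih (G.r e)

theorem isWalk_append_iff (v : V) (l l' : List Edge) :
    G.IsWalk v (l ++ l') ↔ G.IsWalk v l ∧ G.IsWalk (G.walkEnd v l) l' := by
  induction l generalizing v with
  | nil => exact (and_iff_right trivial).symm
  | cons e l ih => exact (and_congr_right fun _ => ih (G.r e)).trans and_assoc.symm

theorem finite_walks_from (n : ℕ) (v : V) :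
    {l : List Edge | G.IsWalk v l ∧ l.length = n}.Finite := by
  induction n generalizing v with
  | zero =>
    refine (Set.finite_singleton []).subset fun l hl => List.length_eq_zero_iff.1 hl.2
  | succ n ih =>
    refine ((G.finite_out v).biUnion fun e _ => (ih (G.r e)).image (List.cons e)).subset ?_
    rintro (_ | ⟨e, l⟩) ⟨h, hl⟩
    · simp at hl
    · exact Set.mem_biUnion (show e ∈ {e | G.s e = v} from h.1)
        ⟨l, ⟨h.2, by simpa using hl⟩, rfl⟩

/-- Induction on the last edge, for which `v` has only finitely many choices. -/
theorem finite_walks_to (n : ℕ) (v : V) : {q : V × List Edge |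
    G.IsWalk q.1 q.2 ∧ G.walkEnd q.1 q.2 = v ∧ q.2.length = n}.Finite := by
  induction n generalizing v with
  | zero =>
    refine (Set.finite_singleton (v, [])).subset ?_
    rintro ⟨w, l⟩ ⟨-, h, hl⟩
    obtain rfl : l = [] := List.length_eq_zero_iff.1 hl
    exact Prod.ext h rfl
  | succ n ih =>
    refine ((G.finite_in v).biUnion fun e _ => (ih (G.s e)).image
      fun q => (q.1, q.2 ++ [e])).subset ?_
    rintro ⟨w, l⟩ ⟨hw, h, hl⟩
    rcases List.eq_nil_or_concat l with rfl | ⟨l, e, rfl⟩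
    · simp at hl
    · rw [List.concat_eq_append] at *
      simp only [isWalk_append_iff, walkEnd_append] at hw h
      exact Set.mem_biUnion (show e ∈ {e | G.r e = v} from h)
        ⟨(w, l), ⟨hw.1, hw.2.1.symm, by simpa using hl⟩, rfl⟩

theorem Path.toProd_injective : Function.Injective fun μ : G.Path => (μ.src, μ.edges) :=
  fun _ _ h => Path.ext (congrArg Prod.fst h) (congrArg Prod.snd h)

/-! ### Paths and exterior trees: counting edges in `M` -/

namespace Sub

variable {M : G.Sub}

/-- An edge outside `M` ends outside `M`. Working backwards from the end vertex, the tail of the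
walk starts in `M`, so the edge before it must belong to `M`. -/
theorem mem_edges_of_walkEnd_mem (hT : HasExteriorTrees M) {l : List Edge} : ∀ {v : V},
    G.IsWalk v l → G.walkEnd v l ∈ M.verts → v ∈ M.verts ∧ ∀ e ∈ l, e ∈ M.edges := by
  induction l with
  | nil => exact fun _ h => ⟨h, by simp⟩
  | cons e l ih =>
    intro v hl h
    obtain ⟨h1, h2⟩ := ih hl.2 h
    have he : e ∈ M.edges := by
      by_contra he
      exact hT.rng_notMem e he h1
    refine ⟨hl.1 ▸ M.src_mem e he, ?_⟩
    simpa using ⟨he, h2⟩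

open Classical in
theorem len_eq_length {μ : G.Path} (h : ∀ e ∈ μ.edges, e ∈ M.edges) :
    M.len μ = μ.edges.length :=
  List.countP_eq_length.2 fun e he => decide_eq_true (h e he)

/-- Between vertices of `M`, equal `|·|_σ` means equal length; this is what makes the range
projections in the first formula orthogonal. -/
theorem length_eq_len (hT : HasExteriorTrees M) {μ : G.Path} (h : μ.rng ∈ M.verts) :
    μ.edges.length = M.len μ :=
  (len_eq_length (mem_edges_of_walkEnd_mem hT μ.isWalk h).2).symm

open Classical in
-- Edges of `M` start in `M`, and the other edges end outside `M`, so a walk that is outside `M`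
-- never meets an edge of `M` again.
theorem countP_eq_zero_of_notMem (hT : HasExteriorTrees M) {l : List Edge} : ∀ {v : V},
    G.IsWalk v l → v ∉ M.verts → l.countP (fun e => decide (e ∈ M.edges)) = 0 := by
  induction l with
  | nil => intros; rfl
  | cons e l ih =>
    intro v hl hv
    have he : e ∉ M.edges := fun he => hv (hl.1 ▸ M.src_mem e he)
    rw [List.countP_cons, ih hl.2 (hT.rng_notMem e he)]
    simp [he]

open Classical in
/-- A walk with at least `m` edges in `M` begins with `m` edges of `M`. -/
theorem exists_prefix (hT : HasExteriorTrees M) {l : List Edge} : ∀ {v : V} {m : ℕ},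
    G.IsWalk v l → m ≤ l.countP (fun e => decide (e ∈ M.edges)) →
    ∃ l₁ l₂, l = l₁ ++ l₂ ∧ l₁.length = m ∧ ∀ e ∈ l₁, e ∈ M.edges := by
  induction l with
  | nil =>
    intro v m _ hm
    exact ⟨[], [], rfl, (Nat.le_zero.1 hm).symm, by simp⟩
  | cons e l ih =>
    intro v m hl hm
    rcases m with _ | m
    · exact ⟨[], e :: l, rfl, rfl, by simp⟩
    -- If the first edge were not in `M`, the walk would be outside `M` from then on and no edge
    -- would be counted, although at least `m + 1` are.
    have he : e ∈ M.edges := by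
      by_contra he
      rw [List.countP_cons, countP_eq_zero_of_notMem hT hl.2 (hT.rng_notMem e he)] at hm
      simp [he] at hm
    rw [List.countP_cons] at hm
    obtain ⟨l₁, l₂, h, h1, h2⟩ := ih (m := m) hl.2 (by simpa [he] using hm)
    exact ⟨e :: l₁, l₂, by rw [h]; rfl, by simp [h1], by simpa using ⟨he, h2⟩⟩

theorem walkEnd_mem {l : List Edge} : ∀ {v : V}, v ∈ M.verts →
    (∀ e ∈ l, e ∈ M.edges) → G.walkEnd v l ∈ M.verts := by
  induction l with
  | nil => exact fun h _ => h
  | cons e l ih =>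
    exact fun _ h => ih (M.rng_mem e (h e (by simp))) fun f hf => h f (by simp [hf])

/-- The initial segment with `m` edges, of a path with at least `m > 0` edges in `M`. -/
theorem exists_initial (hT : HasExteriorTrees M) {α : G.Path} {m : ℕ} (hm : 0 < m)
    (h : m ≤ M.len α) : ∃ μ ν : G.Path, M.len μ = m ∧ μ.edges.length = m ∧ μ.src ∈ M.verts ∧
      μ.rng ∈ M.verts ∧ μ.src = α.src ∧ ν.src = μ.rng ∧ α.edges = μ.edges ++ ν.edges := by
  obtain ⟨l₁, l₂, h1, h2, h3⟩ := exists_prefix hT α.isWalk h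
  have hw := α.isWalk
  rw [h1, isWalk_append_iff] at hw
  -- Here `0 < m` matters: there is a first edge, it lies in `M`, and so does its source.
  have hsrc : α.src ∈ M.verts := by
    match l₁, h2, hw.1 with
    | [], h2, _ => simp at h2; lia
    | e :: l, _, hw => exact hw.1 ▸ M.src_mem e (h3 e (by simp))
  refine ⟨⟨α.src, l₁, hw.1⟩, ⟨_, l₂, hw.2⟩, ?_, h2, hsrc, walkEnd_mem hsrc h3, rfl, rfl, h1⟩
  rw [len_eq_length h3, h2]

open Classical in
-- At a vertex of `M` all incoming paths stay in `M`, so they are counted by length: finitely many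
-- by local finiteness, and at least one because `M` has no sources. Outside `M`, induct along a
-- path from `M` to `v`: the only incoming edge is not in `M`, so adding it leaves `|·|_σ`
-- unchanged.
theorem finite_and_exists_walk_to (hM : IsZhyvot M) (hT : HasExteriorTrees M) (v : V) (m : ℕ) :
    {q : V × List Edge | G.IsWalk q.1 q.2 ∧ G.walkEnd q.1 q.2 = v ∧
      q.2.countP (fun e => decide (e ∈ M.edges)) = m}.Finite ∧
    ∃ q : V × List Edge, G.IsWalk q.1 q.2 ∧ G.walkEnd q.1 q.2 = v ∧
      q.2.countP (fun e => decide (e ∈ M.edges)) = m := by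
  have hin : ∀ v ∈ M.verts, {q : V × List Edge | G.IsWalk q.1 q.2 ∧ G.walkEnd q.1 q.2 = v ∧
      q.2.countP (fun e => decide (e ∈ M.edges)) = m}.Finite ∧
    ∃ q : V × List Edge, G.IsWalk q.1 q.2 ∧ G.walkEnd q.1 q.2 = v ∧
      q.2.countP (fun e => decide (e ∈ M.edges)) = m := by
    intro v hv
    constructor
    · refine (finite_walks_to (G := G) m v).subset ?_
      rintro ⟨w, l⟩ ⟨hw, h, hl⟩
      refine ⟨hw, h, ?_⟩
      have := length_eq_len hT (μ := ⟨w, l, hw⟩) (show G.walkEnd w l ∈ M.verts from h ▸ hv)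
      exact this.trans hl
    · induction m generalizing v with
      | zero => exact ⟨(v, []), trivial, rfl, rfl⟩
      | succ m ih =>
        obtain ⟨e, he, rfl⟩ := hM.noSource v hv
        obtain ⟨⟨w, l⟩, hw, h, hl⟩ := ih (G.s e) (M.src_mem e he)
        refine ⟨(w, l ++ [e]), (isWalk_append_iff _ _ _).2 ⟨hw, h.symm, trivial⟩, ?_, ?_⟩
        · exact walkEnd_append _ _ _
        · simp only at hl
          simp [hl, he]
  obtain ⟨⟨v₀, l, hl⟩, h0, rfl⟩ := hM.reach v
  change v₀ ∈ M.verts at h0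
  simp only [Path.rng]
  induction l using List.reverseRecOn with
  | nil => exact hin _ h0
  | append_singleton l e ih =>
    by_cases hv : G.walkEnd v₀ (l ++ [e]) ∈ M.verts
    · exact hin _ hv
    have hl' := (isWalk_append_iff _ _ _).1 hl
    have hend : G.walkEnd v₀ (l ++ [e]) = G.r e := walkEnd_append _ _ _
    rw [hend] at hv ⊢
    obtain ⟨hfin, q, hq, hq2, hq3⟩ := ih hl'.1
    rw [← hl'.2.1] at hfin hq2
    have he : e ∉ M.edges := fun he => hv (M.rng_mem e he)
    constructor
    · refine ((Set.finite_singleton (G.r e, [])).union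
        (hfin.image fun q => (q.1, q.2 ++ [e]))).subset ?_
      rintro ⟨w, k⟩ ⟨hw, h, hk⟩
      rcases List.eq_nil_or_concat k with rfl | ⟨k, f, rfl⟩
      · exact Or.inl (Prod.ext h rfl)
      · rw [List.concat_eq_append] at *
        simp only [isWalk_append_iff, walkEnd_append, List.countP_append] at hw h hk
        obtain rfl : f = e := (hT.unique_in _ hv).unique h rfl
        exact Or.inr ⟨(w, k), ⟨hw.1, hw.2.1.symm, by simpa [he] using hk⟩, rfl⟩
    · refine ⟨(q.1, q.2 ++ [e]), (isWalk_append_iff _ _ _).2 ⟨hq, hq2.symm, trivial⟩,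
        walkEnd_append _ _ _, ?_⟩
      simp [hq3, he]

/-- The finite nonempty set of the paths to `v` with `m` edges in `M`. -/
theorem exists_pathsTo (hM : IsZhyvot M) (hT : HasExteriorTrees M) (m : ℕ) (v : V) :
    ∃ P : Finset G.Path, (∀ μ, μ ∈ P ↔ M.len μ = m ∧ μ.rng = v) ∧ 0 < P.card := by
  classical
  obtain ⟨hfin, ⟨w, l⟩, hq, hq2, hq3⟩ := finite_and_exists_walk_to hM hT v m
  have hfin' := hfin.preimage (Path.toProd_injective (G := G)).injOn
  have h : ∀ μ, μ ∈ hfin'.toFinset ↔ M.len μ = m ∧ μ.rng = v := fun μ => by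
    rw [Set.Finite.mem_toFinset]
    exact ⟨fun h => ⟨h.2.2, h.2.1⟩, fun h => ⟨μ.isWalk, h.2, h.1⟩⟩
  exact ⟨_, h, Finset.card_pos.2 ⟨⟨w, l, hq⟩, (h _).2 ⟨hq3, hq2⟩⟩⟩

end Sub

/-! ### Range projections of paths -/

namespace CKFamily

variable {B : Type*} [NonUnitalCStarAlgebra B] (T : CKFamily G B)

theorem star_path_mul_path_self (μ : G.Path) : star (T.path μ) * T.path μ = T.p μ.rng := by
  obtain ⟨v, l, hl⟩ := μ
  change star (T.walk v l) * T.walk v l = T.p (G.walkEnd v l)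
  induction l generalizing v with
  | nil => exact (congrArg (· * _) (T.star_p v)).trans (T.p_mul_p v)
  | cons e l ih =>
    rw [walk, StarMul.star_mul, mul_assoc, ← mul_assoc (star (T.S e)), T.star_mul,
      T.p_mul_walk hl.2]
    exact ih _ hl.2

/-- The product cancels edge by edge until the paths differ, and there it vanishes. Equal length
excludes that one path is a proper initial segment of the other. -/
theorem star_path_mul_path_of_ne {μ ν : G.Path} (hl : μ.edges.length = ν.edges.length)
    (h : μ ≠ ν) : star (T.path μ) * T.path ν = 0 := by
  obtain ⟨v, l, hv⟩ := μ
  obtain ⟨w, k, hw⟩ := ν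
  change l.length = k.length at hl
  change star (T.walk v l) * T.walk w k = 0
  induction l generalizing v w k with
  | nil =>
    obtain rfl := List.length_eq_zero_iff.1 hl.symm
    change star (T.p v) * T.p w = 0
    rw [T.star_p, T.orth]
    rintro rfl
    exact h rfl
  | cons e l ih =>
    match k, hw, hl with
    | f :: k, hw, hl =>
      rw [walk, walk, StarMul.star_mul, mul_assoc, ← mul_assoc (star (T.S e))]
      by_cases hef : e = f
      · subst hef
        rw [T.star_mul, T.p_mul_walk hw.2]
        refine ih _ hv.2 _ k hw.2 (fun h' => h ?_) (by simpa using hl)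
        have := congrArg Path.edges h'
        exact Path.ext (hv.1.symm.trans hw.1) (congrArg (List.cons e) this)
      · rw [T.star_S_mul_S hef, zero_mul, mul_zero]

theorem path_mul_p (μ : G.Path) : T.path μ * T.p μ.rng = T.path μ := T.walk_mul_p

theorem p_mul_path (μ : G.Path) : T.p μ.src * T.path μ = T.path μ := T.p_mul_walk μ.isWalk

theorem p_mul_path_of_ne {v : V} {μ : G.Path} (h : v ≠ μ.src) : T.p v * T.path μ = 0 :=
  T.p_mul_walk_of_ne h μ.isWalk

/-- The range projection `S_μ S_μ⋆`. -/
def rangeProj (μ : G.Path) : B := T.path μ * star (T.path μ)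

theorem rangeProj_mul_path (μ : G.Path) : T.rangeProj μ * T.path μ = T.path μ := by
  rw [rangeProj, mul_assoc, star_path_mul_path_self, path_mul_p]

theorem isStarProjection_rangeProj (μ : G.Path) : IsStarProjection (T.rangeProj μ) :=
  ⟨by
    change T.rangeProj μ * T.rangeProj μ = T.rangeProj μ
    nth_rw 2 [rangeProj]
    rw [← mul_assoc, rangeProj_mul_path]; rfl, IsSelfAdjoint.mul_star_self _⟩

theorem rangeProj_mul_rangeProj {μ ν : G.Path} (hl : μ.edges.length = ν.edges.length)
    (h : μ ≠ ν) : T.rangeProj μ * T.rangeProj ν = 0 := by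
  rw [rangeProj, rangeProj, mul_assoc, ← mul_assoc (star (T.path μ)),
    T.star_path_mul_path_of_ne hl h, zero_mul, mul_zero]

theorem path_eq_mul {α μ ν : G.Path} (h1 : μ.src = α.src) (h2 : ν.src = μ.rng)
    (h3 : α.edges = μ.edges ++ ν.edges) : T.path α = T.path μ * T.path ν := by
  have hν := ν.isWalk
  rw [h2] at hν
  have := T.walk_append μ.isWalk hν
  rw [← h3, h1] at this
  rw [path, this, path, path, h2, Path.rng, h1]

end CKFamily

/-! ### The formulas for the spectral projections -/

/-- The element `S_μ` of `A_c`. -/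
def corePath (μ : G.Path) : core G :=
  ⟨(univFamily G).path μ, by
    have h : (univFamily G).path μ = (gen μ ⟨μ.rng, [], trivial⟩ : core G) := by
      change (univFamily G).path μ = (univFamily G).path μ * star ((univFamily G).p μ.rng)
      rw [(univFamily G).star_p, (univFamily G).path_mul_p]
    rw [h]; exact Subtype.property _⟩

namespace Sub

variable (M : G.Sub)

/-- `S_μ⋆` has degree `-|μ|_σ`, so the degree zero part of `S_μ⋆ a` is `S_μ⋆` times the part of `a`
of degree `|μ|_σ`. -/
theorem path_mul_expect (μ : G.Path) (a : CStar G) :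
    (univFamily G).path μ * M.expect (star ((univFamily G).path μ) * a) =
      (univFamily G).rangeProj μ * M.component (M.len μ) a := by
  rw [expect_eq_component, (isHomogeneous_path μ).adjoint.component_mul, ← mul_assoc]
  congr 2
  lia

theorem p_mul_expect (v : V) (a : CStar G) :
    (univFamily G).p v * M.expect (star ((univFamily G).p v) * a) =
      (univFamily G).p v * M.component 0 a := by
  rw [expect_eq_component, (isHomogeneous_p v).adjoint.component_mul, ← mul_assoc,
    (univFamily G).star_p, (univFamily G).p_mul_p]
  rfl

/-- Here the projection in front is `S_μ⋆ S_μ`, which depends on `μ` only through its range. This is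
the origin of the factor `1 / |v|_m` in the third formula. -/
theorem star_path_mul_expect (μ : G.Path) (a : CStar G) :
    star ((univFamily G).path μ) * M.expect (star (star ((univFamily G).path μ)) * a) =
      (univFamily G).p μ.rng * M.component (-M.len μ) a := by
  rw [expect_eq_component, star_star, (isHomogeneous_path μ).component_mul, ← mul_assoc,
    (univFamily G).star_path_mul_path_self, zero_sub]

theorem theta_path (μ : G.Path) (x : M.X) :
    M.theta (M.toX ((univFamily G).path μ)) (M.toX ((univFamily G).path μ)) x =
      M.lmul ((univFamily G).rangeProj μ) (M.specProj (M.len μ) x) := by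
  refine X.ext_toX (M.continuous_theta _ _)
    ((M.continuous_lmul _).comp (M.specProj _).continuous) (fun a => ?_) x
  rw [theta_toX, path_mul_expect, Function.comp_apply, specProj_toX, lmul_toX]

theorem theta_p (v : V) (x : M.X) :
    M.theta (M.toX ((univFamily G).p v)) (M.toX ((univFamily G).p v)) x =
      M.lmul ((univFamily G).p v) (M.specProj 0 x) := by
  refine X.ext_toX (M.continuous_theta _ _)
    ((M.continuous_lmul _).comp (M.specProj _).continuous) (fun a => ?_) x
  rw [theta_toX, p_mul_expect, Function.comp_apply, specProj_toX, lmul_toX]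

theorem theta_star_path (μ : G.Path) (x : M.X) :
    M.theta (M.toX (star ((univFamily G).path μ))) (M.toX (star ((univFamily G).path μ))) x =
      M.lmul ((univFamily G).p μ.rng) (M.specProj (-M.len μ) x) := by
  refine X.ext_toX (M.continuous_theta _ _)
    ((M.continuous_lmul _).comp (M.specProj _).continuous) (fun a => ?_) x
  rw [theta_toX, star_path_mul_expect, Function.comp_apply, specProj_toX, lmul_toX]

/-- The convergence argument shared by the first two formulas. Finite sums of the orthogonal `Q i`
are projections, so the partial sums are contractions; on `S_α S_β⋆` of degree `m` only the `Q i`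
that fixes `S_α` contributes. -/
theorem hasSum_lmul_specProj {ι : Type*} (m : ℤ) (Q : ι → CStar G)
    (hQ : ∀ i, IsStarProjection (Q i)) (horth : ∀ i j, i ≠ j → Q i * Q j = 0)
    (hgen : ∀ α β : G.Path, (M.len α - M.len β : ℤ) = m →
      ∃ i, Q i * (univFamily G).path α = (univFamily G).path α) (x : M.X) :
    HasSum (fun i => M.lmul (Q i) (M.specProj m x)) (M.specProj m x) := by
  classical
  refine X.hasSum_of_gen (T := fun i => (M.lmulL (Q i)).comp (M.specProj m)) (C := 1) ?_ ?_ x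
  · intro s x
    have hs : IsStarProjection (∑ i ∈ s, Q i) := by
      refine ⟨?_, ?_⟩
      · rw [IsIdempotentElem, Finset.sum_mul_sum]
        refine Finset.sum_congr rfl fun i hi => ?_
        rw [Finset.sum_eq_single i (fun j _ hj => horth i j (Ne.symm hj)) fun h => absurd hi h]
        exact (hQ i).isIdempotentElem
      · rw [IsSelfAdjoint, star_sum]
        exact Finset.sum_congr rfl fun i _ => (hQ i).isSelfAdjoint
    change ‖∑ i ∈ s, M.lmul (Q i) (M.specProj m x)‖ ≤ 1 * ‖x‖
    rw [← lmul_sum]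
    exact (M.norm_lmul_le _ _).trans (mul_le_mul hs.norm_le (M.norm_specProj_le m x)
      (norm_nonneg _) zero_le_one)
  · intro α β
    change HasSum (fun i => M.lmul (Q i) (M.specProj m _)) (M.specProj m _)
    rw [specProj_toX, component_gen]
    simp only [lmul_toX]
    split_ifs with h
    · obtain ⟨i, hi⟩ := hgen α β h
      have h1 : Q i * (gen α β : core G) = (gen α β : core G) := by
        change Q i * ((univFamily G).path α * star ((univFamily G).path β)) = _
        rw [← mul_assoc, hi]; rfl
      have h2 := hasSum_single (f := fun i => M.toX (Q i * (gen α β : core G))) i fun j hj => by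
        rw [← h1, ← mul_assoc, horth j i hj, zero_mul, toX_zero]
      simpa only [h1] using h2
    · simp only [mul_zero, toX_zero]
      exact hasSum_zero

variable {M}

/-- Each summand is a range projection times `Φ_m`. If `S_α S_β⋆` has degree `m`, then `|α|_σ = m +
|β|_σ ≥ m`, so the first `m` edges of `α` form one of the paths `μ`, and `S_μ S_μ⋆ S_α = S_α`. -/
theorem hasSum_theta_path (hT : HasExteriorTrees M) {m : ℕ} (hm : 0 < m) (x : M.X) : HasSum
    (fun μ : {μ : G.Path // M.len μ = m ∧ μ.src ∈ M.verts ∧ μ.rng ∈ M.verts} =>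
      M.theta (M.toX ((univFamily G).path μ.1)) (M.toX ((univFamily G).path μ.1)) x)
    (M.specProj m x) := by
  have h : ∀ μ : {μ : G.Path // M.len μ = m ∧ μ.src ∈ M.verts ∧ μ.rng ∈ M.verts},
      M.theta (M.toX ((univFamily G).path μ.1)) (M.toX ((univFamily G).path μ.1)) x =
      M.lmul ((univFamily G).rangeProj μ.1) (M.specProj m x) := fun μ => by
    rw [theta_path, μ.2.1]
  simp only [h]
  refine M.hasSum_lmul_specProj m (fun μ : {μ : G.Path // M.len μ = m ∧ μ.src ∈ M.verts ∧
    μ.rng ∈ M.verts} => (univFamily G).rangeProj μ.1)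
    (fun μ => (univFamily G).isStarProjection_rangeProj _) ?_ ?_ x
  · intro μ ν hμν
    refine (univFamily G).rangeProj_mul_rangeProj ?_ fun h => hμν (Subtype.ext h)
    rw [length_eq_len hT μ.2.2.2, length_eq_len hT ν.2.2.2, μ.2.1, ν.2.1]
  · intro α β hαβ
    obtain ⟨μ, ν, h1, -, h2, h3, h4, h5, h6⟩ := exists_initial hT (α := α) hm (by lia)
    refine ⟨⟨μ, h1, h2, h3⟩, ?_⟩
    rw [(univFamily G).path_eq_mul h4 h5 h6, ← mul_assoc, (univFamily G).rangeProj_mul_path]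

variable (M) in
theorem hasSum_theta_p (x : M.X) : HasSum (fun v : V => M.theta (M.toX ((univFamily G).p v))
    (M.toX ((univFamily G).p v)) x) (M.specProj 0 x) := by
  simp only [theta_p]
  exact M.hasSum_lmul_specProj 0 (univFamily G).p (univFamily G).isProj (univFamily G).orth
    (fun α β _ => ⟨α.src, (univFamily G).p_mul_path α⟩) x

/-! ### Finite rank of the truncated spectral projections -/

/-- `p_v Φ_m` is, on `C⋆(G)`, a finite sum of operators `Θ_{x,x}` with `x ∈ A_c`. -/
theorem exists_p_mul_component (hM : IsZhyvot M) (hT : HasExteriorTrees M) (m : ℤ) (v : V) :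
    ∃ (n : ℕ) (x : Fin n → core G), ∀ a, (univFamily G).p v * M.component m a =
      ∑ i, (x i : CStar G) * M.expect (star (x i : CStar G) * a) := by
  have hfin : ∀ (s : Finset G.Path) (f : G.Path → core G), (∀ a, (univFamily G).p v *
      M.component m a = ∑ μ ∈ s, (f μ : CStar G) * M.expect (star (f μ : CStar G) * a)) →
      ∃ (n : ℕ) (x : Fin n → core G), ∀ a, (univFamily G).p v * M.component m a =
        ∑ i, (x i : CStar G) * M.expect (star (x i : CStar G) * a) := by
    intro s f h
    refine ⟨s.card, fun i => f (s.equivFin.symm i), fun a => ?_⟩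
    rw [h, ← Finset.sum_coe_sort, ← s.equivFin.symm.sum_comp]
  rcases lt_trichotomy m 0 with hm | rfl | hm
  · obtain ⟨P, hP, hcard⟩ := exists_pathsTo hM hT m.natAbs v
    have hm' : m = -(m.natAbs : ℤ) := by lia
    have hcard' : (P.card : ℂ) ≠ 0 := by exact_mod_cast hcard.ne'
    -- The same vector stands in both slots of `Θ_{x,x}`, so each copy of `S_μ⋆` carries the square
    -- root of the weight `1 / |v|_m`.
    set c : ℂ := (((√(P.card : ℝ))⁻¹ : ℝ) : ℂ) with hc
    have hc2 : c * star c = (P.card : ℂ)⁻¹ := by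
      rw [hc, Complex.star_def, Complex.conj_ofReal, ← Complex.ofReal_mul, ← mul_inv,
        Real.mul_self_sqrt (Nat.cast_nonneg _)]
      push_cast; rfl
    refine hfin P (fun μ => c • star (corePath μ)) fun a => ?_
    have h1 : ∀ μ ∈ P, (c • star ((univFamily G).path μ)) *
        M.expect (star (c • star ((univFamily G).path μ)) * a) =
        (P.card : ℂ)⁻¹ • ((univFamily G).p v * M.component m a) := by
      intro μ hμ
      rw [star_smul, smul_mul_assoc (star c), expect_smul, smul_mul_smul_comm, hc2,
        star_path_mul_expect,
        ((hP μ).1 hμ).1, ((hP μ).1 hμ).2, ← hm']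
    symm
    refine (Finset.sum_congr rfl h1).trans ?_
    rw [Finset.sum_const, ← Nat.cast_smul_eq_nsmul ℂ, smul_smul, mul_inv_cancel₀ hcard', one_smul]
  · refine ⟨1, fun _ => corePath ⟨v, [], trivial⟩, fun a => ?_⟩
    rw [Fin.sum_univ_one]
    exact (M.p_mul_expect v a).symm
  · obtain ⟨m, rfl⟩ : ∃ k : ℕ, m = k := ⟨m.toNat, by lia⟩
    have hm' : 0 < m := by lia
    -- The paths which start at `v` and consist of exactly `m` edges, all of them in `M`; finitely
    -- many, since every vertex emits finitely many edges.
    have hf : {μ : G.Path | (μ.src = v ∧ μ.edges.length = m) ∧ M.len μ = m}.Finite := by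
      refine Set.Finite.subset (((Set.finite_singleton v).prod (finite_walks_from (G := G) m v)).preimage
        (Path.toProd_injective (G := G)).injOn) ?_
      rintro ⟨w, l, hl⟩ ⟨⟨h1, h2⟩, -⟩
      change w = v at h1
      subst h1
      exact ⟨rfl, hl, h2⟩
    refine hfin hf.toFinset corePath fun a => ?_
    have h1 : ∀ μ ∈ hf.toFinset, (univFamily G).path μ *
        M.expect (star ((univFamily G).path μ) * a) =
        (univFamily G).rangeProj μ * M.component m a := fun μ hμ => by
      rw [path_mul_expect, ((Set.Finite.mem_toFinset _).1 hμ).2]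
    refine Eq.trans ?_ (Finset.sum_congr rfl h1).symm
    rw [← Finset.sum_mul]
    refine DFunLike.congr_fun
      (f := (ContinuousLinearMap.mul ℂ (CStar G) ((univFamily G).p v)).comp (M.component m))
      (g := (ContinuousLinearMap.mul ℂ (CStar G)
        (∑ μ ∈ hf.toFinset, (univFamily G).rangeProj μ)).comp (M.component m)) ?_ a
    refine CStar.ext_gen fun α β => ?_
    change (univFamily G).p v * M.component m (gen α β : core G) =
      (∑ μ ∈ hf.toFinset, (univFamily G).rangeProj μ) * M.component m (gen α β : core G)
    rw [component_gen]
    split_ifs with hαβ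
    -- Split off the initial segment `μ` of `α` with `m` edges. If it starts at `v`, it is the only
    -- path of the sum whose range projection does not kill `S_μ`; if not, both sides vanish.
    · have key : (univFamily G).p v * (univFamily G).path α =
          (∑ μ ∈ hf.toFinset, (univFamily G).rangeProj μ) * (univFamily G).path α := by
        obtain ⟨μ, ν, h1, hl, h2, h3, h4, h5, h6⟩ := exists_initial hT (α := α) hm' (by lia)
        rw [(univFamily G).path_eq_mul h4 h5 h6, ← mul_assoc, ← mul_assoc]
        congr 1
        rw [Finset.sum_mul]
        have hne : ∀ κ ∈ hf.toFinset, κ ≠ μ →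
            (univFamily G).rangeProj κ * (univFamily G).path μ = 0 := fun κ hκ h => by
          rw [CKFamily.rangeProj, mul_assoc, (univFamily G).star_path_mul_path_of_ne
            (((Set.Finite.mem_toFinset _).1 hκ).1.2.trans hl.symm) h, mul_zero]
        by_cases hv : μ.src = v
        · have hμ : μ ∈ hf.toFinset := (Set.Finite.mem_toFinset _).2 ⟨⟨hv, hl⟩, h1⟩
          rw [Finset.sum_eq_single μ hne fun h => absurd hμ h, (univFamily G).rangeProj_mul_path, ← hv,
            (univFamily G).p_mul_path]
        · rw [(univFamily G).p_mul_path_of_ne (Ne.symm hv), Finset.sum_eq_zero]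
          refine fun κ hκ => hne κ hκ ?_
          rintro rfl
          exact hv ((Set.Finite.mem_toFinset _).1 hκ).1.1
      have hg : ((gen α β : core G) : CStar G) =
        (univFamily G).path α * star ((univFamily G).path β) := rfl
      rw [hg, ← mul_assoc, key, mul_assoc]
    · rw [mul_zero, mul_zero]

/-- `q Φ_m` has finite rank. -/
theorem exists_lmul_specProj_eq (hM : IsZhyvot M) (hT : HasExteriorTrees M) (m : ℤ) {v : V}
    {q : CStar G} (hq : q * (univFamily G).p v = q) :
    M.IsFiniteRank fun x => M.lmul q (M.specProj m x) := by
  obtain ⟨n, x, hx⟩ := exists_p_mul_component hM hT m v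
  -- Since `q = q p_v`, one has `q Φ_m = q ∑ Θ_{x_i,x_i} = ∑ Θ_{q x_i,x_i}`.
  refine ⟨n, fun i => M.toX (q * x i), fun i => M.toX (x i), X.ext_toX
    ((M.continuous_lmul q).comp (M.specProj m).continuous)
    (continuous_finsetSum _ fun i _ => M.continuous_theta _ _) fun a => ?_⟩
  rw [specProj_toX, lmul_toX, ← hq, mul_assoc, hx, Finset.mul_sum]
  simp only [theta_toX, hq, mul_assoc]
  exact map_sum M.toXL _ _

theorem isCompactEnd_of_isFiniteRank {m : ℤ} {q : CStar G}
    (hK : M.IsFiniteRank fun x => M.lmul q (M.specProj m x)) :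
    M.IsCompactEnd fun x => M.lmul q (M.specProj m x) :=
  ⟨⟨fun x => M.specProj m (M.lmul (star q) x), fun x y => by rw [ip_lmul, ip_specProj]⟩,
    fun ε hε => ⟨_, hK, fun x => by
      rw [sub_self, norm_zero]; positivity⟩⟩

end Sub

section GNS

variable [Countable V] [Countable Edge] {g : V → ℝ} {lam : Edge → ℝ}

/-! ### Positivity of the functional of a graph weight -/

/-- On `A_c`, the functional of a graph weight is the eventual value of a net of positive
functionals on `C⋆(G)`. -/
theorem exists_positive_approximation (h : IsGraphWeight G g lam) :
    ∃ ψ : Finset V × ℕ → CStar G →ₗ[ℂ] ℂ, (∀ F a, 0 ≤ ψ F (star a * a)) ∧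
      ∀ a : core G, ∀ᶠ F in Filter.atTop, ψ F a = phi h a := by
  classical
  obtain ⟨b, hb⟩ := exists_branching G
  obtain ⟨T, hp, hS⟩ := exists_family b hb
  let π : CStar G →⋆ₙₐ[ℂ] (lp (fun _ : Idx G => ℂ) 2 →L[ℂ] lp (fun _ : Idx G => ℂ) 2) :=
    evalAt ⟨_, T⟩
  have hwalk : ∀ (v : V) (l : List Edge), π ((univFamily G).walk v l) = T.walk v l := by
    intro v l
    induction l generalizing v with
    | nil => rfl
    | cons e l ih =>
      rw [CKFamily.walk, CKFamily.walk, map_mul, ih]; rfl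
  have hπ : ∀ μ ν : G.Path, π (gen μ ν : core G) = T.path μ * star (T.path ν) := by
    intro μ ν
    change π ((univFamily G).path μ * star ((univFamily G).path ν)) = _
    rw [map_mul, map_star, CKFamily.path, CKFamily.path, hwalk, hwalk]
    rfl
  -- The index is a finite set of vertices and a depth. The value at `S_μ S_ν⋆` is final as soon as
  -- the set contains `s(μ)` and the depth is at least the length of `μ`.
  let ψ : Finset V × ℕ → CStar G →ₗ[ℂ] ℂ := fun F =>
    { toFun := fun a => ∑ v ∈ F.1, approx T g lam F.2 v (π a)
      map_add' := fun a a' => by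
        simp only [map_add, approx_add, Finset.sum_add_distrib]
      map_smul' := fun c a => by
        simp only [map_smul, approx_smul, ← Finset.mul_sum]; rfl }
  refine ⟨ψ, fun F a => Finset.sum_nonneg fun v _ => ?_, fun a => ?_⟩
  · rw [map_mul, map_star]; exact approx_nonneg h _ _ _
  refine core_induction (P := fun a : core G => ∀ᶠ F in Filter.atTop, ψ F a = phi h a)
    ?_ ?_ ?_ ?_ a
  · intro μ ν
    refine (Filter.eventually_ge_atTop ({μ.src}, μ.edges.length)).mono fun F hF => ?_
    change ∑ v ∈ F.1, approx T g lam F.2 v (π (gen μ ν : core G)) = _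
    simp only [hπ]
    rw [phi_gen]
    by_cases hlen : μ.edges.length = ν.edges.length
    · simp only [CKFamily.path,
        approx_walk hp h F.2 _ _ _ _ _ μ.isWalk ν.isWalk hlen hF.2]
      by_cases hμν : μ = ν
      · subst hμν
        rw [if_pos rfl, Finset.sum_eq_single μ.src]
        · rw [if_pos ⟨rfl, rfl, rfl⟩]; rfl
        · exact fun v _ hv => if_neg fun h => hv h.1
        · exact fun h => absurd (hF.1 (Finset.mem_singleton_self _)) h
      · rw [if_neg hμν]
        refine Finset.sum_eq_zero fun v _ => if_neg ?_
        exact fun h => hμν (Path.ext (h.1.symm.trans h.2.1) h.2.2)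
    · rw [if_neg fun h => hlen (by rw [h])]
      -- Paths of different lengths give an operator that shifts the degree on `ℓ²` by a nonzero
      -- amount, so every approximation vanishes.
      refine Finset.sum_eq_zero fun v _ => ?_
      refine approx_raises b hS g lam (k := μ.edges.length + -ν.edges.length) (by lia) _ _ _ ?_
      exact (raises_walk b hp hS _ _).mul (raises_star_walk b hp hS _ _)
  · refine Filter.Eventually.of_forall fun F => ?_
    rw [ZeroMemClass.coe_zero, map_zero, map_zero]
  · intro a a' ha ha'
    filter_upwards [ha, ha'] with F h1 h2
    rw [AddMemClass.coe_add, map_add, map_add, h1, h2]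
  · intro c a ha
    filter_upwards [ha] with F h1
    rw [map_smul, ← h1]
    exact map_smul (ψ F) c (a : CStar G)

/-- A positive element of `A_c` is `b⋆ b` with `b` in `C⋆(G)`, but perhaps not in `A_c`, where
`phi_nonneg` would apply. Some positive functional of the approximating net is defined at `b⋆ b` and
agrees there with `φ`. -/
theorem phi_nonneg_of_nonneg (h : IsGraphWeight G g lam) {a : core G} (ha : 0 ≤ (a : CStar G)) :
    0 ≤ phi h a := by
  classical
  obtain ⟨ψ, hψ, hlim⟩ := exists_positive_approximation h
  have : Nonempty (Finset V × ℕ) := ⟨(∅, 0)⟩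
  obtain ⟨F, hF⟩ := (hlim a).exists
  obtain ⟨b, hb⟩ := CStarAlgebra.nonneg_iff_eq_star_mul_self.1 ha
  rw [← hF, hb]
  exact hψ F b

theorem phi_mono (h : IsGraphWeight G g lam) {a b : core G} (hab : (a : CStar G) ≤ b) :
    phi h a ≤ phi h b := by
  rw [← sub_nonneg, ← map_sub]
  exact phi_nonneg_of_nonneg h (sub_nonneg.2 hab)

/-! ### The representation on the GNS space -/

variable (h : IsGraphWeight G g lam)

theorem inner_toH (a b : core G) : inner ℂ (toH h a) (toH h b) = phi h (star a * b) :=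
  UniformSpace.Completion.inner_coe _ _

theorem norm_toH_sq (a : core G) : ((‖toH h a‖ ^ 2 : ℝ) : ℂ) = phi h (star a * a) := by
  rw [← inner_toH, inner_self_eq_norm_sq_to_K]
  push_cast; rfl

/-- As on `X`: `b⋆ a⋆ a b ≤ ‖a‖² b⋆ b`. The inequality holds in the order of `C⋆(G)`, which is why
`phi_mono` is needed. -/
theorem norm_toH_mul_le (a b : core G) : ‖toH h (a * b)‖ ≤ ‖(a : CStar G)‖ * ‖toH h b‖ := by
  have h1 : ((star (a * b) * (a * b) : core G) : CStar G) ≤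
      (((‖star (a : CStar G) * a‖ : ℝ) : ℂ) • (star b * b) : core G) := by
    have h2 := CStarAlgebra.star_left_conjugate_le_norm_smul (a := (b : CStar G))
      (b := star (a : CStar G) * a) (IsSelfAdjoint.star_mul_self _)
    have h3 : ((star (a * b) * (a * b) : core G) : CStar G) =
        star (b : CStar G) * (star (a : CStar G) * a) * b := by
      change star ((a : CStar G) * b) * (a * b) = _
      simp only [StarMul.star_mul, mul_assoc]
    rw [h3]
    refine h2.trans_eq ?_
    exact (Complex.coe_smul _ _).symm
  have h4 := phi_mono h h1
  rw [map_smul, ← norm_toH_sq, ← norm_toH_sq, CStarRing.norm_star_mul_self, smul_eq_mul,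
    ← Complex.ofReal_mul, Complex.real_le_real] at h4
  refine abs_le_of_sq_le_sq' ?_ (by positivity) |>.2
  rw [mul_pow]
  linarith

variable {h} in
theorem H.toH_induction {P : H h → Prop} (hclosed : IsClosed {x | P x})
    (hP : ∀ a, P (toH h a)) (x : H h) : P x :=
  UniformSpace.Completion.induction_on x hclosed fun a => hP ((toPreH h).symm a)

variable {h} in
theorem H.ext_toH {f f' : H h →L[ℂ] H h} (hf : ∀ a, f (toH h a) = f' (toH h a)) : f = f' := by
  ext x
  exact H.toH_induction (isClosed_eq f.continuous f'.continuous) hf x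

/-- The canonical map from `A_c` to the GNS space, as a linear map. -/
def toHL : core G →ₗ[ℂ] H h :=
  UniformSpace.Completion.toComplL.toLinearMap ∘ₗ (toPreH h).toLinearMap

theorem toHL_apply (a : core G) : toHL h a = toH h a := rfl

theorem toH_zero : toH h 0 = 0 := map_zero (toHL h)

/-- Left multiplication by an element of `A_c` on the GNS space. -/
def leftH (a : core G) : H h →L[ℂ] H h :=
  (LinearMap.mkContinuous ((toPreH h).toLinearMap ∘ₗ LinearMap.mul ℂ (core G) a ∘ₗ
    (toPreH h).symm.toLinearMap) ‖(a : CStar G)‖ fun b => by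
      have := norm_toH_mul_le h a ((toPreH h).symm b)
      simp only [toH, UniformSpace.Completion.norm_coe] at this
      exact this).completion

theorem leftH_toH (a b : core G) : leftH h a (toH h b) = toH h (a * b) :=
  ContinuousLinearMap.completion_apply_coe _ _

theorem norm_leftH_le (a : core G) : ‖leftH h a‖ ≤ ‖(a : CStar G)‖ := by
  refine ContinuousLinearMap.opNorm_le_bound _ (norm_nonneg _) fun x => ?_
  refine H.toH_induction (P := fun x => ‖leftH h a x‖ ≤ ‖(a : CStar G)‖ * ‖x‖) ?_ ?_ x
  · exact isClosed_le (by fun_prop) (by fun_prop)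
  · intro b
    rw [leftH_toH]
    exact norm_toH_mul_le h a b

/-- Left multiplication by elements of `A_c`, as a linear map. -/
def leftHL : core G →ₗ[ℂ] (H h →L[ℂ] H h) where
  toFun := leftH h
  map_add' a b := H.ext_toH fun c => by
    rw [_root_.add_apply, leftH_toH, leftH_toH, leftH_toH, add_mul]
    exact map_add (toHL h) _ _
  map_smul' c a := H.ext_toH fun b => by
    rw [RingHom.id_apply, _root_.smul_apply, leftH_toH, leftH_toH, smul_mul_assoc]
    exact map_smul (toHL h) _ _

/-- The representation of `C⋆(G)` on the GNS space by left multiplication. -/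
def rep : CStar G →L[ℂ] (H h →L[ℂ] H h) := (leftHL h).extendOfNorm (coreIncl G)

/-- The representation is extended from `A_c` to `C⋆(G)` because the projection `q` need not lie in
`A_c`. -/
theorem rep_coe (a : core G) : rep h a = leftH h a :=
  LinearMap.extendOfNorm_eq (f := leftHL h) (e := coreIncl G) denseRange_coreIncl
    ⟨1, fun a => (norm_leftH_le h a).trans_eq (one_mul _).symm⟩ a

theorem rep_toH (a b : core G) : rep h a (toH h b) = toH h (a * b) := by
  rw [rep_coe, leftH_toH]

theorem norm_rep_le (a : CStar G) : ‖rep h a‖ ≤ ‖a‖ := by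
  have := LinearMap.norm_extendOfNorm_apply_le (f := leftHL h) (e := coreIncl G)
    denseRange_coreIncl 1 (fun a => (norm_leftH_le h a).trans_eq (one_mul _).symm) a
  rwa [one_mul] at this

theorem rep_mul (a b : CStar G) : rep h (a * b) = rep h a * rep h b := by
  have hc : Continuous (rep h) := (rep h).continuous
  refine CStar.dense_induction (P := fun a => rep h (a * b) = rep h a * rep h b) ?_ (fun a => ?_) a
  · exact isClosed_eq (by fun_prop) (by fun_prop)
  refine CStar.dense_induction (P := fun b => rep h ((a : CStar G) * b) = rep h a * rep h b) ?_ (fun b => ?_) b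
  · exact isClosed_eq (by fun_prop) (by fun_prop)
  refine H.ext_toH fun c => ?_
  change rep h ((a * b : core G) : CStar G) (toH h c) = rep h a (rep h b (toH h c))
  rw [rep_toH, rep_toH, rep_toH, mul_assoc]

theorem inner_rep (a : CStar G) (x y : H h) :
    inner ℂ (rep h a x) y = inner ℂ x (rep h (star a) y) := by
  have hc : Continuous (rep h) := (rep h).continuous
  refine CStar.dense_induction (P := fun a => inner ℂ (rep h a x) y = inner ℂ x (rep h (star a) y))
    ?_ (fun a => ?_) a
  · exact isClosed_eq (by fun_prop) (by fun_prop)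
  refine H.toH_induction (P := fun x => inner ℂ (rep h a x) y = inner ℂ x (rep h (star a) y))
    ?_ (fun b => ?_) x
  · exact isClosed_eq (by fun_prop) (by fun_prop)
  refine H.toH_induction (P := fun y => inner ℂ (rep h a _) y = inner ℂ _ (rep h (star a) y))
    ?_ (fun c => ?_) y
  · exact isClosed_eq (by fun_prop) (by fun_prop)
  have : star (a : CStar G) = (star a : core G) := rfl
  rw [this, rep_toH, rep_toH, inner_toH, inner_toH, StarMul.star_mul, mul_assoc]

namespace Sub

variable (M : G.Sub)

/-! ### The spectral projections of `D` on the GNS space -/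

/-- `φ(S_μ S_ν⋆)` vanishes unless `μ = ν`, in which case the degree is zero. -/
theorem phi_coreComponent (a : core G) : phi h (M.coreComponent 0 a) = phi h a := by
  refine core_induction (P := fun a => phi h (M.coreComponent 0 a) = phi h a) ?_ ?_ ?_ ?_ a
  · intro μ ν
    rw [coreComponent_gen]
    split_ifs with h1
    · rfl
    · classical
      rw [map_zero, phi_gen, if_neg]
      rintro rfl
      exact h1 (sub_self _)
  · simp only [map_zero]
  · intro a b ha hb; simp only [map_add, ha, hb]
  · intro c a ha; simp only [map_smul, ha]

theorem phi_eq_zero_of_isHomogeneous {k : ℤ} (hk : k ≠ 0) {a : core G}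
    (ha : M.IsHomogeneous k a) : phi h a = 0 := by
  have h1 : M.coreComponent 0 a = 0 := Subtype.ext ((ha.component_eq 0).trans (if_neg hk))
  rw [← phi_coreComponent h M, h1, map_zero]

/-- The component of degree `k` lies in the eigenspace, and the other components are orthogonal to
it because `φ` vanishes on elements of nonzero degree. -/
theorem projH_toH (k : ℤ) (a : core G) :
    M.projH h k (toH h a) = toH h (M.coreComponent k a) := by
  set S : Submodule ℂ (H h) := Submodule.span ℂ {x | ∃ μ ν : G.Path, (M.len μ : ℤ) - M.len ν = k ∧
    x = toH h (gen μ ν)} with hS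
  have key : toH h (M.coreComponent k a) ∈ S ∧
      toH h a - toH h (M.coreComponent k a) ∈ S.topologicalClosureᗮ := by
    refine core_induction (P := fun a => toHL h (M.coreComponent k a) ∈ S ∧
      toHL h a - toHL h (M.coreComponent k a) ∈ S.topologicalClosureᗮ) ?_ ?_ ?_ ?_ a
    · intro μ ν
      rw [coreComponent_gen]
      split_ifs with h1
      · rw [sub_self]
        exact ⟨Submodule.subset_span ⟨μ, ν, h1, rfl⟩, zero_mem _⟩
      · rw [map_zero, sub_zero]
        refine ⟨zero_mem _, ?_⟩
        rw [Submodule.orthogonal_closure, Submodule.mem_orthogonal]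
        intro x hx
        induction hx using Submodule.span_induction with
        | mem x hx =>
          obtain ⟨ρ, κ, h2, rfl⟩ := hx
          rw [toHL_apply, inner_toH]
          exact M.phi_eq_zero_of_isHomogeneous h (k := -(M.len ρ - M.len κ) +
            (M.len μ - M.len ν)) (by lia)
            ((isHomogeneous_gen ρ κ).adjoint.mul (isHomogeneous_gen μ ν))
        | zero => exact inner_zero_left _
        | add x y _ _ hx hy => rw [inner_add_left, hx, hy, add_zero]
        | smul c x _ hx => rw [inner_smul_left, hx, mul_zero]
    · simp only [map_zero, sub_zero]
      exact ⟨zero_mem _, zero_mem _⟩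
    · intro a b ha hb
      simp only [map_add, add_sub_add_comm]
      exact ⟨add_mem ha.1 hb.1, add_mem ha.2 hb.2⟩
    · intro c a ha
      simp only [map_smul, ← smul_sub]
      exact ⟨Submodule.smul_mem _ c ha.1, Submodule.smul_mem _ c ha.2⟩
  exact Submodule.eq_starProjection_of_mem_orthogonal
    (Submodule.le_topologicalClosure _ key.1) key.2

theorem projH_projH (j k : ℤ) (x : H h) :
    M.projH h j (M.projH h k x) = if j = k then M.projH h j x else 0 := by
  refine H.toH_induction
    (P := fun x => M.projH h j (M.projH h k x) = if j = k then M.projH h j x else 0) ?_ ?_ x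
  · split_ifs
    · exact isClosed_eq (by fun_prop) (by fun_prop)
    · exact isClosed_eq (by fun_prop) (by fun_prop)
  · intro a
    rw [projH_toH, projH_toH, projH_toH]
    have : M.coreComponent j (M.coreComponent k a) =
        if j = k then M.coreComponent j a else 0 := by
      refine Subtype.ext ((component_component j k (a : CStar G)).trans ?_)
      split_ifs <;> rfl
    rw [this]
    split_ifs
    · rfl
    · exact toH_zero h

theorem inner_projH (k : ℤ) (x y : H h) :
    inner ℂ (M.projH h k x) y = inner ℂ x (M.projH h k y) :=
  Submodule.inner_starProjection_left_eq_right _ x y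

/-- A homogeneous element of degree zero commutes with the spectral projections. -/
theorem projH_rep {q : CStar G} (hq : M.IsHomogeneous 0 q) (k : ℤ) (x : H h) :
    M.projH h k (rep h q x) = rep h q (M.projH h k x) := by
  have hc : Continuous (rep h) := (rep h).continuous
  have key : ∀ (a : CStar G) (x : H h), M.projH h k (rep h (M.component 0 a) x) =
      rep h (M.component 0 a) (M.projH h k x) := by
    intro a x
    refine CStar.dense_induction (P := fun a => M.projH h k (rep h (M.component 0 a) x) =
      rep h (M.component 0 a) (M.projH h k x)) ?_ (fun a => ?_) a
    · have := (M.component 0).continuous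
      exact isClosed_eq (by fun_prop) (by fun_prop)
    refine H.toH_induction (P := fun x => M.projH h k (rep h (M.component 0 a) x) =
      rep h (M.component 0 a) (M.projH h k x)) ?_ (fun b => ?_) x
    · exact isClosed_eq (by fun_prop) (by fun_prop)
    rw [← coe_coreComponent, rep_toH, projH_toH, projH_toH, rep_toH]
    congr 1
    refine Subtype.ext (((isHomogeneous_component 0 (a : CStar G)).component_mul k b).trans ?_)
    rw [sub_zero]; rfl
  have h1 := hq.component_eq 0
  rw [if_pos rfl] at h1
  rw [← h1]
  exact key q x

/-- Bessel's inequality for the mutually orthogonal eigenspaces. It allows a bounded operator to be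
moved inside the series that defines `unitaryD`. -/
theorem summable_smul_projH (c : ℤ → ℂ) (hc : ∀ k, ‖c k‖ = 1) (x : H h) :
    Summable fun k => c k • M.projH h k x := by
  have hV : OrthogonalFamily ℂ (fun k : ℤ => LinearMap.range (M.projH h k).toLinearMap)
      fun k => (LinearMap.range (M.projH h k).toLinearMap).subtypeₗᵢ := by
    rintro j k hjk ⟨_, y, rfl⟩ ⟨_, z, rfl⟩
    change inner ℂ (M.projH h j y) (M.projH h k z) = 0
    rw [inner_projH, projH_projH, if_neg hjk, inner_zero_right]
  have h1 := hV.summable_iff_norm_sq_summable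
    (fun k => c k • ⟨M.projH h k x, x, rfl⟩)
  change Summable (fun k => c k • M.projH h k x) ↔
    Summable fun k => ‖c k • M.projH h k x‖ ^ 2 at h1
  rw [h1]
  simp only [norm_smul, hc, one_mul]
  refine summable_of_sum_le (c := ‖x‖ ^ 2) (fun k => sq_nonneg _) fun s => ?_
  have h2 : ∀ k, ((‖M.projH h k x‖ ^ 2 : ℝ) : ℂ) = inner ℂ x (M.projH h k x) := fun k => by
    have := M.projH_projH h k k x
    rw [if_pos rfl] at this
    nth_rw 2 [← this]
    rw [← inner_projH, inner_self_eq_norm_sq_to_K]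
    push_cast; rfl
  have h3 : ((∑ k ∈ s, ‖M.projH h k x‖ ^ 2 : ℝ) : ℂ) = inner ℂ x (∑ k ∈ s, M.projH h k x) := by
    rw [inner_sum, Complex.ofReal_sum]
    exact Finset.sum_congr rfl fun k _ => h2 k
  have h4 : ‖∑ k ∈ s, M.projH h k x‖ ^ 2 = ∑ k ∈ s, ‖M.projH h k x‖ ^ 2 :=
    hV.norm_sum (fun k => ⟨M.projH h k x, x, rfl⟩) s
  -- For the finite sum `P` of eigenprojections, `‖P x‖² = ⟨x, P x⟩ ≤ ‖x‖ ‖P x‖`, hence `‖P x‖ ≤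
  -- ‖x‖`.
  have h5 : ∑ k ∈ s, ‖M.projH h k x‖ ^ 2 ≤ ‖x‖ * ‖∑ k ∈ s, M.projH h k x‖ := by
    have := norm_inner_le_norm (𝕜 := ℂ) x (∑ k ∈ s, M.projH h k x)
    rw [← h3, Complex.norm_real, Real.norm_of_nonneg (Finset.sum_nonneg fun k _ => sq_nonneg _)]
      at this
    exact this
  rw [← h4] at h5 ⊢
  nlinarith [norm_nonneg x, norm_nonneg (∑ k ∈ s, M.projH h k x),
    sq_nonneg (‖x‖ - ‖∑ k ∈ s, M.projH h k x‖)]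

end Sub

end GNS

/-! ### Grading by length and the generators in `A_c` -/

section KMS

variable (G) in
/-- The graph, as a subgraph of itself. -/
def fullSub : G.Sub := ⟨Set.univ, Set.univ, fun _ _ => trivial, fun _ _ => trivial⟩

/-- With the whole graph in the role of `M`, the degree counts all edges. This grading detects when
`φ` has to vanish for reasons of length. -/
theorem fullSub_len (μ : G.Path) : (fullSub G).len μ = μ.edges.length :=
  Sub.len_eq_length fun _ _ => trivial

/-- The element `S_e` of `A_c`. -/
def coreS (e : Edge) : core G := ⟨univS e, univS_eq_gen e ▸ Subtype.property _⟩

/-- The element `p_v` of `A_c`. -/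
def coreP (v : V) : core G := ⟨univP v, univP_eq_gen v ▸ Subtype.property _⟩

variable [Countable V] [Countable Edge] {g : V → ℝ} {lam : Edge → ℝ}
  (h : IsGraphWeight G g lam)

/-! ### The functional of a graph weight is a KMS functional -/

/-- The twisted commutation relation `φ(x b) = c φ(b x)`. -/
def IsKMS (c : ℝ) (x : core G) : Prop := ∀ b, phi h (x * b) = c * phi h (b * x)

variable {h}

theorem IsKMS.mul {c d : ℝ} {x y : core G} (hx : IsKMS h c x) (hy : IsKMS h d y) :
    IsKMS h (c * d) (x * y) := fun b => by
  rw [mul_assoc, hx, mul_assoc, hy, mul_assoc, Complex.ofReal_mul, mul_assoc]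

/-- Apply the relation to `b⋆` and conjugate; `c` is real and `φ` is hermitian, so the two sides
change places. -/
theorem IsKMS.adjoint {c : ℝ} (hc : c ≠ 0) {x : core G} (hx : IsKMS h c x) :
    IsKMS h c⁻¹ (star x) := fun b => by
  have hc' : (c : ℂ) ≠ 0 := by exact_mod_cast hc
  have h1 := congrArg star (hx (star b))
  rw [star_mul', ← phi_star, ← phi_star, StarMul.star_mul, StarMul.star_mul, star_star,
    Complex.star_def, Complex.conj_ofReal] at h1
  rw [h1, Complex.ofReal_inv, inv_mul_cancel_left₀ hc']

theorem IsKMS.of_gen {c : ℝ} {x : core G}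
    (hx : ∀ α β, phi h (x * gen α β) = c * phi h (gen α β * x)) : IsKMS h c x := by
  refine core_induction (P := fun b => phi h (x * b) = c * phi h (b * x)) hx ?_ ?_ ?_
  · simp only [mul_zero, zero_mul, map_zero]
  · intro a b ha hb; simp only [mul_add, add_mul, map_add, ha, hb]
  · intro k a ha
    simp only [mul_smul_comm, smul_mul_assoc, map_smul, ha, smul_eq_mul, mul_left_comm]

variable (h)

/-- Multiplying `S_α S_β⋆` by `p_v` on the left tests `v = s(α)` and on the right `v = s(β)`. The
tests agree when `α = β`, and otherwise `φ` vanishes on both products. -/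
theorem isKMS_coreP (v : V) : IsKMS h 1 (coreP v) := by
  classical
  refine IsKMS.of_gen fun α β => ?_
  have h1 : coreP v * gen α β = if v = α.src then gen α β else 0 := by
    refine Subtype.ext ?_
    change (univFamily G).p v * ((univFamily G).path α * star ((univFamily G).path β)) = _
    rw [← mul_assoc]
    split_ifs with hv
    · rw [hv, (univFamily G).p_mul_path]; rfl
    · rw [(univFamily G).p_mul_path_of_ne hv, zero_mul]; rfl
  have h2 : gen α β * coreP v = if v = β.src then gen α β else 0 := by
    refine Subtype.ext ?_
    change (univFamily G).path α * star ((univFamily G).path β) * (univFamily G).p v = _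
    rw [← (univFamily G).star_p, mul_assoc, ← StarMul.star_mul]
    split_ifs with hv
    · rw [hv, (univFamily G).p_mul_path]; rfl
    · rw [(univFamily G).p_mul_path_of_ne hv, star_zero, mul_zero]; rfl
  rw [h1, h2, Complex.ofReal_one, one_mul]
  by_cases hαβ : α = β
  · rw [hαβ]
  · rw [apply_ite (phi h), apply_ite (phi h), phi_gen, if_neg hαβ, map_zero, ite_self, ite_self]

/-- By length, both sides vanish unless `β = f κ` with `|κ| = |α|`. Then `S_e S_α S_β⋆` is `S_{eα}
S_β⋆` or `0`, and `S_α S_β⋆ S_e` is `S_α S_κ⋆` if `f = e` and `0` otherwise. Both values of `φ`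
require `β = e α`, and the extra edge contributes the factor `lam e`. -/
theorem isKMS_coreS (e : Edge) : IsKMS h (lam e) (coreS e) := by
  classical
  refine IsKMS.of_gen fun α β => ?_
  have hS : (fullSub G).IsHomogeneous 1 (coreS (G := G) e) := by
    have := Sub.isHomogeneous_S (M := fullSub G) e
    rwa [if_pos (show e ∈ (fullSub G).edges from trivial)] at this
  have hg := Sub.isHomogeneous_gen (M := fullSub G) α β
  rw [fullSub_len, fullSub_len] at hg
  by_cases hl : β.edges.length = α.edges.length + 1
  swap
  · rw [(fullSub G).phi_eq_zero_of_isHomogeneous h (a := coreS e * gen α β) (by lia) (hS.mul hg),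
      (fullSub G).phi_eq_zero_of_isHomogeneous h (a := gen α β * coreS e) (by lia) (hg.mul hS),
      mul_zero]
  obtain ⟨w, k, hw⟩ := β
  match k, hw, hl with
  | f :: k, hw, hl =>
    have h1 : coreS e * gen α ⟨w, f :: k, hw⟩ = if hα : G.r e = α.src then
        gen ⟨G.s e, e :: α.edges, rfl, hα ▸ α.isWalk⟩ ⟨w, f :: k, hw⟩ else 0 := by
      refine Subtype.ext ?_
      change (univFamily G).S e * ((univFamily G).path α * star _) = _
      split_ifs with hα
      · rw [← mul_assoc]
        change _ = (univFamily G).S e * (univFamily G).walk (G.r e) α.edges * star _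
        rw [hα]; rfl
      · rw [← (univFamily G).S_mul_p, mul_assoc, ← mul_assoc (CKFamily.p _ _),
          (univFamily G).p_mul_path_of_ne hα, zero_mul, mul_zero]
        rfl
    have h2 : gen α ⟨w, f :: k, hw⟩ * coreS e =
        if f = e then gen α ⟨G.r f, k, hw.2⟩ else 0 := by
      refine Subtype.ext ?_
      change (univFamily G).path α * star ((univFamily G).S f * (univFamily G).walk (G.r f) k) *
        (univFamily G).S e = _
      rw [StarMul.star_mul, mul_assoc, mul_assoc (star ((univFamily G).walk _ _))]
      split_ifs with hfe
      · subst hfe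
        rw [(univFamily G).star_mul]
        have := congrArg star ((univFamily G).p_mul_walk hw.2)
        rw [StarMul.star_mul, (univFamily G).star_p] at this
        rw [this]; rfl
      · rw [(univFamily G).star_S_mul_S hfe, mul_zero, mul_zero]; rfl
    rw [h1, h2]
    by_cases hfe : f = e
    · subst hfe
      rw [if_pos rfl, phi_gen]
      split_ifs with hα h3 h3
      · subst h3
        have heq : (⟨G.s f, f :: k, rfl, hw.2⟩ : G.Path) = ⟨w, f :: k, hw⟩ := Path.ext hw.1 rfl
        rw [phi_gen]
        refine (if_pos heq).trans ?_
        change ((((f :: k).map lam).prod : ℝ) : ℂ) * g (G.walkEnd (G.r f) k) = _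
        rw [List.map_cons, List.prod_cons, Complex.ofReal_mul, mul_assoc]
        rfl
      · rw [phi_gen, if_neg, mul_zero]
        intro h4
        have h5 : α.edges = k := List.tail_eq_of_cons_eq (congrArg Path.edges h4)
        exact h3 (Path.ext hα.symm h5)
      · exact absurd (congrArg Path.src h3).symm hα
      · rw [map_zero, mul_zero]
    · rw [if_neg hfe, map_zero, mul_zero]
      split_ifs with hα
      · rw [phi_gen, if_neg]
        intro h4
        exact hfe (List.head_eq_of_cons_eq (congrArg Path.edges h4)).symm
      · exact map_zero _

end KMS

/-! ### The trace property in degree zero -/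

namespace Sub

variable {M : G.Sub} [Countable V] [Countable Edge] {g : V → ℝ} {c : ℝ}
  (h : IsGraphWeight G g (M.edgeWeight c))

theorem isKMS_corePath (μ : G.Path) : IsKMS h (c ^ M.len μ) (corePath μ) := by
  classical
  obtain ⟨v, l, hl⟩ := μ
  induction l generalizing v with
  | nil =>
    have := isKMS_coreP h v
    rwa [← pow_zero c] at this
  | cons e l ih =>
    have := (isKMS_coreS h e).mul (ih (G.r e) hl.2)
    change IsKMS h _ (coreS e * corePath ⟨G.r e, l, hl.2⟩)
    convert this using 1
    simp only [Sub.len, List.countP_cons, decide_eq_true_eq, edgeWeight]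
    split_ifs
    · rw [pow_succ, mul_comm]
    · rw [add_zero, one_mul]

/-- The functional is a trace on the elements of degree zero. -/
theorem phi_coreComponent_mul (hc : c ≠ 0) (a b : core G) :
    phi h (M.coreComponent 0 a * b) = phi h (b * M.coreComponent 0 a) := by
  refine core_induction (P := fun a => phi h (M.coreComponent 0 a * b) =
    phi h (b * M.coreComponent 0 a)) ?_ ?_ ?_ ?_ a
  · intro μ ν
    rw [coreComponent_gen]
    split_ifs with hμν
    -- `S_μ S_ν⋆` has KMS factor `c ^ |μ|_σ` times the inverse of `c ^ |ν|_σ`, which is `1` in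
    -- degree zero.
    · have h1 := (isKMS_corePath h μ).mul ((isKMS_corePath h ν).adjoint (pow_ne_zero _ hc))
      have h2 : M.len μ = M.len ν := by lia
      rw [h2, mul_inv_cancel₀ (pow_ne_zero _ hc)] at h1
      have h3 := h1 b
      rwa [Complex.ofReal_one, one_mul] at h3
    · rw [zero_mul, mul_zero]
  · simp only [map_zero, zero_mul, mul_zero]
  · intro a a' ha ha'; simp only [map_add, add_mul, mul_add, ha, ha']
  · intro k a ha; simp only [map_smul, smul_mul_assoc, mul_smul_comm, ha]

/-- `⟨ξ, Θ_{x,x} ξ⟩ = φ((x | ξ) (ξ | x))`. -/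
theorem phi_theta (hc : c ≠ 0) (ξ x : core G) :
    phi h (star ξ * (x * M.coreComponent 0 (star x * ξ))) =
      phi h (star (M.coreComponent 0 (star ξ * x)) * M.coreComponent 0 (star ξ * x)) := by
  have h1 : M.coreComponent 0 ((star ξ * x) * M.coreComponent 0 (star x * ξ)) =
      M.coreComponent 0 (star ξ * x) * M.coreComponent 0 (star x * ξ) := Subtype.ext (by
    change M.component 0 (((star ξ * x : core G) : CStar G) * M.component 0 _) =
      M.component 0 _ * M.component 0 _
    simp only [← expect_eq_component]
    exact M.expect_mul_expect _ _)
  -- First `φ = φ ∘ Φ`, then `Φ(a Φ(b)) = Φ(a) Φ(b)`, and finally the trace property exchanges the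
  -- two factors of degree zero.
  rw [← mul_assoc, ← phi_coreComponent h M, h1, star_coreComponent_zero,
    phi_coreComponent_mul h hc, StarMul.star_mul, star_star]

/-! ### The operator `q Φ_m` on the GNS space -/

/-- The operator `q Φ_m` on the GNS space. -/
def repProj (m : ℤ) (q : CStar G) : H h →L[ℂ] H h := (rep h q).comp (M.projH h m)

variable {h}

theorem repProj_apply (m : ℤ) (q : CStar G) (x : H h) :
    repProj h m q x = rep h q (M.projH h m x) := rfl

/-- Approximate `q` by `b ∈ A_c`. The products of `b` with the component of `a` lie in `A_c` and
converge both in `X` and in the GNS space, as a common approximation demands. -/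
theorem represents_repProj (m : ℤ) (q : CStar G) :
    M.Represents h (fun x => M.lmul q (M.specProj m x)) (repProj h m q) := by
  intro a
  change (M.lmul q (M.specProj m (M.toX a)), _) ∈ _
  rw [specProj_toX, lmul_toX, repProj_apply, projH_toH]
  let f : CStar G → M.X × H h := fun b => (M.toXL (b * M.component m a),
    rep h b (toH h (M.coreComponent m a)))
  have hf : Continuous f := by
    have h1 := (rep h).continuous
    exact (M.toXL.continuous.comp (continuous_mul_const _)).prodMk
      (h1.clm_apply continuous_const)
  have key : f q ∈ closure {x : M.X × H h | ∃ b : core G, x = (M.toX b, toH h b)} :=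
    map_mem_closure hf (dense_core q) fun b hb => ⟨⟨b, hb⟩ * M.coreComponent m a,
      Prod.ext rfl (rep_toH h ⟨b, hb⟩ (M.coreComponent m a))⟩
  exact key

theorem repProj_projH (m k : ℤ) (q : CStar G) (x : H h) :
    repProj h m q (M.projH h k x) = if k = m then repProj h m q x else 0 := by
  rw [repProj_apply, projH_projH]
  by_cases hk : m = k
  · rw [if_pos hk, if_pos hk.symm]; rfl
  · rw [if_neg hk, if_neg (Ne.symm hk), map_zero]

theorem projH_repProj {q : CStar G} (hq : M.IsHomogeneous 0 q) (m k : ℤ) (x : H h) :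
    M.projH h k (repProj h m q x) = if k = m then repProj h m q x else 0 := by
  rw [repProj_apply, projH_rep h M hq, projH_projH]
  split_ifs with hk
  · rw [hk]
  · exact map_zero _

theorem inner_repProj {q : CStar G} (hq : M.IsHomogeneous 0 q) (hq' : IsSelfAdjoint q) (m : ℤ)
    (x y : H h) : inner ℂ (repProj h m q x) y = inner ℂ x (repProj h m q y) := by
  rw [repProj_apply, inner_rep, inner_projH, hq'.star_eq, projH_rep h M hq]
  rfl

theorem repProj_repProj {q : CStar G} (hq : M.IsHomogeneous 0 q) (hq' : IsIdempotentElem q) (m : ℤ)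
    (x : H h) : repProj h m q (repProj h m q x) = repProj h m q x := by
  rw [repProj_apply m q (repProj h m q x), projH_repProj hq, if_pos rfl, repProj_apply]
  change (rep h q * rep h q) (M.projH h m x) = _
  rw [← rep_mul, hq'.eq]

/-- For a projection `q ∈ F` the factors `q` and `Φ_m` commute, so their product is an orthogonal
projection. -/
theorem inner_repProj_self {q : CStar G} (hq : M.IsHomogeneous 0 q) (hq' : IsStarProjection q)
    (m : ℤ) (x : H h) : inner ℂ x (repProj h m q x) = ((‖repProj h m q x‖ ^ 2 : ℝ) : ℂ) := by
  rw [← repProj_repProj hq hq'.isIdempotentElem, ← inner_repProj hq hq'.isSelfAdjoint,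
    inner_self_eq_norm_sq_to_K, repProj_repProj hq hq'.isIdempotentElem]
  push_cast; rfl

theorem isPositive_repProj {q : CStar G} (hq : M.IsHomogeneous 0 q) (hq' : IsStarProjection q)
    (m : ℤ) : (repProj h m q).IsPositive := by
  refine ⟨fun x y => inner_repProj hq hq'.isSelfAdjoint m x y, fun x => ?_⟩
  change 0 ≤ RCLike.re (inner ℂ (repProj h m q x) x)
  rw [inner_repProj hq hq'.isSelfAdjoint, inner_repProj_self hq hq']
  exact sq_nonneg _

/-- The operator represents a finite rank endomorphism, so it is among the generators of `N`. It
lives on the single eigenspace for `m`, so composing it with `c ^ (i t D)` on either side multiplies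
it by `c ^ (i t m)`. -/
theorem repProj_mem_modularFixed (hc : 0 < c) {m : ℤ} {q : CStar G} (hq : M.IsHomogeneous 0 q)
    (hK : M.IsFiniteRank fun x => M.lmul q (M.specProj m x)) :
    repProj h m q ∈ M.modularFixed h c := by
  refine ⟨Set.subset_centralizer_centralizer
    ⟨_, isCompactEnd_of_isFiniteRank hK, represents_repProj m q⟩, fun t x => ?_⟩
  have hnorm : ∀ k : ℤ, ‖(c : ℂ) ^ (Complex.I * t * k)‖ = 1 := fun k => by
    rw [Complex.norm_cpow_eq_rpow_re_of_pos hc]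
    simp
  rw [unitaryD, unitaryD, (repProj h m q).map_tsum (M.summable_smul_projH h _ hnorm x)]
  refine tsum_congr fun k => ?_
  rw [map_smul, repProj_projH, projH_repProj hq]

/-- On the eigenspace for `m` the truncated `c ^ (D / 2)` is the scalar `c ^ (m / 2)`, or `0` if `m`
is cut off. The bound is independent of `n`, as the supremum in `weightD` requires. -/
theorem sqrtD_mul_repProj_mul_sqrtD {q : CStar G} (hq : M.IsHomogeneous 0 q) (m : ℤ) (n : ℕ) :
    ∃ z : ℂ, ‖z‖ ≤ ‖(c : ℂ) ^ ((m : ℂ) / 2)‖ ^ 2 ∧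
      M.sqrtD h c n * repProj h m q * M.sqrtD h c n = z • repProj h m q := by
  set w : ℤ → ℂ := fun k => (c : ℂ) ^ ((k : ℂ) / 2) with hw
  set d : ℂ := if m ∈ Finset.Icc (-n : ℤ) n then w m else 0 with hd
  have happ : ∀ y, M.sqrtD h c n y = ∑ k ∈ Finset.Icc (-n : ℤ) n, w k • M.projH h k y := fun y => by
    rw [sqrtD, _root_.sum_apply]; rfl
  have h1 : ∀ y, M.sqrtD h c n (repProj h m q y) = d • repProj h m q y := fun y => by
    rw [happ]
    simp only [projH_repProj hq, smul_ite, smul_zero]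
    rw [Finset.sum_ite_eq', hd, ite_smul, zero_smul]
  have h2 : ∀ y, repProj h m q (M.sqrtD h c n y) = d • repProj h m q y := fun y => by
    rw [happ, map_sum]
    simp only [map_smul, repProj_projH, smul_ite, smul_zero]
    rw [Finset.sum_ite_eq', hd, ite_smul, zero_smul]
  refine ⟨d * d, ?_, ?_⟩
  · have h3 : ‖d‖ ≤ ‖w m‖ := by
      rw [hd]
      split_ifs
      · exact le_rfl
      · rw [norm_zero]; exact norm_nonneg _
    rw [norm_mul, sq]
    exact mul_le_mul h3 h3 (norm_nonneg _) (norm_nonneg _)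
  · ext y
    change M.sqrtD h c n (repProj h m q (M.sqrtD h c n y)) = (d * d) • repProj h m q y
    rw [h2, map_smul, h1, smul_smul]

/-- If `p_v Φ_m = ∑ⱼ Θ_{xⱼ,xⱼ}` and `q ≤ p_v` then
`⟨ξ, q Φ_m ξ⟩ ≤ ∑ⱼ φ((xⱼ | ξ) (ξ | xⱼ))`. -/
theorem norm_repProj_sq_le (hc : c ≠ 0) {q : CStar G} (hq' : IsStarProjection q) {v : V} (hqv :
    q * (univFamily G).p v = q) (m : ℤ) {k : ℕ} {x : Fin k → core G}
    (hx : ∀ a, (univFamily G).p v * M.component m a =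
      ∑ j, (x j : CStar G) * M.expect (star (x j : CStar G) * a)) (ξ : core G) :
    ‖repProj h m q (toH h ξ)‖ ^ 2 ≤ ∑ j, (phi h (star (M.coreComponent 0 (star ξ * x j)) *
      M.coreComponent 0 (star ξ * x j))).re := by
  -- `q Φ_m = q p_v Φ_m` and `‖q‖ ≤ 1`. Passing to `p_v` is what gives access to vectors `x_j ∈
  -- A_c`.
  have h1 : ‖repProj h m q (toH h ξ)‖ ≤
      ‖repProj h m ((univFamily G).p v) (toH h ξ)‖ := by
    have h2 : repProj h m q (toH h ξ) =
        rep h q (repProj h m ((univFamily G).p v) (toH h ξ)) := by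
      change _ = (rep h q * rep h ((univFamily G).p v)) (M.projH h m (toH h ξ))
      rw [← rep_mul, hqv]; rfl
    rw [h2]
    refine (ContinuousLinearMap.le_of_opNorm_le _
      ((norm_rep_le h q).trans hq'.norm_le) _).trans_eq (one_mul _)
  have h3 : repProj h m ((univFamily G).p v) (toH h ξ) =
      toH h (∑ j, x j * M.coreComponent 0 (star (x j) * ξ)) := by
    rw [repProj_apply, projH_toH]
    refine (rep_toH h (coreP v) _).trans (congrArg (toH h) (Subtype.ext ?_))
    refine (hx ξ).trans ?_
    simp only [expect_eq_component]
    exact (map_sum (coreIncl G) (fun j => x j * M.coreComponent 0 (star (x j) * ξ))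
      Finset.univ).symm
  have h4 : ((‖repProj h m ((univFamily G).p v) (toH h ξ)‖ ^ 2 : ℝ) : ℂ) =
      ∑ j, phi h (star (M.coreComponent 0 (star ξ * x j)) *
        M.coreComponent 0 (star ξ * x j)) := by
    rw [← inner_repProj_self (isHomogeneous_p v) ((univFamily G).isProj v), h3, inner_toH,
      Finset.mul_sum, map_sum]
    exact Finset.sum_congr rfl fun j _ => phi_theta h hc ξ (x j)
  have h5 := congrArg Complex.re h4
  rw [Complex.ofReal_re, Complex.re_sum] at h5
  rw [← h5]
  exact pow_le_pow_left₀ (norm_nonneg _) h1 2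

/-- Every family allowed in the trace gives at most `|c ^ (m / 2)|² ∑_j φ(x_j⋆ x_j)`, whatever the
truncation: for each `j` the tracial form of `⟨ξ_i, Θ_{x_j,x_j} ξ_i⟩`, summed over `i`, is bounded
by `φ((x_j | x_j))`. -/
theorem weightD_repProj_lt_top (hc : c ≠ 0) {q : CStar G} (hq : M.IsHomogeneous 0 q)
    (hq' : IsStarProjection q) {v : V} (hqv : q * (univFamily G).p v = q) (m : ℤ) {k : ℕ}
    {x : Fin k → core G} (hx : ∀ a, (univFamily G).p v * M.component m a =
      ∑ j, (x j : CStar G) * M.expect (star (x j : CStar G) * a)) :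
    M.weightD h c (repProj h m q) < ⊤ := by
  set r : ℝ := ‖(c : ℂ) ^ ((m : ℂ) / 2)‖ ^ 2
  set C : ℝ := ∑ j, (phi h (star (x j) * x j)).re
  refine lt_of_le_of_lt (b := ENNReal.ofReal (r * C)) ?_ ENNReal.ofReal_lt_top
  refine iSup_le fun n => iSup_le fun N => iSup_le fun ξ => iSup_le fun hξ =>
    ENNReal.ofReal_le_ofReal ?_
  obtain ⟨z, hz, hT⟩ := sqrtD_mul_repProj_mul_sqrtD (h := h) hq m n
  rw [hT]
  have h1 : ∀ i, (inner ℂ (toH h (ξ i)) ((z • repProj h m q) (toH h (ξ i)))).re ≤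
      r * ∑ j, (phi h (star (M.coreComponent 0 (star (ξ i) * x j)) *
        M.coreComponent 0 (star (ξ i) * x j))).re := fun i => by
    rw [_root_.smul_apply, inner_smul_right, inner_repProj_self hq hq', Complex.re_mul_ofReal]
    exact mul_le_mul (((Complex.re_le_norm z).trans hz)) (norm_repProj_sq_le hc hq' hqv m hx (ξ i))
      (sq_nonneg _) (sq_nonneg _)
  refine (Finset.sum_le_sum fun i _ => h1 i).trans ?_
  rw [← Finset.mul_sum]
  refine mul_le_mul_of_nonneg_left ?_ (sq_nonneg _)
  rw [Finset.sum_comm]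
  refine Finset.sum_le_sum fun j _ => ?_
  -- The constraint `∑ Θ_{ξ_i,ξ_i} ≤ 1`, tested at the vector `x_j`. It is an inequality in `C⋆(G)`,
  -- to which `φ` is applied through `phi_mono`.
  have h2 := hξ (M.toX (x j))
  simp only [ip_toX] at h2
  have h3 : ((∑ i, star (M.coreComponent 0 (star (ξ i) * x j)) *
      M.coreComponent 0 (star (ξ i) * x j) : core G) : CStar G) ≤
      (M.coreComponent 0 (star (x j) * x j) : core G) := by
    refine le_trans (le_of_eq ?_) (h2.trans_eq (M.expect_eq_component _))
    refine (map_sum (coreIncl G) _ _).trans (Finset.sum_congr rfl fun i _ => ?_)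
    rw [star_coreComponent_zero, StarMul.star_mul, star_star, expect_eq_component,
      expect_eq_component]
    rfl
  have h4 := phi_mono h h3
  rw [map_sum, phi_coreComponent] at h4
  have h5 := (Complex.le_def.1 h4).1
  rwa [Complex.re_sum] at h5

end Sub

end LFGraph

end

/-- For projections, `q ≤ p_v` is the equation `q p_v = q`, and `q ∈ F` is invariance under every
`M.act z`. The finset `P` of the third formula records that `|v|_m` is finite, and its positive
cardinality that the division makes sense. -/
theorem proposition5p1 {V Edge : Type u} [Countable V] [Countable Edge] (G : LFGraph V Edge)
    (M : G.Sub) (hM : LFGraph.IsZhyvot M) (hT : LFGraph.HasExteriorTrees M)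
    (g : V → ℝ) (lam : ℝ) (hlam0 : 0 < lam) (hlam1 : lam < 1)
    (hg : LFGraph.IsGraphWeight G g (M.edgeWeight lam)) :
    ∃ Φ : ℤ → M.X → M.X, M.IsSpectralResolution Φ ∧
      (∀ m : ℕ, 0 < m → ∀ x, HasSum
        (fun μ : {μ : G.Path // M.len μ = m ∧ μ.src ∈ M.verts ∧ μ.rng ∈ M.verts} =>
          M.theta (M.toX ((LFGraph.univFamily G).path μ.1))
            (M.toX ((LFGraph.univFamily G).path μ.1)) x)
        (Φ m x)) ∧
      (∀ x, HasSum (fun v : V => M.theta (M.toX ((LFGraph.univFamily G).p v))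
        (M.toX ((LFGraph.univFamily G).p v)) x) (Φ 0 x)) ∧
      (∀ m : ℕ, 0 < m → ∀ v : V, ∃ P : Finset G.Path,
        (∀ μ, μ ∈ P ↔ M.len μ = m ∧ μ.rng = v) ∧ 0 < P.card ∧
        ∀ x, M.lmul ((LFGraph.univFamily G).p v) (Φ (-m) x) =
          (P.card : ℂ)⁻¹ • ∑ μ ∈ P, M.theta (M.toX (star ((LFGraph.univFamily G).path μ)))
            (M.toX (star ((LFGraph.univFamily G).path μ))) x) ∧
      (∀ (m : ℤ) (v : V) (q : LFGraph.CStar G), IsStarProjection q →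
        q * (LFGraph.univFamily G).p v = q →
        M.IsFiniteRank (fun x => M.lmul q (Φ m x)) ∧
        ((∀ z, M.act z q = q) →
          ∃ T : LFGraph.H hg →L[ℂ] LFGraph.H hg,
            M.Represents hg (fun x => M.lmul q (Φ m x)) T ∧
            T ∈ M.modularFixed hg lam ∧ T.IsPositive ∧ M.weightD hg lam T < ⊤)) := by
  have hrank := fun (m : ℤ) (v : V) (q : LFGraph.CStar G)
    (hqv : q * (LFGraph.univFamily G).p v = q) =>
    LFGraph.Sub.exists_lmul_specProj_eq hM hT m hqv
  refine ⟨fun m => M.specProj m, M.isSpectralResolution_specProj,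
    fun m hm x => LFGraph.Sub.hasSum_theta_path hT hm x, M.hasSum_theta_p,
    fun m _ v => ?_, fun m v q hq hqv => ⟨hrank m v q hqv, fun hq0 => ?_⟩⟩
  · obtain ⟨P, hP, hcard⟩ := LFGraph.Sub.exists_pathsTo hM hT m v
    refine ⟨P, hP, hcard, fun x => ?_⟩
    -- Every summand equals `p_v Φ_{-m}`, so the sum is `|v|_m` times it.
    have h1 : ∀ μ ∈ P, M.theta (M.toX (star ((LFGraph.univFamily G).path μ)))
        (M.toX (star ((LFGraph.univFamily G).path μ))) x =
        M.lmul ((LFGraph.univFamily G).p v) (M.specProj (-m) x) := fun μ hμ => by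
      rw [LFGraph.Sub.theta_star_path, ((hP μ).1 hμ).1, ((hP μ).1 hμ).2]
    have hcard' : (P.card : ℂ) ≠ 0 := by exact_mod_cast hcard.ne'
    rw [Finset.sum_congr rfl h1, Finset.sum_const, ← Nat.cast_smul_eq_nsmul ℂ, smul_smul,
      inv_mul_cancel₀ hcard', one_smul]
  · have hhom : M.IsHomogeneous 0 q := fun z => by
      rw [hq0, zpow_zero, Circle.coe_one, one_smul]
    obtain ⟨k, x, hx⟩ := LFGraph.Sub.exists_p_mul_component hM hT m v
    exact ⟨LFGraph.Sub.repProj hg m q, LFGraph.Sub.represents_repProj m q,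
      LFGraph.Sub.repProj_mem_modularFixed hlam0 hhom (hrank m v q hqv),
      LFGraph.Sub.isPositive_repProj hhom hq m,
      LFGraph.Sub.weightD_repProj_lt_top hlam0.ne' hhom hq hqv m hx⟩
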